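/- Let $\hbar>0$, $\theta_1,\theta_2\in\mathbb R$ and $\mathcal S_1=\{(s_{\rm ph},s_1,s_2)\in\mathbb R^3: s_1<s_{\rm ph}<s_2\}$, with boundary faces $\mathcal C_1=\{s_1=s_{\rm ph}<s_2\}$ and $\mathcal C_2=\{s_1<s_{\rm ph}=s_2\}$. Wave functions $\Psi\in L^2(\mathcal S_1,\mathbb C^8)$ have components $\psi_{\varsigma_0\varsigma_1\varsigma_2}$, $\varsigma_j\in\{-,+\}$. Let $\hat H$ be the massless ($m_{\rm e}=0$) Hamiltonian with domain $C_c^\infty(\mathcal S_1,\mathbb C^8)$, $$\hat H=-i\hbar\big(\gamma^0\gamma^1\partial_{s_{\rm ph}}\otimes 1\otimes 1+1\otimes\gamma^0\gamma^1\partial_{s_1}\otimes 1+1\otimes 1\otimes\gamma^0\gamma^1\partial_{s_2}\big),\qquad \gamma^0\gamma^1=\mathrm{diag}(1,-1)\ \text{in the basis } (-,+),$$ that is, $(\hat H\Psi)_{\varsigma_0\varsigma_1\varsigma_2}=i\hbar(\varsigma_0\partial_{s_{\rm ph}}+\varsigma_1\partial_{s_1}+\varsigma_2\partial_{s_2})\psi_{\varsigma_0\varsigma_1\varsigma_2}$.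 For $\epsilon>0$ let $\mu_\epsilon:[0,\infty)\to[0,1]$ be smooth, equal to $0$ on $[0,\epsilon]$ and to $1$ on $[2\epsilon,\infty)$; let $\mu_0\equiv1$. For $\epsilon\ge0$ let $\hat H_\epsilon$ be the restriction of $\hat H^*$ to those $\Psi\in D(\hat H^*)$ whose traces satisfy the leaky boundary conditions $$\psi_{-+\varsigma_2}=e^{i\theta_1}\mu_\epsilon(|s_1-s_2|)\,\psi_{+-\varsigma_2}\ \text{on }\mathcal C_1,\qquad \psi_{+\varsigma_1-}=e^{i\theta_2}\mu_\epsilon(|s_1-s_2|)\,\psi_{-\varsigma_1+}\ \text{on }\mathcal C_2 .$$ Traces are taken in the sense of Green's formula: if $u\in L^2(\mathcal S_1)$ has a weak derivative $Du\in L^2(\mathcal S_1)$ in the direction $(\varsigma_0,\varsigma_1,\varsigma_2)$, its trace on $\mathcal C_j$ is the locally integrable function $g$ with $\int_{\mathcal S_1}(u\,D\varphi+(Du)\,\varphi)=\int_{\mathcal C_j}g\,\varphi\,(\varsigma_0,\varsigma_1,\varsigma_2)\cdot n\,dS$, $n$ the outward unit normal, for all smooth $\varphi$ with compact support disjoint from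 the closure of the other face. Then the following hold. 1. For every $\epsilon\ge0$, $-\frac i\hbar\hat H_\epsilon$ is a densely defined maximally dissipative extension of $-\frac i\hbar\hat H$. 2. Put $s=\frac{s_{\rm ph}-s_1}2$, $\tilde s=\frac{s_2-s_{\rm ph}}2$, $s_p=s_{\rm ph}$, and order the components as $---,--+,-+-,-++,+--,+-+,++-,+++$. Then $\mathrm{Ker}(i+\hat H^*)$ consists exactly of the functions in $L^2(\mathcal S_1,\mathbb C^8)$ of the form $$\Psi_-=\begin{pmatrix}0\\ e^{-\tilde s/\hbar}f_1(s_p+\tilde s,s)\\ 0\\ e^{-\tilde s/\hbar}f_3(s_p+\tilde s,s+\tilde s)\\ e^{-s/\hbar}f_4(s_p-s,\tilde s+s)\\ e^{-s/\hbar}f_5(s_p-s,\tilde s)\\ 0\\ 0\end{pmatrix}$$ with measurable $f_1,f_3,f_4,f_5$. 3. For every $\epsilon\ge0$ there is a linear contraction $T_\epsilon:\mathrm{Ker}(i+\hat H^*)\to\mathrm{Ker}(i-\hat H^*)$ that is associated with $\hat H_\epsilon$, i.e. $D(\hat H_\epsilon)=\{\Psi_0+T_\epsilon\Psi_-+\Psi_-:\Psi_0\in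 D(\overline{H}),\ \Psi_-\in\mathrm{Ker}(i+\hat H^*)\}$, where $\overline H$ is the closure of $\hat H$, and it is given for $\Psi_-$ as above by $$T_\epsilon\Psi_-=\begin{pmatrix}0\\0\\ e^{i\theta_1-\frac s\hbar}\mu_\epsilon(2\tilde s)\big((1-e^{-\frac{2\tilde s}\hbar})f_4(s_p-s,\tilde s)+e^{i\theta_2-\frac{\tilde s}\hbar}\mu_\epsilon(2\tilde s)f_1(s_p-s+\tilde s,\tilde s)\big)\\ e^{-\frac s\hbar}\big(\mu_\epsilon(2(s+\tilde s))e^{i\theta_1}f_5(s_p-s,s+\tilde s)-e^{-\frac{s+\tilde s}\hbar}f_3(s_p+\tilde s,s+\tilde s)\big)\\ e^{-\frac{\tilde s}\hbar}\big(\mu_\epsilon(2(s+\tilde s))e^{i\theta_2}f_1(s_p+\tilde s,s+\tilde s)-e^{-\frac{s+\tilde s}\hbar}f_4(s_p-s,s+\tilde s)\big)\\ 0\\ e^{i\theta_2-\frac{\tilde s}\hbar}\mu_\epsilon(2s)\big((1-e^{-\frac{2s}\hbar})f_3(s_p+\tilde s,s)+e^{i\theta_1-\frac s\hbar}\mu_\epsilon(2s)f_5(s_p+\tilde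 s-s,s)\big)\\0\end{pmatrix}.$$ 4. $T_0$ is unitary from $\mathrm{Ker}(i+\hat H^*)$ onto $\mathrm{Ker}(i-\hat H^*)$, and $\hat H_0$ is a self-adjoint extension of $\hat H$. 5. $T_\epsilon\to T_0$ strongly as $\epsilon\to0^+$, and $-\frac i\hbar\hat H_0$ is the extended limit of the family $-\frac i\hbar\hat H_\epsilon$: a pair $(\Psi,\eta)$ satisfies $\Psi\in D(\hat H_0)$ and $\eta=-\frac i\hbar\hat H_0\Psi$ if and only if there are $\Psi_\epsilon\in D(\hat H_\epsilon)$ with $\Psi_\epsilon\to\Psi$ and $-\frac i\hbar\hat H_\epsilon\Psi_\epsilon\to\eta$ as $\epsilon\to0^+$. -/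

import Mathlib

open MeasureTheory Set Filter Topology TopologicalSpace
open scoped ContDiff Kronecker InnerProductSpace LinearPMap

noncomputable section

namespace LeakyBoundary

/-! ### Configuration space, spinors, and the Hilbert space -/

/-- Equal-time configurations, in the order `(s_ph, s_e1, s_e2)`. -/
abbrev Config : Type := ℝ × ℝ × ℝ

/-- Indices `(ς₀, ς₁, ς₂)` of the eight components; `0` stands for `-` and `1` for `+`. -/
abbrev Spin : Type := Fin 2 × Fin 2 × Fin 2

/-- `ℂ⁸` with its Euclidean norm. -/
abbrev Spinor : Type := EuclideanSpace ℂ Spin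

/-- The sign `-1` of the index `-`, and `1` of the index `+`. -/
def sgn : Fin 2 → ℝ := ![-1, 1]

/-- The photon is between the two electrons: `s_e1 < s_ph < s_e2`. -/
def S₁ : Opens Config where
  carrier := {x | x.2.1 < x.1 ∧ x.1 < x.2.2}
  is_open' := by
    have h1 : Continuous fun x : Config => x.1 := by fun_prop
    have h2 : Continuous fun x : Config => x.2.1 := by fun_prop
    have h3 : Continuous fun x : Config => x.2.2 := by fun_prop
    exact (isOpen_lt h2 h1).inter (isOpen_lt h1 h3)

/-- The Hilbert space `L²(S₁, ℂ⁸)`. -/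
abbrev WaveFn : Type := Lp Spinor 2 (volume.restrict (S₁ : Set Config))

/-! ### The Hamiltonian on `C_c^∞(S₁, ℂ⁸)` -/

def γ0 : Matrix (Fin 2) (Fin 2) ℂ := !![0, 1; 1, 0]

def γ1 : Matrix (Fin 2) (Fin 2) ℂ := !![0, -1; 1, 0]

/-- A `2 × 2` matrix acting on the photon index. -/
def onPh (A : Matrix (Fin 2) (Fin 2) ℂ) : Spinor →L[ℂ] Spinor :=
  Matrix.toEuclideanCLM (n := Spin) (𝕜 := ℂ)
    (A ⊗ₖ ((1 : Matrix (Fin 2) (Fin 2) ℂ) ⊗ₖ (1 : Matrix (Fin 2) (Fin 2) ℂ)))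

/-- A `2 × 2` matrix acting on the index of the first electron. -/
def onE1 (A : Matrix (Fin 2) (Fin 2) ℂ) : Spinor →L[ℂ] Spinor :=
  Matrix.toEuclideanCLM (n := Spin) (𝕜 := ℂ)
    ((1 : Matrix (Fin 2) (Fin 2) ℂ) ⊗ₖ (A ⊗ₖ (1 : Matrix (Fin 2) (Fin 2) ℂ)))

/-- A `2 × 2` matrix acting on the index of the second electron. -/
def onE2 (A : Matrix (Fin 2) (Fin 2) ℂ) : Spinor →L[ℂ] Spinor :=
  Matrix.toEuclideanCLM (n := Spin) (𝕜 := ℂ)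
    ((1 : Matrix (Fin 2) (Fin 2) ℂ) ⊗ₖ ((1 : Matrix (Fin 2) (Fin 2) ℂ) ⊗ₖ A))

/-- The differential expression
`-iħ γ⁰γ¹ ∂_{s_ph} + γ⁰ (m - iħ γ¹ ∂_{s_e1}) + γ⁰ (m - iħ γ¹ ∂_{s_e2})`,
each summand acting on the index of its own particle. -/
def hamExpr (ħ m : ℝ) (Φ : Config → Spinor) (x : Config) : Spinor :=
  (-Complex.I * ħ) • onPh (γ0 * γ1) (fderiv ℝ Φ x (1, 0, 0))
    + ((m : ℂ) • onE1 γ0 (Φ x) + (-Complex.I * ħ) • onE1 (γ0 * γ1) (fderiv ℝ Φ x (0, 1, 0)))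
    + ((m : ℂ) • onE2 γ0 (Φ x) + (-Complex.I * ħ) • onE2 (γ0 * γ1) (fderiv ℝ Φ x (0, 0, 1)))

/-- For `m = 0` the components decouple: `(ĤΦ)_ς = iħ (ς₀ ∂_{s_ph} + ς₁ ∂_{s_e1} + ς₂ ∂_{s_e2}) Φ_ς`. -/
theorem hamExpr_massless (ħ : ℝ) (Φ : Config → Spinor) (x : Config) (ς : Spin) :
    hamExpr ħ 0 Φ x ς = Complex.I * ħ * (sgn ς.1 * fderiv ℝ Φ x (1, 0, 0) ς
      + sgn ς.2.1 * fderiv ℝ Φ x (0, 1, 0) ς + sgn ς.2.2 * fderiv ℝ Φ x (0, 0, 1) ς) := by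
  obtain ⟨a, b, c⟩ := ς
  fin_cases a <;> fin_cases b <;> fin_cases c <;>
    simp [hamExpr, onPh, onE1, onE2, γ0, γ1, sgn, Matrix.ofLp_toEuclideanCLM, Matrix.mulVec,
      dotProduct, Fintype.sum_prod_type, Matrix.one_apply] <;> ring

/-- `C_c^∞(S₁, ℂ⁸)` (here `⊤ : ℕ∞` means smooth). -/
abbrev TestSpinor : Type := TestFunction S₁ Spinor ⊤

theorem testSpinor_memLp (Φ : TestSpinor) :
    MemLp (Φ : Config → Spinor) 2 (volume.restrict (S₁ : Set Config)) :=
  (Φ.continuous.memLp_of_hasCompactSupport Φ.hasCompactSupport).restrict _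

theorem hamExpr_memLp (ħ m : ℝ) (Φ : TestSpinor) :
    MemLp (hamExpr ħ m Φ) 2 (volume.restrict (S₁ : Set Config)) := by
  have hd : Continuous (fderiv ℝ (Φ : Config → Spinor)) :=
    Φ.contDiff.continuous_fderiv (by simp)
  have hc : Continuous (hamExpr ħ m Φ) := by
    have h0 := Φ.continuous
    unfold hamExpr
    fun_prop
  refine (hc.memLp_of_hasCompactSupport ?_).restrict _
  refine HasCompactSupport.intro Φ.hasCompactSupport fun x hx => ?_
  have h1 : fderiv ℝ (Φ : Config → Spinor) x = 0 := fderiv_of_notMem_tsupport ℝ hx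
  have h2 : Φ x = 0 := image_eq_zero_of_notMem_tsupport hx
  simp [hamExpr, h1, h2]

/-- The inclusion of `C_c^∞(S₁, ℂ⁸)` into `L²(S₁, ℂ⁸)`. -/
def testIncl : TestSpinor →ₗ[ℂ] WaveFn where
  toFun Φ := (testSpinor_memLp Φ).toLp _
  map_add' Φ Ψ := MemLp.toLp_add (testSpinor_memLp Φ) (testSpinor_memLp Ψ)
  map_smul' c Φ := MemLp.toLp_const_smul c (testSpinor_memLp Φ)

theorem testIncl_injective : Function.Injective testIncl := by
  intro Φ Ψ h
  have h1 : (Φ : Config → Spinor) =ᵐ[volume.restrict (S₁ : Set Config)] Ψ :=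
    (MemLp.toLp_eq_toLp_iff (testSpinor_memLp Φ) (testSpinor_memLp Ψ)).1 h
  have h2 := Measure.eqOn_open_of_ae_eq h1 S₁.isOpen
    Φ.continuous.continuousOn Ψ.continuous.continuousOn
  ext1 x
  by_cases hx : x ∈ (S₁ : Set Config)
  · exact h2 hx
  · rw [image_eq_zero_of_notMem_tsupport fun h => hx (Φ.tsupport_subset h),
      image_eq_zero_of_notMem_tsupport fun h => hx (Ψ.tsupport_subset h)]

theorem testSpinor_differentiableAt (Φ : TestSpinor) (x : Config) :
    DifferentiableAt ℝ (Φ : Config → Spinor) x :=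
  Φ.contDiff.differentiable (by simp) x

/-- The differential expression as a linear map from `C_c^∞(S₁, ℂ⁸)` to `L²(S₁, ℂ⁸)`. -/
def hamTest (ħ m : ℝ) : TestSpinor →ₗ[ℂ] WaveFn where
  toFun Φ := (hamExpr_memLp ħ m Φ).toLp _
  map_add' Φ Ψ := by
    rw [← MemLp.toLp_add]
    congr 1
    funext x
    have h : fderiv ℝ (⇑(Φ + Ψ)) x = fderiv ℝ (⇑Φ) x + fderiv ℝ (⇑Ψ) x :=
      fderiv_add (testSpinor_differentiableAt Φ x) (testSpinor_differentiableAt Ψ x)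
    have h' : (Φ + Ψ) x = Φ x + Ψ x := rfl
    simp only [hamExpr, Pi.add_apply, h, h', add_apply, map_add, smul_add]
    abel
  map_smul' c Φ := by
    rw [RingHom.id_apply, ← MemLp.toLp_const_smul]
    congr 1
    funext x
    have h : fderiv ℝ (⇑(c • Φ)) x = c • fderiv ℝ (⇑Φ) x :=
      fderiv_const_smul (testSpinor_differentiableAt Φ x) c
    have h' : (c • Φ) x = c • Φ x := rfl
    simp only [hamExpr, Pi.smul_apply, h, h', smul_apply, map_smul, smul_add,
      smul_comm c]

/-- The Hamiltonian `Ĥ` with electron mass `m` and domain `C_c^∞(S₁, ℂ⁸)`, as an unbounded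
operator on `L²(S₁, ℂ⁸)`. -/
def hamiltonian (ħ m : ℝ) : WaveFn →ₗ.[ℂ] WaveFn where
  domain := LinearMap.range testIncl
  toFun := hamTest ħ m ∘ₗ (LinearEquiv.ofInjective testIncl testIncl_injective).symm.toLinearMap

theorem hamiltonian_testIncl (ħ m : ℝ) (Φ : TestSpinor) :
    hamiltonian ħ m ⟨testIncl Φ, LinearMap.mem_range_self _ Φ⟩ = hamTest ħ m Φ := by
  change hamTest ħ m ((LinearEquiv.ofInjective testIncl testIncl_injective).symm
    (LinearEquiv.ofInjective testIncl testIncl_injective Φ)) = _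
  rw [LinearEquiv.symm_apply_apply]

/-! ### Traces on the coincidence sets

An element of the domain of the adjoint of the massless Hamiltonian has, in each component `ς`, one
square integrable weak derivative: the derivative `D_ς` in the direction `(ς₀, ς₁, ς₂)`. Its trace
on a face of `S₁` to which this direction is transversal is defined by Green's formula. -/

/-- The direction `(ς₀, ς₁, ς₂)`. -/
def dir (ς : Spin) : Config := (sgn ς.1, sgn ς.2.1, sgn ς.2.2)

/-- A neighbourhood of `C₁` which does not meet the closure of `C₂`. -/
def near₁ : Opens Config where
  carrier := {x | x.1 < x.2.2}
  is_open' := by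
    have h1 : Continuous fun x : Config => x.1 := by fun_prop
    have h3 : Continuous fun x : Config => x.2.2 := by fun_prop
    exact isOpen_lt h1 h3

/-- A neighbourhood of `C₂` which does not meet the closure of `C₁`. -/
def near₂ : Opens Config where
  carrier := {x | x.2.1 < x.1}
  is_open' := by
    have h1 : Continuous fun x : Config => x.1 := by fun_prop
    have h2 : Continuous fun x : Config => x.2.1 := by fun_prop
    exact isOpen_lt h2 h1

/-- The plane `s_e1 = s_ph` in the coordinates `(s_ph, s_e2)`; the preimage of `near₁` is
`C₁ = {s_e1 = s_ph < s_e2}`. -/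
def plane₁ (p : ℝ × ℝ) : Config := (p.1, p.1, p.2)

/-- The plane `s_e2 = s_ph` in the coordinates `(s_ph, s_e1)`; the preimage of `near₂` is
`C₂ = {s_e1 < s_ph = s_e2}`. -/
def plane₂ (p : ℝ × ℝ) : Config := (p.1, p.2, p.1)

/-- `u` has a weak derivative `w = D u` in `L²(S₁)` in the direction `d`, and `g` is its trace on
the part of the boundary of `S₁` that is parametrized by `ι` and lies in `N`: Green's formula
`∫_{S₁} (u D φ + (D u) φ) = κ ∫ g (φ ∘ ι)` holds for all smooth `φ` with compact support in `N`.
Here `κ` is the scalar product of `d` with the outward normal belonging to the parametrization. -/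
def HasTrace (N : Opens Config) (ι : ℝ × ℝ → Config) (κ : ℝ) (d : Config)
    (u : Config → ℂ) (g : ℝ × ℝ → ℂ) : Prop :=
  LocallyIntegrableOn g (ι ⁻¹' N) ∧
  ∃ w : Config → ℂ, MemLp w 2 (volume.restrict (S₁ : Set Config)) ∧
    ∀ φ : TestFunction N ℂ ⊤,
      ∫ x in (S₁ : Set Config), (u x * fderiv ℝ φ x d + w x * φ x) =
        (κ : ℂ) * ∫ p in ι ⁻¹' (N : Set Config), g p * φ (ι p)

/-- `g` is the trace on `C₁` of a function `u` with `D_ς u` in `L²(S₁)`, where `ς₀ ≠ ς₁`.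
The outward normal is `(-1, 1, 0)`. -/
def HasTrace₁ (ς : Spin) (u : Config → ℂ) (g : ℝ × ℝ → ℂ) : Prop :=
  HasTrace near₁ plane₁ (sgn ς.2.1 - sgn ς.1) (dir ς) u g

/-- `g` is the trace on `C₂` of a function `u` with `D_ς u` in `L²(S₁)`, where `ς₀ ≠ ς₂`.
The outward normal is `(1, 0, -1)`. -/
def HasTrace₂ (ς : Spin) (u : Config → ℂ) (g : ℝ × ℝ → ℂ) : Prop :=
  HasTrace near₂ plane₂ (sgn ς.1 - sgn ς.2.2) (dir ς) u g

theorem isClosedEmbedding_plane₁ : IsClosedEmbedding plane₁ := by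
  have hc : Continuous plane₁ := by unfold plane₁; fun_prop
  have hr : Continuous fun x : Config => (x.1, x.2.2) := by fun_prop
  exact Function.LeftInverse.isClosedEmbedding (f := fun x : Config => (x.1, x.2.2))
    (fun _ => rfl) hr hc

theorem isClosedEmbedding_plane₂ : IsClosedEmbedding plane₂ := by
  have hc : Continuous plane₂ := by unfold plane₂; fun_prop
  have hr : Continuous fun x : Config => (x.1, x.2.1) := by fun_prop
  exact Function.LeftInverse.isClosedEmbedding (f := fun x : Config => (x.1, x.2.1))
    (fun _ => rfl) hr hc

section HasTraceLemmas

variable {N : Opens Config} {ι : ℝ × ℝ → Config} {κ : ℝ} {d : Config}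

theorem integrable_face (hι : IsClosedEmbedding ι) {g : ℝ × ℝ → ℂ}
    (hg : LocallyIntegrableOn g (ι ⁻¹' N)) (φ : TestFunction N ℂ ⊤) :
    IntegrableOn (fun p => g p * φ (ι p)) (ι ⁻¹' (N : Set Config)) := by
  have hK : IsCompact (ι ⁻¹' tsupport φ) := hι.isCompact_preimage φ.hasCompactSupport
  have hsub : ι ⁻¹' tsupport φ ⊆ ι ⁻¹' (N : Set Config) := preimage_mono φ.tsupport_subset
  have h1 : IntegrableOn (fun p => g p * φ (ι p)) (ι ⁻¹' tsupport φ) :=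
    (hg.integrableOn_compact_subset hsub hK).mul_continuousOn
      ((φ.continuous.comp hι.continuous).continuousOn) hK
  refine (h1.integrable_of_forall_notMem_eq_zero fun p hp => ?_).integrableOn
  have : φ (ι p) = 0 := image_eq_zero_of_notMem_tsupport hp
  simp [this]

theorem integrable_interior {u w : Config → ℂ}
    (hu : MemLp u 2 (volume.restrict (S₁ : Set Config)))
    (hw : MemLp w 2 (volume.restrict (S₁ : Set Config))) (φ : TestFunction N ℂ ⊤) :
    Integrable (fun x => u x * fderiv ℝ φ x d + w x * φ x)
      (volume.restrict (S₁ : Set Config)) := by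
  have hd : Continuous (fderiv ℝ (φ : Config → ℂ)) := φ.contDiff.continuous_fderiv (by simp)
  have h1 : MemLp (fun x => fderiv ℝ φ x d) 2 (volume.restrict (S₁ : Set Config)) :=
    ((by fun_prop : Continuous fun x => fderiv ℝ φ x d).memLp_of_hasCompactSupport
      (φ.hasCompactSupport.fderiv_apply ℝ d)).restrict _
  have h2 : MemLp (φ : Config → ℂ) 2 (volume.restrict (S₁ : Set Config)) :=
    (φ.continuous.memLp_of_hasCompactSupport φ.hasCompactSupport).restrict _
  exact (hu.integrable_mul h1).add (hw.integrable_mul h2)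

theorem HasTrace.congr {u u' : Config → ℂ} {g : ℝ × ℝ → ℂ} (h : HasTrace N ι κ d u g)
    (huu : u =ᵐ[volume.restrict (S₁ : Set Config)] u') : HasTrace N ι κ d u' g := by
  obtain ⟨hg, w, hw, hG⟩ := h
  refine ⟨hg, w, hw, fun φ => ?_⟩
  rw [← hG φ]
  refine integral_congr_ae ?_
  filter_upwards [huu] with x hx
  rw [hx]

theorem HasTrace.add (hι : IsClosedEmbedding ι) {u u' : Config → ℂ} {g g' : ℝ × ℝ → ℂ}
    (hu : MemLp u 2 (volume.restrict (S₁ : Set Config)))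
    (hu' : MemLp u' 2 (volume.restrict (S₁ : Set Config)))
    (h : HasTrace N ι κ d u g) (h' : HasTrace N ι κ d u' g') :
    HasTrace N ι κ d (fun x => u x + u' x) (fun p => g p + g' p) := by
  obtain ⟨hg, w, hw, hG⟩ := h
  obtain ⟨hg', w', hw', hG'⟩ := h'
  refine ⟨hg.add hg', w + w', hw.add hw', fun φ => ?_⟩
  have e1 : ∀ x, (u x + u' x) * fderiv ℝ φ x d + (w + w') x * φ x =
      (u x * fderiv ℝ φ x d + w x * φ x) + (u' x * fderiv ℝ φ x d + w' x * φ x) := by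
    intro x; simp only [Pi.add_apply]; ring
  have e2 : ∀ p, (g p + g' p) * φ (ι p) = g p * φ (ι p) + g' p * φ (ι p) := fun p => add_mul _ _ _
  simp_rw [e1, e2]
  rw [integral_add (integrable_interior hu hw φ) (integrable_interior hu' hw' φ), hG φ, hG' φ,
    integral_add (integrable_face hι hg φ) (integrable_face hι hg' φ), mul_add]

theorem HasTrace.const_mul {u : Config → ℂ} {g : ℝ × ℝ → ℂ} (c : ℂ)
    (h : HasTrace N ι κ d u g) : HasTrace N ι κ d (fun x => c * u x) (fun p => c * g p) := by
  obtain ⟨hg, w, hw, hG⟩ := h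
  refine ⟨hg.smul c, fun x => c * w x, hw.const_mul c, fun φ => ?_⟩
  have e1 : ∀ x, c * u x * fderiv ℝ φ x d + c * w x * φ x =
      c * (u x * fderiv ℝ φ x d + w x * φ x) := by intro x; ring
  have e2 : ∀ p, c * g p * φ (ι p) = c * (g p * φ (ι p)) := fun p => mul_assoc _ _ _
  simp_rw [e1, e2]
  rw [integral_const_mul, integral_const_mul, hG φ]
  ring

theorem HasTrace.zero : HasTrace N ι κ d (fun _ => 0) (fun _ => 0) :=
  ⟨locallyIntegrableOn_zero, fun _ => 0, MemLp.zero', fun φ => by simp⟩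

end HasTraceLemmas

/-! ### The leaky boundary conditions -/

/-- The component `ς` of a wave function. -/
def comp (ς : Spin) (Ψ : WaveFn) : Config → ℂ := fun x => Ψ x ς

theorem comp_memLp (ς : Spin) (Ψ : WaveFn) :
    MemLp (comp ς Ψ) 2 (volume.restrict (S₁ : Set Config)) :=
  (EuclideanSpace.proj (𝕜 := ℂ) ς : Spinor →L[ℂ] ℂ).comp_memLp' (Lp.memLp Ψ)

theorem comp_add (ς : Spin) (Ψ Φ : WaveFn) :
    (fun x => comp ς Ψ x + comp ς Φ x) =ᵐ[volume.restrict (S₁ : Set Config)] comp ς (Ψ + Φ) := by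
  filter_upwards [Lp.coeFn_add Ψ Φ] with x hx
  change Ψ x ς + Φ x ς = (Ψ + Φ : WaveFn) x ς
  rw [hx]
  rfl

theorem comp_smul (ς : Spin) (c : ℂ) (Ψ : WaveFn) :
    (fun x => c * comp ς Ψ x) =ᵐ[volume.restrict (S₁ : Set Config)] comp ς (c • Ψ) := by
  filter_upwards [Lp.coeFn_smul c Ψ] with x hx
  simp [comp, hx]

theorem comp_zero (ς : Spin) :
    (fun _ => 0) =ᵐ[volume.restrict (S₁ : Set Config)] comp ς 0 := by
  filter_upwards [Lp.coeFn_zero Spinor 2 (volume.restrict (S₁ : Set Config))] with x hx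
  change (0 : ℂ) = (0 : WaveFn) x ς
  rw [hx]
  rfl

/-- The condition `v = a u` between the traces on the same face of two components `u = ψ_ς` and
`v = ψ_{ς'}`, where `κ`, `κ'` belong to `ς`, `ς'`. -/
def traceRelation (N : Opens Config) (ι : ℝ × ℝ → Config) (hι : IsClosedEmbedding ι)
    (κ κ' : ℝ) (ς ς' : Spin) (a : ℝ × ℝ → ℂ) : Submodule ℂ WaveFn where
  carrier := {Ψ | ∃ g : ℝ × ℝ → ℂ, HasTrace N ι κ (dir ς) (comp ς Ψ) g ∧
    HasTrace N ι κ' (dir ς') (comp ς' Ψ) (fun p => a p * g p)}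
  add_mem' := by
    rintro Ψ Φ ⟨g, h1, h2⟩ ⟨g', h1', h2'⟩
    refine ⟨fun p => g p + g' p,
      ((h1.add hι (comp_memLp _ _) (comp_memLp _ _) h1').congr (comp_add _ _ _)), ?_⟩
    have := (h2.add hι (comp_memLp _ _) (comp_memLp _ _) h2').congr (comp_add _ _ _)
    simpa only [mul_add] using this
  zero_mem' := ⟨fun _ => 0, HasTrace.zero.congr (comp_zero _), by
    simpa only [mul_zero] using HasTrace.zero.congr (comp_zero _)⟩
  smul_mem' := by
    rintro c Ψ ⟨g, h1, h2⟩
    refine ⟨fun p => c * g p, (h1.const_mul c).congr (comp_smul _ _ _), ?_⟩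
    have := (h2.const_mul c).congr (comp_smul _ _ _)
    simpa only [mul_left_comm c] using this

/-- The boundary condition `ψ_{ς'} = a ψ_ς` on `C₁`. -/
def bc₁ (ς ς' : Spin) (a : ℝ × ℝ → ℂ) : Submodule ℂ WaveFn :=
  traceRelation near₁ plane₁ isClosedEmbedding_plane₁
    (sgn ς.2.1 - sgn ς.1) (sgn ς'.2.1 - sgn ς'.1) ς ς' a

/-- The boundary condition `ψ_{ς'} = a ψ_ς` on `C₂`. -/
def bc₂ (ς ς' : Spin) (a : ℝ × ℝ → ℂ) : Submodule ℂ WaveFn :=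
  traceRelation near₂ plane₂ isClosedEmbedding_plane₂
    (sgn ς.1 - sgn ς.2.2) (sgn ς'.1 - sgn ς'.2.2) ς ς' a

theorem mem_bc₁ {ς ς' : Spin} {a : ℝ × ℝ → ℂ} {Ψ : WaveFn} : Ψ ∈ bc₁ ς ς' a ↔
    ∃ g, HasTrace₁ ς (comp ς Ψ) g ∧ HasTrace₁ ς' (comp ς' Ψ) (fun p => a p * g p) := Iff.rfl

theorem mem_bc₂ {ς ς' : Spin} {a : ℝ × ℝ → ℂ} {Ψ : WaveFn} : Ψ ∈ bc₂ ς ς' a ↔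
    ∃ g, HasTrace₂ ς (comp ς Ψ) g ∧ HasTrace₂ ς' (comp ς' Ψ) (fun p => a p * g p) := Iff.rfl

/-- The distance `|s_e1 - s_e2|` of the electrons. -/
def dist₁₂ (x : Config) : ℝ := |x.2.1 - x.2.2|

/-- `ψ_{-+ς₂} = e^{iθ₁} m(|s_e1 - s_e2|) ψ_{+-ς₂}` on `C₁` and
`ψ_{+ς₁-} = e^{iθ₂} m(|s_e1 - s_e2|) ψ_{-ς₁+}` on `C₂`. -/
def leakyConditions (θ₁ θ₂ : ℝ) (m : ℝ → ℝ) : Submodule ℂ WaveFn :=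
  (⨅ c : Fin 2, bc₁ (1, 0, c) (0, 1, c)
      fun p => Complex.exp (Complex.I * θ₁) * m (dist₁₂ (plane₁ p))) ⊓
    ⨅ b : Fin 2, bc₂ (0, b, 1) (1, b, 0)
      fun p => Complex.exp (Complex.I * θ₂) * m (dist₁₂ (plane₂ p))

/-- The restriction of the adjoint `Ĥ*` of the massless Hamiltonian to those elements of its domain
that satisfy the leaky boundary conditions with transition function `m`. -/
def leakyHamiltonian (ħ θ₁ θ₂ : ℝ) (m : ℝ → ℝ) : WaveFn →ₗ.[ℂ] WaveFn :=
  (hamiltonian ħ 0)†.domRestrict (leakyConditions θ₁ θ₂ m)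

/-- A transition function: smooth on `[0, ∞)`, with values in `[0, 1]`, equal to `0` on `[0, ε]`
and to `1` on `[2ε, ∞)`. -/
structure IsTransition (ε : ℝ) (m : ℝ → ℝ) : Prop where
  smooth : ContDiffOn ℝ ∞ m (Ici 0)
  mem_Icc : ∀ s, 0 ≤ s → m s ∈ Icc (0 : ℝ) 1
  eq_zero : ∀ s ∈ Icc 0 ε, m s = 0
  eq_one : ∀ s, 2 * ε ≤ s → m s = 1

/-! ### Dissipative operators, deficiency spaces, extended limits -/

section Abstract

variable {H : Type*} [NormedAddCommGroup H] [InnerProductSpace ℂ H]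

/-- `Re ⟨B x, x⟩ ≤ 0` on the domain of `B`. -/
def IsDissipative (B : H →ₗ.[ℂ] H) : Prop :=
  ∀ x : B.domain, (⟪B x, (x : H)⟫_ℂ).re ≤ 0

/-- Densely defined, dissipative, and without a proper dissipative extension. -/
def IsMaximallyDissipative (B : H →ₗ.[ℂ] H) : Prop :=
  Dense (B.domain : Set H) ∧ IsDissipative B ∧
    ∀ A : H →ₗ.[ℂ] H, IsDissipative A → B ≤ A → A = B

variable [CompleteSpace H]

/-- `Ker (z - A*)`. -/
def deficiency (A : H →ₗ.[ℂ] H) (z : ℂ) : Submodule ℂ H :=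
  (LinearMap.ker (A†.toFun - z • A†.domain.subtype)).map A†.domain.subtype

theorem mem_deficiency {A : H →ₗ.[ℂ] H} {z : ℂ} {x : H} :
    x ∈ deficiency A z ↔ ∃ h : x ∈ A†.domain, A† ⟨x, h⟩ = z • x := by
  simp only [deficiency, Submodule.mem_map, LinearMap.mem_ker, LinearMap.sub_apply,
    LinearMap.smul_apply, Submodule.subtype_apply, sub_eq_zero]
  constructor
  · rintro ⟨y, hy, rfl⟩
    exact ⟨y.2, hy⟩
  · rintro ⟨h, hx⟩
    exact ⟨⟨x, h⟩, hx, rfl⟩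

/-- For a linear map `T` from `Ker (i + A*)` to `Ker (i - A*)`, the restriction of `A*` to the
elements `Ψ₀ + T Ψ₋ + Ψ₋` with `Ψ₀` in the domain of the closure of `A` and `Ψ₋ ∈ Ker (i + A*)`. -/
def extensionOf (A : H →ₗ.[ℂ] H)
    (T : deficiency A (-Complex.I) →L[ℂ] deficiency A Complex.I) : H →ₗ.[ℂ] H :=
  A†.domRestrict (A.closure.domain ⊔
    LinearMap.range ((deficiency A Complex.I).subtype ∘ₗ (T : _ →ₗ[ℂ] _)
      + (deficiency A (-Complex.I)).subtype))

/-- The graph of the extended limit as `ε → 0+` of the operators `B ε`: all pairs `(x, y)` for which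
there are `x_ε` in the domain of `B ε` with `x_ε → x` and `B ε x_ε → y`. -/
def extendedLimit (B : ℝ → H →ₗ.[ℂ] H) : Set (H × H) :=
  {p | ∃ x : ∀ ε, (B ε).domain,
    Tendsto (fun ε => (x ε : H)) (𝓝[>] 0) (𝓝 p.1) ∧
    Tendsto (fun ε => B ε (x ε)) (𝓝[>] 0) (𝓝 p.2)}

end Abstract

/-! ### The explicit formulas -/

/-- The relative coordinate `s = (s_ph - s_e1) / 2`. -/
def relS (x : Config) : ℝ := (x.1 - x.2.1) / 2

/-- The relative coordinate `s̃ = (s_e2 - s_ph) / 2`. -/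
def relT (x : Config) : ℝ := (x.2.2 - x.1) / 2

/-- The general form of an element of `Ker (i + Ĥ*)`. -/
def minusForm (ħ : ℝ) (f₁ f₃ f₄ f₅ : ℝ × ℝ → ℂ) (x : Config) : Spinor :=
  let p := x.1
  let s := relS x
  let t := relT x
  WithLp.toLp 2 fun ς => match ς with
    | (0, 0, 1) => Real.exp (-t / ħ) * f₁ (p + t, s)
    | (0, 1, 1) => Real.exp (-t / ħ) * f₃ (p + t, s + t)
    | (1, 0, 0) => Real.exp (-s / ħ) * f₄ (p - s, t + s)
    | (1, 0, 1) => Real.exp (-s / ħ) * f₅ (p - s, t)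
    | _ => 0

/-- The image of `minusForm ħ f₁ f₃ f₄ f₅` under the contraction that belongs to the leaky boundary
conditions with transition function `m`. On a characteristic that meets `C₁` or `C₂` where the
electrons have the distance `2 r`, the transition function takes the value `m (2 r)`. -/
def imageForm (ħ θ₁ θ₂ : ℝ) (m : ℝ → ℝ) (f₁ f₃ f₄ f₅ : ℝ × ℝ → ℂ) (x : Config) : Spinor :=
  let p := x.1
  let s := relS x
  let t := relT x
  let e₁ : ℂ := Complex.exp (Complex.I * θ₁)
  let e₂ : ℂ := Complex.exp (Complex.I * θ₂)
  WithLp.toLp 2 fun ς => match ς with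
    | (0, 1, 0) => e₁ * Real.exp (-s / ħ) * m (2 * t) *
        ((1 - Real.exp (-2 * t / ħ)) * f₄ (p - s, t)
          + e₂ * Real.exp (-t / ħ) * m (2 * t) * f₁ (p - s + t, t))
    | (0, 1, 1) => Real.exp (-s / ħ) *
        (m (2 * (s + t)) * e₁ * f₅ (p - s, s + t)
          - Real.exp (-(s + t) / ħ) * f₃ (p + t, s + t))
    | (1, 0, 0) => Real.exp (-t / ħ) *
        (m (2 * (s + t)) * e₂ * f₁ (p + t, s + t)
          - Real.exp (-(s + t) / ħ) * f₄ (p - s, s + t))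
    | (1, 1, 0) => e₂ * Real.exp (-t / ħ) * m (2 * s) *
        ((1 - Real.exp (-2 * s / ħ)) * f₃ (p + t, s)
          + e₁ * Real.exp (-s / ħ) * m (2 * s) * f₅ (p + t - s, s))
    | _ => 0

end LeakyBoundary
end

open MeasureTheory Set Filter Topology TopologicalSpace
open scoped ContDiff Kronecker InnerProductSpace LinearPMap

noncomputable section

namespace LeakyBoundary

/-! ### Extensions of symmetric operators -/

section Abstract

variable {H : Type*} [NormedAddCommGroup H] [InnerProductSpace ℂ H]

/-! The massless expression does not couple the components: each one is transported along straight
lines in the direction `dir ς`, and only the traces on the faces mix components. An element of `Ker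
(i + Ĥ*)` or `Ker (i - Ĥ*)` is therefore, on each such line, an exponential of rate `∓ħ⁻¹` times an
amplitude that depends only on the line. Three kinds of lines occur in `S₁`. Whole lines (`---`,
`+++`) carry no square integrable exponential. Half-lines from a face (`-+-`, `+-+` from `C₁`;
`--+`, `++-` from `C₂`) carry one for exactly one of the two rates. Segments between the faces
(`+--`, `-++`) carry one for both. This gives both deficiency spaces (`mem_deficiency_neg_I_iff`,
`mem_deficiency_I_iff`).

The operator theory is von Neumann's. For a contraction `T` between the deficiency spaces, the
restriction `B` of `A*` to the vectors `x₀ + T k + k` satisfies `Im ⟪B x, x⟫ = ‖k‖² - ‖T k‖²`, and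
`B - i` is onto whatever `T` is. The first fact gives dissipativity, the second maximality. If `T`
is unitary then `B + i` is onto as well and `B` is self-adjoint. Since `B - i` is inverted with data
that do not depend on `T` and with a uniform bound, strong convergence of the contractions yields
the extended limit (`extendedLimit_extensionOf`).

To apply this, `domRestrict_eq_extensionOf` asks three things of the boundary conditions: they hold
on the domain of the closure, where all traces vanish; no nonzero element of `Ker (i - Ĥ*)`
satisfies them; and for each `Ψ₋` some element `T Ψ₋` of `Ker (i - Ĥ*)` makes `T Ψ₋ + Ψ₋` satisfy
them. The last point is linear algebra on each segment. Let `r` be its length in the characteristic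
parameter, `E = e^{-r/ħ}`, and let `b`, `a` be the amplitudes of `Ψ₋` on the half-line and on the
segment. Without leak and up to phases, `(b, a)` goes to `((1 - E²) a + E b, b - E a)`. This map
preserves `|b|² + (1 - E²) |a|²`, which is the `L²` norm up to a constant factor, and it is its own
inverse; hence `T` is unitary. The leak multiplies both what enters the segment and what leaves it
by a number in `[0, 1]`, hence `T` is a contraction. At a fixed `r` this number is `1` as soon as `ε
≤ r`, so strong convergence follows by dominated convergence. -/

theorem mem_graph_iff_exists {A : H →ₗ.[ℂ] H} {x y : H} :
    (x, y) ∈ A.graph ↔ ∃ h : x ∈ A.domain, A ⟨x, h⟩ = y := by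
  simp [LinearPMap.mem_graph_iff]

theorem mem_graph_smul_iff {A : H →ₗ.[ℂ] H} {c : ℂ} {x w : H} :
    (x, w) ∈ (c • A).graph ↔ ∃ y, (x, y) ∈ A.graph ∧ w = c • y := by
  simp only [mem_graph_iff_exists]
  constructor
  · rintro ⟨h, rfl⟩
    exact ⟨_, ⟨h, rfl⟩, rfl⟩
  · rintro ⟨_, ⟨h, rfl⟩, rfl⟩
    exact ⟨h, rfl⟩

theorem smul_le_smul {A B : H →ₗ.[ℂ] H} (c : ℂ) (h : A ≤ B) : c • A ≤ c • B :=
  ⟨h.1, fun x y hxy => congrArg (c • ·) (h.2 (x := x) (y := y) hxy)⟩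

variable [CompleteSpace H]

theorem mem_adjoint_graph_iff {A : H →ₗ.[ℂ] H} (hA : Dense (A.domain : Set H)) {x y : H} :
    (x, y) ∈ A†.graph ↔ ∀ v : A.domain, ⟪y, (v : H)⟫_ℂ = ⟪x, A v⟫_ℂ := by
  rw [mem_graph_iff_exists]
  constructor
  · rintro ⟨h, rfl⟩ v
    exact LinearPMap.adjoint_isFormalAdjoint hA ⟨x, h⟩ v
  · intro h
    have hx : x ∈ A†.domain := LinearPMap.mem_adjoint_domain_of_exists _ ⟨y, h⟩
    exact ⟨hx, LinearPMap.adjoint_apply_eq hA ⟨x, hx⟩ h⟩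

theorem mem_deficiency_iff_graph {A : H →ₗ.[ℂ] H} {z : ℂ} {x : H} :
    x ∈ deficiency A z ↔ (x, z • x) ∈ A†.graph := by
  rw [mem_deficiency, mem_graph_iff_exists]

omit [CompleteSpace H] in
theorem mem_domRestrict_graph_iff {A : H →ₗ.[ℂ] H} {S : Submodule ℂ H} {x y : H} :
    (x, y) ∈ (A.domRestrict S).graph ↔ x ∈ S ∧ (x, y) ∈ A.graph := by
  simp only [mem_graph_iff_exists]
  constructor
  · rintro ⟨h, rfl⟩
    rw [LinearPMap.domRestrict_domain, Submodule.mem_inf] at h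
    exact ⟨h.1, h.2, (LinearPMap.domRestrict_apply rfl).symm⟩
  · rintro ⟨h, h', rfl⟩
    exact ⟨⟨h, h'⟩, LinearPMap.domRestrict_apply rfl⟩

section Symmetric

variable {A : H →ₗ.[ℂ] H} (hA : Dense (A.domain : Set H)) (hs : A ≤ A†)
include hA hs

theorem isClosable_of_le_adjoint : A.IsClosable :=
  (LinearPMap.adjoint_isClosed hA).isClosable.leIsClosable hs

theorem closure_graph_eq : A.closure.graph = A.graph.topologicalClosure :=
  ((isClosable_of_le_adjoint hA hs).graph_closure_eq_closure_graph).symm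

theorem closure_graph_le_adjoint_graph : A.closure.graph ≤ A†.graph := by
  rw [closure_graph_eq hA hs]
  exact Submodule.topologicalClosure_minimal _ (LinearPMap.le_graph_of_le hs)
    (LinearPMap.adjoint_isClosed hA)

/-- The closure of `A` is a formal adjoint of `A*`. -/
theorem inner_closure_graph {x y u v : H} (h : (x, y) ∈ A.closure.graph)
    (h' : (u, v) ∈ A†.graph) : ⟪v, x⟫_ℂ = ⟪u, y⟫_ℂ := by
  have hc : IsClosed {p : H × H | ⟪v, p.1⟫_ℂ = ⟪u, p.2⟫_ℂ} :=
    isClosed_eq (by fun_prop) (by fun_prop)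
  rw [closure_graph_eq hA hs] at h
  have hsub : (A.graph : Set (H × H)) ⊆ {p : H × H | ⟪v, p.1⟫_ℂ = ⟪u, p.2⟫_ℂ} := by
    rintro ⟨a, b⟩ hab
    obtain ⟨ha, rfl⟩ := mem_graph_iff_exists.1 hab
    exact (mem_adjoint_graph_iff hA).1 h' ⟨a, ha⟩
  exact closure_minimal hsub hc h

/-- The closure is symmetric, so the inner product equals its own conjugate. -/
theorem im_inner_closure_graph {x y : H} (h : (x, y) ∈ A.closure.graph) :
    (⟪y, x⟫_ℂ).im = 0 := by
  have h1 := inner_closure_graph hA hs h (closure_graph_le_adjoint_graph hA hs h)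
  rw [← inner_conj_symm x y] at h1
  have := congrArg Complex.im h1
  simp only [Complex.conj_im] at this
  linarith

-- The cross term is `-2 Re (c ⟪y, x⟫)`, and `c` is purely imaginary. The identity gives lower
-- bounds for `B - c` whenever the sign of `Im ⟪B x, x⟫` is known: equality for symmetric operators,
-- an inequality for dissipative ones.
omit [CompleteSpace H] hA hs in
theorem norm_sq_sub_smul {x y : H} (c : ℂ) (hc : c = Complex.I ∨ c = -Complex.I) :
    ‖y - c • x‖ ^ 2 = ‖x‖ ^ 2 + ‖y‖ ^ 2 + 2 * c.im * (⟪y, x⟫_ℂ).im := by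
  have h : ‖y - c • x‖ ^ 2 = ‖y‖ ^ 2 - 2 * (⟪y, c • x⟫_ℂ).re + ‖c • x‖ ^ 2 :=
    norm_sub_sq (𝕜 := ℂ) y (c • x)
  rw [h, inner_smul_right, norm_smul]
  rcases hc with rfl | rfl <;> simp <;> ring

/-- `H` is spanned by the range of the closure of `A - c` and `Ker (A* + c)`, for `c = ± i`. -/
theorem exists_closure_graph_add_deficiency {c : ℂ} (hc : c = Complex.I ∨ c = -Complex.I) (z : H) :
    ∃ x y k : H, (x, y) ∈ A.closure.graph ∧ k ∈ deficiency A (-c) ∧ z = y - c • x + k := by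
  have hcc : (starRingEnd ℂ) c = -c := by rcases hc with rfl | rfl <;> simp
  have hclosed : IsClosed (A.closure.graph : Set (H × H)) :=
    (isClosable_of_le_adjoint hA hs).closure_isClosed
  let L : A.closure.graph →L[ℂ] H :=
    ((ContinuousLinearMap.snd ℂ H H) - c • (ContinuousLinearMap.fst ℂ H H)).comp
      A.closure.graph.subtypeL
  have hL : ∀ p : A.closure.graph, L p = p.1.2 - c • p.1.1 := fun p => rfl
  -- The cross term vanishes by symmetry, so `‖y - c x‖² = ‖x‖² + ‖y‖²` dominates the sup norm of
  -- the graph. The graph is complete, hence the range of the closure of `A - c` is closed and has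
  -- an orthogonal complement.
  have hanti : AntilipschitzWith 1 L := by
    refine AddMonoidHomClass.antilipschitz_of_bound L fun p => ?_
    have h1 := norm_sq_sub_smul (x := p.1.1) (y := p.1.2) c hc
    rw [im_inner_closure_graph hA hs (x := p.1.1) (y := p.1.2) p.2, mul_zero, add_zero,
      ← hL] at h1
    have h2 : ‖p‖ = max ‖p.1.1‖ ‖p.1.2‖ := rfl
    rw [h2, NNReal.coe_one, one_mul]
    refine max_le ?_ ?_ <;>
      refine le_of_sq_le_sq ?_ (norm_nonneg _) <;> rw [h1] <;> nlinarith [sq_nonneg ‖p.1.1‖, sq_nonneg ‖p.1.2‖]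
  have : CompleteSpace A.closure.graph := hclosed.completeSpace_coe
  have hr : IsClosed (LinearMap.range (L : A.closure.graph →ₗ[ℂ] H) : Set H) :=
    hanti.isClosed_range L.uniformContinuous
  have : CompleteSpace (LinearMap.range (L : A.closure.graph →ₗ[ℂ] H)) := hr.completeSpace_coe
  obtain ⟨r, ⟨p, rfl⟩, k, hk, rfl⟩ := Submodule.exists_add_mem_mem_orthogonal
    (K := LinearMap.range (L : A.closure.graph →ₗ[ℂ] H)) z
  refine ⟨p.1.1, p.1.2, k, p.2, ?_, rfl⟩
  -- A vector orthogonal to the range of `A - c` is an eigenvector of `A*` for the conjugate of `c`,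
  -- which is `-c`.
  rw [mem_deficiency_iff_graph, mem_adjoint_graph_iff hA]
  intro v
  have hv : ((v : H), A v) ∈ A.closure.graph :=
    LinearPMap.le_graph_of_le A.le_closure (A.mem_graph v)
  have := Submodule.inner_left_of_mem_orthogonal
    (LinearMap.mem_range_self (L : A.closure.graph →ₗ[ℂ] H) ⟨_, hv⟩) hk
  change ⟪k, A v - c • (v : H)⟫_ℂ = 0 at this
  rw [inner_sub_right, inner_smul_right, sub_eq_zero] at this
  rw [inner_smul_left, map_neg, hcc, neg_neg, this]

/-- Von Neumann's decomposition of the domain of `A*`. -/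
theorem adjoint_domain_decomposition {x : H} (hx : x ∈ A†.domain) :
    ∃ x₀ ∈ A.closure.domain, ∃ k ∈ deficiency A (-Complex.I), ∃ l ∈ deficiency A Complex.I,
      x = x₀ + l + k := by
  obtain ⟨x₀, y₀, k, h0, hk, he⟩ := exists_closure_graph_add_deficiency hA hs (c := Complex.I)
    (Or.inl rfl) (A† ⟨x, hx⟩ - Complex.I • x)
  have hI : (Complex.I / 2) * -Complex.I = 1 / 2 := by
    linear_combination (-1 / 2) * Complex.I_mul_I
  -- On `Ker (i + A*)` the operator `A* - i` is multiplication by `-2i`, whose inverse is `i / 2`.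
  -- Hence `A* - i` sends this vector to `k`, and it annihilates what remains of `x`.
  have hk' : (Complex.I / 2) • k ∈ deficiency A (-Complex.I) := Submodule.smul_mem _ _ hk
  refine ⟨x₀, (mem_graph_iff_exists.1 h0).1, (Complex.I / 2) • k, hk',
    x - x₀ - (Complex.I / 2) • k, ?_, by abel⟩
  rw [mem_deficiency_iff_graph]
  have h1 := sub_mem (sub_mem (A†.mem_graph ⟨x, hx⟩) (closure_graph_le_adjoint_graph hA hs h0))
    (mem_deficiency_iff_graph.1 hk')
  convert h1 using 1
  refine Prod.ext rfl ?_
  change Complex.I • (x - x₀ - (Complex.I / 2) • k) = A† ⟨x, hx⟩ - y₀ - -Complex.I • (Complex.I / 2) • k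
  rw [sub_eq_iff_eq_add.1 he]
  simp only [smul_sub, smul_smul]
  have e1 : Complex.I * (Complex.I / 2) = -1 / 2 := by
    linear_combination (1 / 2) * Complex.I_mul_I
  have e2 : -Complex.I * (Complex.I / 2) = 1 / 2 := by
    linear_combination (-1 / 2) * Complex.I_mul_I
  rw [e1, e2]
  module

/-! ### Extensions given by a map between the deficiency spaces. -/

variable (T : deficiency A (-Complex.I) →L[ℂ] deficiency A Complex.I)

/-- `A*` acts as `i` on `T k` and as `-i` on `k`, which gives the second coordinate. -/
theorem mem_extensionOf_graph_iff {x y : H} : (x, y) ∈ (extensionOf A T).graph ↔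
    ∃ x₀ y₀ : H, (x₀, y₀) ∈ A.closure.graph ∧ ∃ k : deficiency A (-Complex.I),
      x = x₀ + (T k + k) ∧ y = y₀ + Complex.I • ((T k : H) - k) := by
  have hgr : ∀ x₀ y₀ : H, (x₀, y₀) ∈ A.closure.graph → ∀ k : deficiency A (-Complex.I),
      (x₀ + (T k + k), y₀ + Complex.I • ((T k : H) - k)) ∈ A†.graph := by
    intro x₀ y₀ h0 k
    have h1 := mem_deficiency_iff_graph.1 k.2
    have h2 := mem_deficiency_iff_graph.1 (T k).2
    convert add_mem (closure_graph_le_adjoint_graph hA hs h0) (add_mem h2 h1) using 1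
    refine Prod.ext rfl ?_
    change _ = y₀ + (Complex.I • (T k : H) + -Complex.I • (k : H))
    module
  rw [extensionOf, mem_domRestrict_graph_iff]
  constructor
  · rintro ⟨hx, hg⟩
    obtain ⟨x₀, hx₀, _, ⟨k, rfl⟩, rfl⟩ := Submodule.mem_sup.1 hx
    refine ⟨x₀, _, A.closure.mem_graph ⟨x₀, hx₀⟩, k, rfl, ?_⟩
    exact LinearPMap.mem_graph_snd_inj' A† hg (hgr x₀ _ (A.closure.mem_graph ⟨x₀, hx₀⟩) k) rfl
  · rintro ⟨x₀, y₀, h0, k, rfl, rfl⟩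
    exact ⟨Submodule.add_mem_sup (mem_graph_iff_exists.1 h0).1 ⟨k, rfl⟩, hgr x₀ y₀ h0 k⟩

/-- The boundary form of `A*` does not see the domain of the closure: the mixed terms are conjugate
to each other and cancel in the imaginary part. On the deficiency spaces the cross terms between `T
k` and `k` contribute a real number. The sign of the remaining difference is that of minus the real
part in `IsDissipative`, once the operator is multiplied by `-i/ħ`. -/
theorem im_inner_extensionOf_graph {x₀ y₀ : H} (h0 : (x₀, y₀) ∈ A.closure.graph)
    (k : deficiency A (-Complex.I)) :
    (⟪y₀ + Complex.I • ((T k : H) - k), x₀ + (T k + k)⟫_ℂ).im = ‖k‖ ^ 2 - ‖T k‖ ^ 2 := by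
  have hk : ((T k : H) + k, Complex.I • ((T k : H) - k)) ∈ A†.graph := by
    have h := ((mem_extensionOf_graph_iff hA hs T).2 ⟨0, 0, zero_mem _, k, rfl, rfl⟩)
    rw [extensionOf, mem_domRestrict_graph_iff] at h
    simpa using h.2
  have h1 := inner_closure_graph hA hs h0 hk
  have h2 := im_inner_closure_graph hA hs h0
  rw [inner_add_left, inner_add_right y₀, inner_add_right _ x₀, h1,
    ← inner_conj_symm y₀ ((T k : H) + k)]
  simp only [Complex.add_im, Complex.conj_im, h2]
  rw [inner_smul_left, inner_sub_left, inner_add_right, inner_add_right,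
    ← inner_conj_symm (T k : H) (k : H)]
  have e1 : (⟪(T k : H), (T k : H)⟫_ℂ) = ((‖T k‖ ^ 2 : ℝ) : ℂ) := by
    rw [inner_self_eq_norm_sq_to_K]; simp
  have e2 : (⟪(k : H), (k : H)⟫_ℂ) = ((‖k‖ ^ 2 : ℝ) : ℂ) := by
    rw [inner_self_eq_norm_sq_to_K]; simp
  rw [e1, e2]
  simp only [Complex.conj_I, Complex.mul_im, Complex.neg_re, Complex.neg_im, Complex.I_re,
    Complex.I_im, Complex.sub_re, Complex.add_re, Complex.conj_re, Complex.ofReal_re]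
  ring

/-- A restriction of `A*` to a subspace that contains the domain of the closure and the vectors
`k + T k`, and that meets `Ker (i - A*)` trivially, is the extension given by `T`. -/
theorem domRestrict_eq_extensionOf {S : Submodule ℂ H} (h0 : A.closure.domain ≤ S)
    (hT : ∀ k : deficiency A (-Complex.I), (T k : H) + k ∈ S)
    (hS : ∀ l ∈ deficiency A Complex.I, l ∈ S → l = 0) :
    A†.domRestrict S = extensionOf A T := by
  apply LinearPMap.eq_of_eq_graph
  ext ⟨x, y⟩
  rw [extensionOf, mem_domRestrict_graph_iff, mem_domRestrict_graph_iff]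
  refine and_congr_left fun hg => ⟨fun hx => ?_, fun hx => ?_⟩
  · obtain ⟨x₀, hx₀, k, hk, l, hl, rfl⟩ :=
      adjoint_domain_decomposition hA hs (mem_graph_iff_exists.1 hg).1
    -- Subtracting `x₀` and `T k + k`, which lie in `S`, leaves an element of `Ker (i - A*)` in `S`.
    have h1 : l - T ⟨k, hk⟩ ∈ S := by
      have := sub_mem (sub_mem hx (h0 hx₀)) (hT ⟨k, hk⟩)
      convert this using 1
      change _ = x₀ + l + k - x₀ - (T ⟨k, hk⟩ + k)
      abel
    have h2 := sub_eq_zero.1 (hS _ (sub_mem hl (T ⟨k, hk⟩).2) h1)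
    rw [h2, add_assoc]
    exact Submodule.add_mem_sup hx₀ ⟨⟨k, hk⟩, rfl⟩
  · obtain ⟨x₀, hx₀, _, ⟨k, rfl⟩, rfl⟩ := Submodule.mem_sup.1 hx
    exact add_mem (h0 hx₀) (hT k)

theorem le_extensionOf : A ≤ extensionOf A T := by
  apply LinearPMap.le_of_le_graph
  rintro ⟨x, y⟩ h
  rw [mem_extensionOf_graph_iff hA hs T]
  exact ⟨x, y, LinearPMap.le_graph_of_le A.le_closure h, 0, by simp, by simp⟩

theorem dense_domain_extensionOf : Dense ((extensionOf A T).domain : Set H) :=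
  hA.mono (le_extensionOf hA hs T).1

/-- `B - i` maps the domain of `B = extensionOf A T` onto `H`. -/
theorem exists_extensionOf_graph_sub (z : H) : ∃ x₀ y₀ : H, (x₀, y₀) ∈ A.closure.graph ∧
    ∃ k : deficiency A (-Complex.I),
      z = (y₀ + Complex.I • ((T k : H) - k)) - Complex.I • (x₀ + (T k + k)) := by
  obtain ⟨x₀, y₀, k, h0, hk, rfl⟩ := exists_closure_graph_add_deficiency hA hs (c := Complex.I)
    (Or.inl rfl) z
  -- `B - i` annihilates `T k` and multiplies `k` by `-2i`. The solution data `x₀`, `y₀`, `k`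
  -- therefore do not depend on `T`.
  refine ⟨x₀, y₀, h0, ⟨(Complex.I / 2) • k, Submodule.smul_mem _ _ hk⟩, ?_⟩
  have e1 : Complex.I * (Complex.I / 2) = -1 / 2 := by
    linear_combination (1 / 2) * Complex.I_mul_I
  simp only [smul_sub, smul_add, smul_smul, e1]
  module

variable {T} (hT : ‖T‖ ≤ 1)
include hT

/-- For a contraction the cross term in `norm_sq_sub_smul` is nonnegative. The bound is uniform over
all contractions, which is what the passage to the limit needs. -/
theorem norm_le_of_extensionOf_graph {x y : H} (h : (x, y) ∈ (extensionOf A T).graph) :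
    ‖x‖ ≤ ‖y - Complex.I • x‖ ∧ ‖y‖ ≤ ‖y - Complex.I • x‖ := by
  obtain ⟨x₀, y₀, h0, k, hx, hy⟩ := (mem_extensionOf_graph_iff hA hs T).1 h
  have h1 := norm_sq_sub_smul (x := x) (y := y) Complex.I (Or.inl rfl)
  have h2 := im_inner_extensionOf_graph hA hs T h0 k
  rw [← hx, ← hy] at h2
  have h3 : ‖T k‖ ≤ ‖k‖ := by simpa using T.le_of_opNorm_le hT k
  have h4 : ‖T k‖ ^ 2 ≤ ‖k‖ ^ 2 := by gcongr
  rw [h2, Complex.I_im] at h1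
  constructor <;> refine le_of_sq_le_sq ?_ (norm_nonneg _) <;> rw [h1] <;>
    nlinarith [sq_nonneg ‖x‖, sq_nonneg ‖y‖]

/-- The extension given by a contraction is maximally dissipative. -/
theorem isMaximallyDissipative_extensionOf {ħ : ℝ} (hħ : 0 < ħ) :
    IsMaximallyDissipative ((-Complex.I / (ħ : ℂ)) • extensionOf A T) := by
  have hħ' : (ħ : ℂ) ≠ 0 := by exact_mod_cast hħ.ne'
  refine ⟨dense_domain_extensionOf hA hs T, fun x => ?_, fun A' hA' hle => le_antisymm ?_ hle⟩
  · change (⟪(-Complex.I / (ħ : ℂ)) • extensionOf A T x, (x : H)⟫_ℂ).re ≤ 0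
    obtain ⟨x₀, y₀, h0, k, hx, hy⟩ := (mem_extensionOf_graph_iff hA hs T).1
      ((extensionOf A T).mem_graph x)
    have h2 := im_inner_extensionOf_graph hA hs T h0 k
    rw [← hx, ← hy] at h2
    have h3 : ‖T k‖ ≤ ‖k‖ := by simpa using T.le_of_opNorm_le hT k
    have h4 : ‖T k‖ ^ 2 ≤ ‖k‖ ^ 2 := by gcongr
    have h5 : (starRingEnd ℂ) (-Complex.I / (ħ : ℂ)) = ((ħ⁻¹ : ℝ) : ℂ) * Complex.I := by
      rw [map_div₀, map_neg, Complex.conj_I, Complex.conj_ofReal, neg_neg]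
      push_cast; ring
    rw [inner_smul_left, h5, mul_assoc, Complex.re_ofReal_mul, Complex.mul_re, Complex.I_re,
      Complex.I_im, h2]
    have : 0 < ħ⁻¹ := inv_pos.2 hħ
    nlinarith
  · apply LinearPMap.le_of_le_graph
    rintro ⟨x, w⟩ hxw
    -- A pair `(x, w)` of a dissipative extension `A'` corresponds to the value `iħ w` before
    -- multiplication by `-i/ħ`. Solving `(B - i) x' = iħ w - i x` gives a difference `x - x'` on
    -- which `A'` acts as `1/ħ`. Dissipativity then forces it to vanish.
    obtain ⟨x₀, y₀, h0, k, he⟩ := exists_extensionOf_graph_sub hA hs T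
      ((ħ : ℂ) • Complex.I • w - Complex.I • x)
    set x' := x₀ + ((T k : H) + k)
    set y' := y₀ + Complex.I • ((T k : H) - k)
    have hg : (x', (-Complex.I / (ħ : ℂ)) • y') ∈
        ((-Complex.I / (ħ : ℂ)) • extensionOf A T).graph :=
      mem_graph_smul_iff.2 ⟨y', (mem_extensionOf_graph_iff hA hs T).2 ⟨x₀, y₀, h0, k, rfl, rfl⟩, rfl⟩
    have hd := sub_mem hxw (LinearPMap.le_graph_of_le hle hg)
    have hw : w - (-Complex.I / (ħ : ℂ)) • y' = ((ħ⁻¹ : ℝ) : ℂ) • (x - x') := by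
      have hy : y' = (ħ : ℂ) • Complex.I • w - Complex.I • x + Complex.I • x' := by
        rw [he]; abel
      rw [hy]
      simp only [smul_add, smul_sub, smul_smul]
      have e1 : -Complex.I / (ħ : ℂ) * ((ħ : ℂ) * Complex.I) = 1 := by
        field_simp; simp
      have e2 : -Complex.I / (ħ : ℂ) * Complex.I = ((ħ⁻¹ : ℝ) : ℂ) := by
        push_cast; field_simp; simp
      rw [e1, e2]
      module
    have hd' : (x - x', ((ħ⁻¹ : ℝ) : ℂ) • (x - x')) ∈ A'.graph := by rw [← hw]; exact hd
    obtain ⟨hm, hv⟩ := mem_graph_iff_exists.1 hd'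
    have h6 := hA' ⟨_, hm⟩
    rw [hv, inner_smul_left, Complex.conj_ofReal, Complex.re_ofReal_mul] at h6
    have h7 : (⟪x - x', x - x'⟫_ℂ).re = ‖x - x'‖ ^ 2 := inner_self_eq_norm_sq (𝕜 := ℂ) _
    change ħ⁻¹ * (⟪x - x', x - x'⟫_ℂ).re ≤ 0 at h6
    rw [h7] at h6
    have h8 : ‖x - x'‖ ^ 2 = 0 := by
      have : 0 < ħ⁻¹ := inv_pos.2 hħ
      nlinarith [sq_nonneg ‖x - x'‖]
    have h9 : x - x' = 0 := by simpa using h8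
    rw [h9, smul_zero, sub_eq_zero] at hw
    rw [sub_eq_zero] at h9
    rw [h9, hw]
    exact hg

omit hT in
/-- The extension given by a unitary map is self-adjoint. -/
theorem isSelfAdjoint_extensionOf (hU : ∀ k, ‖T k‖ = ‖k‖) (hsurj : Function.Surjective T) :
    IsSelfAdjoint (extensionOf A T) := by
  have hT : ‖T‖ ≤ 1 := T.opNorm_le_bound zero_le_one fun k => by rw [hU k, one_mul]
  have hd := dense_domain_extensionOf hA hs T
  have him : ∀ x y : H, (x, y) ∈ (extensionOf A T).graph → (⟪y, x⟫_ℂ).im = 0 := by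
    intro x y h
    obtain ⟨x₀, y₀, h0, k, rfl, rfl⟩ := (mem_extensionOf_graph_iff hA hs T).1 h
    rw [im_inner_extensionOf_graph hA hs T h0 k, hU, sub_self]
  -- Polarization: reality of the quadratic form at `x + u` and at `x + i u` gives the two parts of
  -- the symmetry relation.
  have hq : ∀ x y u v : H, (x, y) ∈ (extensionOf A T).graph → (u, v) ∈ (extensionOf A T).graph →
      ⟪y, u⟫_ℂ = ⟪x, v⟫_ℂ := by
    intro x y u v h h'
    have h1 := him _ _ (add_mem h h')
    have h2 := him _ _ (add_mem h (Submodule.smul_mem _ Complex.I h'))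
    change (⟪y + v, x + u⟫_ℂ).im = 0 at h1
    change (⟪y + Complex.I • v, x + Complex.I • u⟫_ℂ).im = 0 at h2
    rw [← inner_conj_symm x v]
    simp only [inner_add_left, inner_add_right, inner_smul_left, inner_smul_right, Complex.add_im,
      Complex.mul_im, Complex.mul_re, Complex.add_re, Complex.conj_I, Complex.neg_im, Complex.neg_re, Complex.I_re,
      Complex.I_im, him _ _ h, him _ _ h'] at h1 h2
    apply Complex.ext
    · rw [Complex.conj_re]; linarith
    · rw [Complex.conj_im]; linarith
  have hsym : extensionOf A T ≤ (extensionOf A T)† := by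
    apply LinearPMap.le_of_le_graph
    rintro ⟨x, y⟩ h
    rw [mem_adjoint_graph_iff hd]
    exact fun v => hq _ _ _ _ h ((extensionOf A T).mem_graph v)
  rw [LinearPMap.isSelfAdjoint_def]
  refine le_antisymm (LinearPMap.le_of_le_graph ?_) hsym
  rintro ⟨u, v⟩ huv
  -- Subtracting from `(u, v)` the element of the extension with the same image under `B - i` leaves
  -- an eigenvector of the adjoint for `i`.
  obtain ⟨x₀, y₀, h0, k, he⟩ := exists_extensionOf_graph_sub hA hs T (v - Complex.I • u)
  have hg : (_, _) ∈ (extensionOf A T).graph :=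
    (mem_extensionOf_graph_iff hA hs T).2 ⟨x₀, y₀, h0, k, rfl, rfl⟩
  set x' := x₀ + ((T k : H) + k)
  set y' := y₀ + Complex.I • ((T k : H) - k)
  have hdiff := sub_mem huv (LinearPMap.le_graph_of_le hsym hg)
  have hv : v - y' = Complex.I • (u - x') := by
    linear_combination (norm := module) he
  obtain ⟨a, b, l, hab, hl, hz⟩ := exists_closure_graph_add_deficiency hA hs (c := -Complex.I)
    (Or.inr rfl) (u - x')
  rw [neg_neg] at hl
  -- `B + i` annihilates `k'` and multiplies `T k'` by `2i`, whose inverse is `-i/2`. Surjectivity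
  -- of `T` makes every element of `Ker (i - A*)` available as `T k'`, so `B + i` is onto. The
  -- eigenvector is then orthogonal to itself.
  obtain ⟨k', hk'⟩ := hsurj ⟨(-Complex.I / 2) • l, Submodule.smul_mem _ _ hl⟩
  have hg' : (_, _) ∈ (extensionOf A T).graph :=
    (mem_extensionOf_graph_iff hA hs T).2 ⟨a, b, hab, k', rfl, rfl⟩
  have hz' : u - x' = (b + Complex.I • ((T k' : H) - k')) + Complex.I • (a + (T k' + k')) := by
    rw [hz, hk']
    have e1 : Complex.I * (-Complex.I / 2) = 1 / 2 := by
      linear_combination (-1 / 2) * Complex.I_mul_I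
    simp only [smul_sub, smul_add, smul_smul, e1]
    module
  obtain ⟨hm, hval⟩ := mem_graph_iff_exists.1 hg'
  have h1 := (mem_adjoint_graph_iff hd).1 hdiff ⟨_, hm⟩
  change ⟪v - y', _⟫_ℂ = ⟪u - x', _⟫_ℂ at h1
  rw [hval, hv, inner_smul_left, Complex.conj_I] at h1
  have h2 : ⟪u - x', u - x'⟫_ℂ = 0 := by
    nth_rewrite 2 [hz']
    rw [inner_add_right, ← h1, inner_smul_right]
    ring
  have h3 : u - x' = 0 := inner_self_eq_zero.1 h2
  rw [h3, smul_zero, sub_eq_zero] at hv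
  rw [sub_eq_zero] at h3
  rw [h3, hv]
  exact hg

end Symmetric

/-- Strong convergence of the contractions implies convergence of the extensions. -/
theorem extendedLimit_extensionOf {A : H →ₗ.[ℂ] H} (hA : Dense (A.domain : Set H)) (hs : A ≤ A†)
    {T : ℝ → (deficiency A (-Complex.I) →L[ℂ] deficiency A Complex.I)}
    (hT : ∀ ε, 0 < ε → ‖T ε‖ ≤ 1)
    (hlim : ∀ k, Tendsto (fun ε => T ε k) (𝓝[>] 0) (𝓝 (T 0 k))) {c : ℂ} (hc : c ≠ 0) :
    extendedLimit (fun ε => c • extensionOf A (T ε)) =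
      ((c • extensionOf A (T 0)).graph : Set (H × H)) := by
  have hX : ∀ x₀ y₀ : H, ∀ k : deficiency A (-Complex.I),
      Tendsto (fun ε => x₀ + ((T ε k : H) + k)) (𝓝[>] 0) (𝓝 (x₀ + ((T 0 k : H) + k))) ∧
      Tendsto (fun ε => y₀ + Complex.I • ((T ε k : H) - k)) (𝓝[>] 0)
        (𝓝 (y₀ + Complex.I • ((T 0 k : H) - k))) := by
    intro x₀ y₀ k
    have h : Tendsto (fun ε => (T ε k : H)) (𝓝[>] 0) (𝓝 (T 0 k : H)) :=
      (continuous_subtype_val.tendsto _).comp (hlim k)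
    exact ⟨(h.add_const _).const_add _, ((h.sub_const _).const_smul _).const_add _⟩
  ext ⟨x, w⟩
  rw [SetLike.mem_coe, mem_graph_smul_iff]
  constructor
  · rintro ⟨X, hX1, hX2⟩
    change Tendsto (fun ε => (X ε : H)) (𝓝[>] 0) (𝓝 x) at hX1
    change Tendsto (fun ε => c • extensionOf A (T ε) (X ε)) (𝓝[>] 0) (𝓝 w) at hX2
    have hX3 : Tendsto (fun ε => extensionOf A (T ε) (X ε)) (𝓝[>] 0) (𝓝 (c⁻¹ • w)) := by
      have := hX2.const_smul c⁻¹
      simpa [smul_smul, inv_mul_cancel₀ hc] using this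
    refine ⟨c⁻¹ • w, ?_, by rw [smul_smul, mul_inv_cancel₀ hc, one_smul]⟩
    obtain ⟨x₀, y₀, h0, k, he⟩ := exists_extensionOf_graph_sub hA hs (T 0)
      (c⁻¹ • w - Complex.I • x)
    -- The terms with `T ε k` cancel in `B - i`, so the data found for `T 0` solve the equation for
    -- every `ε`. The uniform bound compares this solution with `X ε`.
    have he' : ∀ ε, c⁻¹ • w - Complex.I • x =
        (y₀ + Complex.I • ((T ε k : H) - k)) - Complex.I • (x₀ + (T ε k + k)) := by
      intro ε; rw [he]; module
    have hz : Tendsto (fun ε => ‖(extensionOf A (T ε) (X ε) - Complex.I • (X ε : H))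
        - (c⁻¹ • w - Complex.I • x)‖) (𝓝[>] 0) (𝓝 0) := by
      have := ((hX3.sub (hX1.const_smul Complex.I)).sub_const (c⁻¹ • w - Complex.I • x)).norm
      simpa using this
    have hb : ∀ᶠ ε in 𝓝[>] (0 : ℝ), ‖(X ε : H) - (x₀ + (T ε k + k))‖ ≤
          ‖(extensionOf A (T ε) (X ε) - Complex.I • (X ε : H)) - (c⁻¹ • w - Complex.I • x)‖ ∧
        ‖extensionOf A (T ε) (X ε) - (y₀ + Complex.I • ((T ε k : H) - k))‖ ≤
          ‖(extensionOf A (T ε) (X ε) - Complex.I • (X ε : H)) - (c⁻¹ • w - Complex.I • x)‖ := by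
      filter_upwards [self_mem_nhdsWithin] with ε hε
      have hg : (_, _) ∈ (extensionOf A (T ε)).graph :=
        (mem_extensionOf_graph_iff hA hs (T ε)).2 ⟨x₀, y₀, h0, k, rfl, rfl⟩
      have := norm_le_of_extensionOf_graph hA hs (hT ε hε)
        (sub_mem ((extensionOf A (T ε)).mem_graph (X ε)) hg)
      have e : (extensionOf A (T ε) (X ε) - Complex.I • (X ε : H)) - (c⁻¹ • w - Complex.I • x) =
          (extensionOf A (T ε) (X ε) - (y₀ + Complex.I • ((T ε k : H) - k))) -
            Complex.I • ((X ε : H) - (x₀ + (T ε k + k))) := by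
        rw [he' ε]; module
      rw [e]
      exact this
    have hx : x₀ + ((T 0 k : H) + k) = x := by
      refine tendsto_nhds_unique (hX x₀ y₀ k).1 ?_
      have h1 : Tendsto (fun ε => (X ε : H) - (x₀ + (T ε k + k))) (𝓝[>] 0) (𝓝 0) :=
        squeeze_zero_norm' (hb.mono fun ε h => h.1) hz
      simpa using hX1.sub h1
    have hy : y₀ + Complex.I • ((T 0 k : H) - k) = c⁻¹ • w := by
      refine tendsto_nhds_unique (hX x₀ y₀ k).2 ?_
      have h1 : Tendsto (fun ε => extensionOf A (T ε) (X ε) - (y₀ + Complex.I • ((T ε k : H) - k)))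
          (𝓝[>] 0) (𝓝 0) := squeeze_zero_norm' (hb.mono fun ε h => h.2) hz
      simpa using hX3.sub h1
    exact (mem_extensionOf_graph_iff hA hs (T 0)).2 ⟨x₀, y₀, h0, k, hx.symm, hy.symm⟩
  · rintro ⟨y, hg, rfl⟩
    obtain ⟨x₀, y₀, h0, k, rfl, rfl⟩ := (mem_extensionOf_graph_iff hA hs (T 0)).1 hg
    have hm : ∀ ε, ∃ h : x₀ + ((T ε k : H) + k) ∈ (extensionOf A (T ε)).domain,
        extensionOf A (T ε) ⟨_, h⟩ = y₀ + Complex.I • ((T ε k : H) - k) := fun ε =>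
      mem_graph_iff_exists.1 ((mem_extensionOf_graph_iff hA hs (T ε)).2 ⟨x₀, y₀, h0, k, rfl, rfl⟩)
    refine ⟨fun ε => ⟨_, (hm ε).1⟩, (hX x₀ y₀ k).1, ?_⟩
    have h2 : ∀ ε, (c • extensionOf A (T ε)) ⟨_, (hm ε).1⟩ =
        c • (y₀ + Complex.I • ((T ε k : H) - k)) := fun ε => congrArg (c • ·) (hm ε).2
    simp only [h2]
    exact (hX x₀ y₀ k).2.const_smul c

end Abstract

/-! ### Functions with a vanishing weak directional derivative -/

section Mollify

variable {E : Type*} [NormedAddCommGroup E] [NormedSpace ℝ E] [FiniteDimensional ℝ E]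
  [MeasurableSpace E] [BorelSpace E] {μ : Measure E} [μ.IsAddHaarMeasure]

/-- The derivative of a mollification in a direction in which the weak derivative vanishes. -/
theorem hasFDerivAt_mollify {v : E → ℂ} (hv : LocallyIntegrable v μ) {S : Set E} {d : E}
    (hd : ∀ g : E → ℝ, ContDiff ℝ ∞ g → HasCompactSupport g → tsupport g ⊆ S →
      ∫ x, fderiv ℝ g x d • v x ∂μ = 0)
    (b : ContDiffBump (0 : E)) {x : E} (hx : Metric.closedBall x b.rOut ⊆ S) :
    ∃ L : E →L[ℝ] ℂ, L d = 0 ∧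
      HasFDerivAt (convolution (b.normed μ) v (ContinuousLinearMap.lsmul ℝ ℝ) μ) L x := by
  have hb1 : ContDiff ℝ 1 (b.normed μ) := b.contDiff_normed (n := 1)
  have h := b.hasCompactSupport_normed (μ := μ) |>.hasFDerivAt_convolution_right
    (ContinuousLinearMap.lsmul ℝ ℝ : ℝ →L[ℝ] ℂ →L[ℝ] ℂ).flip hv hb1 x
  rw [convolution_flip] at h
  refine ⟨_, ?_, h⟩
  rw [convolution_precompR_apply _ hv (b.hasCompactSupport_normed.fderiv ℝ)
    (hb1.continuous_fderiv one_ne_zero), convolution_def]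
  have hg : ∀ t, HasFDerivAt (fun t => b.normed μ (x - t)) (-(fderiv ℝ (b.normed μ) (x - t))) t := by
    intro t
    have h1 : HasFDerivAt (b.normed μ) (fderiv ℝ (b.normed μ) (x - t)) (x - t) :=
      (hb1.differentiable one_ne_zero _).hasFDerivAt
    have h2 : HasFDerivAt (fun t : E => x - t) (-(ContinuousLinearMap.id ℝ E)) t := by
      simpa using (hasFDerivAt_id t).const_sub x
    have h3 := h1.comp t h2
    rwa [ContinuousLinearMap.comp_neg, ContinuousLinearMap.comp_id] at h3
  have hsupp : tsupport (fun t => b.normed μ (x - t)) ⊆ Metric.closedBall x b.rOut := by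
    refine closure_minimal (fun t ht => ?_) Metric.isClosed_closedBall
    have h1 : x - t ∈ Function.support (b.normed μ) := ht
    rw [b.support_normed_eq, mem_ball_zero_iff] at h1
    rw [mem_closedBall_iff_norm']
    exact h1.le
  -- The derivative of the mollification in the direction `d` is, up to sign, the weak derivative of
  -- `v` tested against the reflected and translated bump.
  have h0 := hd (fun t => b.normed μ (x - t)) (b.contDiff_normed.comp (contDiff_const.sub contDiff_id))
    ((isCompact_closedBall x b.rOut).of_isClosed_subset (isClosed_tsupport _) hsupp)
    (hsupp.trans hx)
  have e : ∀ t, (ContinuousLinearMap.lsmul ℝ ℝ : ℝ →L[ℝ] ℂ →L[ℝ] ℂ).flip (v t)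
      (fderiv ℝ (b.normed μ) (x - t) d) =
        -(fderiv ℝ (fun t => b.normed μ (x - t)) t d • v t) := by
    intro t
    rw [(hg t).fderiv]
    simp
  simp_rw [e, integral_neg, h0, neg_zero]

/-- On a convex set, a locally integrable function with a vanishing weak derivative in the
direction `d` is a function of the base point of the line in the direction `d`. -/
theorem exists_ae_eq_comp_of_weak_deriv_eq_zero {v : E → ℂ} (hv : LocallyIntegrable v μ)
    {S : Set E} (hS : IsOpen S) (hSc : Convex ℝ S) {d : E}
    (hd : ∀ g : E → ℝ, ContDiff ℝ ∞ g → HasCompactSupport g → tsupport g ⊆ S →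
      ∫ x, fderiv ℝ g x d • v x ∂μ = 0)
    {σ : E → E} (hσ : ∀ x ∈ S, σ x ∈ S) (hσd : ∀ x ∈ S, ∃ h : ℝ, σ x = x + h • d) :
    ∃ F : E → ℂ, Measurable F ∧ ∀ᵐ x ∂μ, x ∈ S → v x = F (σ x) := by
  let b : ℕ → ContDiffBump (0 : E) := fun n =>
    ⟨1 / ((n : ℝ) + 1) / 2, 1 / ((n : ℝ) + 1), by positivity, half_lt_self (by positivity)⟩
  let w : ℕ → E → ℂ := fun n => convolution ((b n).normed μ) v (ContinuousLinearMap.lsmul ℝ ℝ) μ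
  have hr : Tendsto (fun n => (b n).rOut) atTop (𝓝 0) := tendsto_one_div_add_atTop_nhds_zero_nat
  -- By convexity, balls centred on the segment between the two points stay in `S`, so the
  -- mollification is differentiable along it with derivative zero.
  have hconst : ∀ n, ∀ x y : E, ∀ h : ℝ, y = x + h • d → Metric.closedBall x (b n).rOut ⊆ S →
      Metric.closedBall y (b n).rOut ⊆ S → w n y = w n x := by
    rintro n x y h rfl hx hy
    have hseg : ∀ θ ∈ Icc (0 : ℝ) 1, Metric.closedBall (x + θ • h • d) (b n).rOut ⊆ S := by
      intro θ hθ z hz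
      have h1 : z + -(θ • h • d) ∈ Metric.closedBall x (b n).rOut := by
        rw [mem_closedBall_iff_norm] at hz ⊢
        convert hz using 2; abel
      have h2 : z + -(θ • h • d) + h • d ∈ Metric.closedBall (x + h • d) (b n).rOut := by
        rw [mem_closedBall_iff_norm] at hz ⊢
        convert hz using 2; abel
      have h3 := hSc (hx h1) (hy h2) (sub_nonneg.2 hθ.2) hθ.1 (by ring)
      convert h3 using 1
      module
    have hder : ∀ θ ∈ Icc (0 : ℝ) 1,
        HasDerivWithinAt (fun θ : ℝ => w n (x + θ • h • d)) 0 (Icc 0 1) θ := by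
      intro θ hθ
      obtain ⟨L, hL, hw⟩ := hasFDerivAt_mollify hv hd (b n) (hseg θ hθ)
      have h1 : HasDerivAt (fun θ : ℝ => x + θ • h • d) (h • d) θ := by
        simpa using ((hasDerivAt_id θ).smul_const (h • d)).const_add x
      have h2 := hw.comp_hasDerivAt θ h1
      rw [map_smul, hL, smul_zero] at h2
      exact h2.hasDerivWithinAt
    have := norm_image_sub_le_of_norm_deriv_le_segment_01' (C := 0) hder (by simp)
    simpa [sub_eq_zero] using this
  have hwc : ∀ n, Continuous (w n) := fun n =>
    (b n).hasCompactSupport_normed.continuous_convolution_left _ (b n).continuous_normed hv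
  -- A pointwise limit is used because `σ` may map `S` into a null set, where an almost everywhere
  -- representative of `v` says nothing. At `σ x` the mollifications eventually equal those at `x`,
  -- so they converge there for almost every `x`. The value of `limUnder` elsewhere is irrelevant,
  -- and the function is measurable in any case.
  refine ⟨fun x => limUnder atTop fun n => w n x,
    (StronglyMeasurable.limUnder fun n => (hwc n).stronglyMeasurable).measurable, ?_⟩
  have hlim := ContDiffBump.ae_convolution_tendsto_right_of_locallyIntegrable (μ := μ) (φ := b)
    (l := atTop) (K := 2) hr (Eventually.of_forall fun n => by
      change 1 / ((n : ℝ) + 1) ≤ 2 * (1 / ((n : ℝ) + 1) / 2)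
      linarith) hv
  have hev : ∀ x ∈ S, ∀ᶠ n in atTop, Metric.closedBall x (b n).rOut ⊆ S := by
    intro x hx
    obtain ⟨r, hr0, hrS⟩ := Metric.isOpen_iff.1 hS x hx
    filter_upwards [hr.eventually (gt_mem_nhds hr0)] with n hn
    exact (Metric.closedBall_subset_ball hn).trans hrS
  filter_upwards [hlim] with x hx hxS
  obtain ⟨h, hh⟩ := hσd x hxS
  refine (Tendsto.limUnder_eq ?_).symm
  refine hx.congr' ?_
  filter_upwards [hev x hxS, hev _ (hσ x hxS)] with n h1 h2
  exact (hconst n x (σ x) h hh h1 h2).symm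

end Mollify

/-! ### Characteristic coordinates -/

theorem convex_S₁ : Convex ℝ (S₁ : Set Config) := by
  intro x hx y hy a b ha hb hab
  obtain ⟨h1, h2⟩ := hx
  obtain ⟨h3, h4⟩ := hy
  have hne : 0 < a ∨ 0 < b := by
    rcases ha.eq_or_lt with rfl | h
    · right; linarith
    · exact Or.inl h
  change a * x.2.1 + b * y.2.1 < a * x.1 + b * y.1 ∧ a * x.1 + b * y.1 < a * x.2.2 + b * y.2.2
  rcases hne with h | h
  · constructor
    · nlinarith [mul_lt_mul_of_pos_left h1 h, mul_le_mul_of_nonneg_left h3.le hb]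
    · nlinarith [mul_lt_mul_of_pos_left h2 h, mul_le_mul_of_nonneg_left h4.le hb]
  · constructor
    · nlinarith [mul_le_mul_of_nonneg_left h1.le ha, mul_lt_mul_of_pos_left h3 h]
    · nlinarith [mul_le_mul_of_nonneg_left h2.le ha, mul_lt_mul_of_pos_left h4 h]

instance isAddHaarMeasure_plane : (volume : Measure (ℝ × ℝ)).IsAddHaarMeasure :=
  Measure.prod.instIsAddHaarMeasure (volume : Measure ℝ) (volume : Measure ℝ)

instance isAddHaarMeasure_config : (volume : Measure Config).IsAddHaarMeasure :=
  Measure.prod.instIsAddHaarMeasure (volume : Measure ℝ) (volume : Measure (ℝ × ℝ))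

theorem measurableSet_S₁ : MeasurableSet (S₁ : Set Config) := S₁.isOpen.measurableSet

/-- Linear coordinates `(τ, y)` of which `τ` runs along a characteristic direction. The
characteristics in `S₁` are labelled by `y ∈ base`; the values of `τ` on them form `slice y`. -/
structure CharChart where
  equiv : (ℝ × ℝ × ℝ) ≃L[ℝ] Config
  base : Set (ℝ × ℝ)
  slice : ℝ × ℝ → Set ℝ
  mid : ℝ × ℝ → ℝ
  volume_eq : (volume : Measure Config) = (4 : ENNReal) • Measure.map equiv volume
  mem_iff : ∀ τ y, equiv (τ, y) ∈ (S₁ : Set Config) ↔ y ∈ base ∧ τ ∈ slice y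
  isOpen_base : IsOpen base
  measurable_mid : Measurable mid
  mid_mem : ∀ y ∈ base, mid y ∈ slice y

namespace CharChart

variable (ch : CharChart)

/-- The direction of the characteristics. -/
def direction : Config := ch.equiv (1, 0, 0)

/-- The function `e^{c τ} f(y)`. -/
def form (c : ℝ) (f : ℝ × ℝ → ℂ) (x : Config) : ℂ :=
  (Real.exp (c * (ch.equiv.symm x).1) : ℂ) * f (ch.equiv.symm x).2

theorem equiv_add (τ h : ℝ) (y : ℝ × ℝ) :
    ch.equiv (τ + h, y) = ch.equiv (τ, y) + h • ch.direction := by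
  rw [direction, ← map_smul, ← map_add]
  congr 1
  ext <;> simp

theorem form_equiv (c : ℝ) (f : ℝ × ℝ → ℂ) (τ : ℝ) (y : ℝ × ℝ) :
    ch.form c f (ch.equiv (τ, y)) = (Real.exp (c * τ) : ℂ) * f y := by
  simp [form]

theorem measurable_form (c : ℝ) {f : ℝ × ℝ → ℂ} (hf : Measurable f) : Measurable (ch.form c f) := by
  have h : Measurable ch.equiv.symm := ch.equiv.symm.continuous.measurable
  have h1 : Measurable fun x => (ch.equiv.symm x).1 := measurable_fst.comp h
  exact (Complex.measurable_ofReal.comp (Real.measurable_exp.comp (h1.const_mul c))).mul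
    (hf.comp (measurable_snd.comp h))

theorem measurableSet_slice {y : ℝ × ℝ} (hy : y ∈ ch.base) : MeasurableSet (ch.slice y) := by
  have : ch.slice y = (fun τ => ch.equiv (τ, y)) ⁻¹' (S₁ : Set Config) := by
    ext τ
    simp [ch.mem_iff, hy]
  rw [this]
  exact measurableSet_S₁.preimage (ch.equiv.continuous.measurable.comp (by fun_prop))

theorem mem_base_of_mem {x : Config} (hx : x ∈ (S₁ : Set Config)) :
    (ch.equiv.symm x).2 ∈ ch.base ∧ (ch.equiv.symm x).1 ∈ ch.slice (ch.equiv.symm x).2 := by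
  rw [← ch.mem_iff]
  simpa using hx

theorem lintegral_S₁ {F : Config → ENNReal} (hF : Measurable F) :
    ∫⁻ x in (S₁ : Set Config), F x =
      4 * ∫⁻ y in ch.base, ∫⁻ τ in ch.slice y, F (ch.equiv (τ, y)) := by
  have hm : Measurable ch.equiv := ch.equiv.continuous.measurable
  have hFi : Measurable ((S₁ : Set Config).indicator F) := hF.indicator measurableSet_S₁
  rw [← lintegral_indicator measurableSet_S₁, ch.volume_eq, lintegral_smul_measure,
    lintegral_map hFi hm, ← lintegral_indicator ch.isOpen_base.measurableSet]
  have hprod : ∫⁻ z, (S₁ : Set Config).indicator F (ch.equiv z) =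
      ∫⁻ y, ∫⁻ τ, (S₁ : Set Config).indicator F (ch.equiv (τ, y)) :=
    lintegral_prod_symm (μ := (volume : Measure ℝ)) (ν := (volume : Measure (ℝ × ℝ)))
      (fun z => (S₁ : Set Config).indicator F (ch.equiv z)) (hFi.comp hm).aemeasurable
  rw [hprod, smul_eq_mul]
  congr 1
  refine lintegral_congr fun y => ?_
  by_cases hy : y ∈ ch.base
  · rw [indicator_of_mem hy, ← lintegral_indicator (ch.measurableSet_slice hy)]
    refine lintegral_congr fun τ => ?_
    by_cases hτ : τ ∈ ch.slice y
    · rw [indicator_of_mem hτ, indicator_of_mem ((ch.mem_iff τ y).2 ⟨hy, hτ⟩)]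
    · rw [indicator_of_notMem hτ, indicator_of_notMem fun h => hτ ((ch.mem_iff τ y).1 h).2]
  · rw [indicator_of_notMem hy]
    refine (lintegral_congr fun τ => ?_).trans lintegral_zero
    rw [indicator_of_notMem fun h => hy ((ch.mem_iff τ y).1 h).1]

theorem integrable_comp_equiv {G : Config → ℂ} (hG : IntegrableOn G (S₁ : Set Config)) :
    Integrable (fun z => (S₁ : Set Config).indicator G (ch.equiv z)) := by
  have h1 : Integrable ((S₁ : Set Config).indicator G) := hG.integrable_indicator measurableSet_S₁
  rw [ch.volume_eq, integrable_smul_measure (by norm_num) (by norm_num)] at h1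
  exact (ch.equiv.toHomeomorph.measurableEmbedding.integrable_map_iff).1 h1

theorem integral_S₁ {G : Config → ℂ} (hG : IntegrableOn G (S₁ : Set Config)) :
    ∫ x in (S₁ : Set Config), G x =
      4 * ∫ y in ch.base, ∫ τ in ch.slice y, G (ch.equiv (τ, y)) := by
  have h1 := ch.integrable_comp_equiv hG
  have hprod : ∫ z, (S₁ : Set Config).indicator G (ch.equiv z) =
      ∫ y, ∫ τ, (S₁ : Set Config).indicator G (ch.equiv (τ, y)) :=
    integral_prod_symm (μ := (volume : Measure ℝ)) (ν := (volume : Measure (ℝ × ℝ)))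
      (fun z => (S₁ : Set Config).indicator G (ch.equiv z)) h1
  have hmap : ∫ x, (S₁ : Set Config).indicator G x ∂(Measure.map ch.equiv volume) =
      ∫ z, (S₁ : Set Config).indicator G (ch.equiv z) :=
    ch.equiv.toHomeomorph.measurableEmbedding.integral_map _
  rw [← integral_indicator measurableSet_S₁, ch.volume_eq, integral_smul_measure, hmap, hprod,
    ← integral_indicator ch.isOpen_base.measurableSet]
  have h4 : (4 : ENNReal).toReal = 4 := by norm_num
  rw [h4, Complex.real_smul]
  norm_cast
  congr 1
  refine integral_congr_ae (Eventually.of_forall fun y => ?_)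
  by_cases hy : y ∈ ch.base
  · simp only [indicator_of_mem hy]
    rw [← integral_indicator (ch.measurableSet_slice hy)]
    refine integral_congr_ae (Eventually.of_forall fun τ => ?_)
    by_cases hτ : τ ∈ ch.slice y
    · simp only [indicator_of_mem hτ]
      rw [indicator_of_mem ((ch.mem_iff τ y).2 ⟨hy, hτ⟩)]
    · simp only [indicator_of_notMem hτ]
      rw [indicator_of_notMem fun h => hτ ((ch.mem_iff τ y).1 h).2]
  · simp only [indicator_of_notMem hy]
    refine (integral_congr_ae (Eventually.of_forall fun τ => ?_)).trans (integral_zero _ _)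
    exact indicator_of_notMem (fun h => hy ((ch.mem_iff τ y).1 h).1) _

/-- A square integrable function with `D u = c u` weakly, where `D` is the derivative in the
direction of the characteristics, has the form `e^{c τ} f(y)`. -/
theorem exists_form {u : Config → ℂ} (hu : MemLp u 2 (volume.restrict (S₁ : Set Config))) {c : ℝ}
    (h : ∀ φ : TestFunction S₁ ℂ ⊤,
      ∫ x in (S₁ : Set Config), (u x * fderiv ℝ φ x ch.direction + c * u x * φ x) = 0) :
    ∃ f : ℝ × ℝ → ℂ, Measurable f ∧ u =ᵐ[volume.restrict (S₁ : Set Config)] ch.form c f := by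
  let τ : Config → ℝ := fun x => (ch.equiv.symm x).1
  have hτc : ContDiff ℝ ∞ τ := contDiff_fst.comp ch.equiv.symm.contDiff
  have hτd : ∀ x, HasFDerivAt τ
      ((ContinuousLinearMap.fst ℝ ℝ (ℝ × ℝ)).comp (ch.equiv.symm : Config →L[ℝ] ℝ × ℝ × ℝ)) x :=
    fun x => ((ContinuousLinearMap.fst ℝ ℝ (ℝ × ℝ)).comp
      (ch.equiv.symm : Config →L[ℝ] ℝ × ℝ × ℝ)).hasFDerivAt
  -- The integrating factor: multiplication by `e^{-c τ}` turns `D u = c u` into `D v = 0`.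
  let e : Config → ℂ := fun x => ((Real.exp (-c * τ x) : ℝ) : ℂ)
  have hec : ContDiff ℝ ∞ e :=
    Complex.ofRealCLM.contDiff.comp (Real.contDiff_exp.comp (contDiff_const.mul hτc))
  have hed : ∀ x, HasFDerivAt e
      (Complex.ofRealCLM.comp (Real.exp (-c * τ x) • (-c) •
        (ContinuousLinearMap.fst ℝ ℝ (ℝ × ℝ)).comp (ch.equiv.symm : Config →L[ℝ] ℝ × ℝ × ℝ))) x :=
    fun x => Complex.ofRealCLM.hasFDerivAt.comp x
      ((Real.hasDerivAt_exp _).comp_hasFDerivAt x ((hτd x).const_mul (-c)))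
  let v : Config → ℂ := (S₁ : Set Config).indicator fun x => e x * u x
  have hv : LocallyIntegrable v := by
    have h1 : LocallyIntegrable u (volume.restrict (S₁ : Set Config)) :=
      hu.locallyIntegrable (by norm_num)
    have h2 : LocallyIntegrable (fun x => e x * u x) (volume.restrict (S₁ : Set Config)) := by
      rw [← locallyIntegrableOn_univ] at h1 ⊢
      exact h1.continuousOn_mul hec.continuous.continuousOn isOpen_univ.isLocallyClosed
    intro x
    obtain ⟨U, hU, hUi⟩ := h2 x
    refine ⟨U, hU, ?_⟩
    rw [integrableOn_indicator_iff measurableSet_S₁, inter_comm]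
    rwa [IntegrableOn, Measure.restrict_restrict' measurableSet_S₁] at hUi
  have hd : ∀ g : Config → ℝ, ContDiff ℝ ∞ g → HasCompactSupport g →
      tsupport g ⊆ (S₁ : Set Config) → ∫ x, fderiv ℝ g x ch.direction • v x = 0 := by
    intro g hg hgc hgs
    -- Testing with `e g` produces the term `-c e g`, which cancels the zeroth order term and leaves
    -- `e u D g`.
    let φ : TestFunction S₁ ℂ ⊤ := ⟨fun x => e x * (g x : ℂ),
      hec.mul (Complex.ofRealCLM.contDiff.comp hg),
      (hgc.comp_left (g := fun r : ℝ => (r : ℂ)) (by simp)).mul_left,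
      (tsupport_mul_subset_right).trans ((tsupport_comp_subset
        (g := fun r : ℝ => (r : ℂ)) Complex.ofReal_zero g).trans hgs)⟩
    have hφ := h φ
    rw [← hφ, ← integral_indicator measurableSet_S₁]
    refine integral_congr_ae (Eventually.of_forall fun x => ?_)
    by_cases hx : x ∈ (S₁ : Set Config)
    · have hgd : HasFDerivAt (fun x => (g x : ℂ)) (Complex.ofRealCLM.comp (fderiv ℝ g x)) x :=
        Complex.ofRealCLM.hasFDerivAt.comp x (hg.differentiable (by simp) x).hasFDerivAt
      have hφd : fderiv ℝ φ x = _ := ((hed x).mul hgd).fderiv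
      have hdir : (ch.equiv.symm ch.direction).1 = 1 := by simp [direction]
      simp only [v, indicator_of_mem hx, hφd]
      simp [hdir, e, φ]
      ring
    · simp [v, indicator_of_notMem hx]
  -- Each point is moved along its characteristic to the marked point `mid`, so that a function of
  -- `σ x` is a function of the label alone.
  let σ : Config → Config := fun x => ch.equiv (ch.mid (ch.equiv.symm x).2, (ch.equiv.symm x).2)
  obtain ⟨F, hF, hvF⟩ := exists_ae_eq_comp_of_weak_deriv_eq_zero hv S₁.isOpen convex_S₁ hd (σ := σ)
    (fun x hx => (ch.mem_iff _ _).2 ⟨(ch.mem_base_of_mem hx).1, ch.mid_mem _ (ch.mem_base_of_mem hx).1⟩)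
    (fun x hx => ⟨ch.mid (ch.equiv.symm x).2 - τ x, by
      have := ch.equiv_add (τ x) (ch.mid (ch.equiv.symm x).2 - τ x) (ch.equiv.symm x).2
      rw [add_sub_cancel] at this
      simpa [τ, σ] using this⟩)
  refine ⟨fun y => F (ch.equiv (ch.mid y, y)),
    hF.comp (ch.equiv.continuous.measurable.comp (ch.measurable_mid.prodMk measurable_id)), ?_⟩
  rw [Filter.EventuallyEq, ae_restrict_iff' measurableSet_S₁]
  filter_upwards [hvF] with x hx hxS
  have h1 := hx hxS
  simp only [v, indicator_of_mem hxS] at h1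
  have h2 : ((Real.exp (c * τ x) : ℝ) : ℂ) * e x = 1 := by
    simp only [e]
    rw [← Complex.ofReal_mul, ← Real.exp_add]
    simp
  calc u x = ((Real.exp (c * τ x) : ℝ) : ℂ) * e x * u x := by rw [h2, one_mul]
    _ = _ := by rw [mul_assoc, h1]; rfl

/-- The square of the `L²` norm of `e^{c τ} f(y)`. -/
theorem lintegral_form (c : ℝ) {f : ℝ × ℝ → ℂ} (hf : Measurable f) :
    ∫⁻ x in (S₁ : Set Config), ‖ch.form c f x‖ₑ ^ 2 =
      4 * ∫⁻ y in ch.base, ‖f y‖ₑ ^ 2 * ∫⁻ τ in ch.slice y, ENNReal.ofReal (Real.exp (2 * c * τ)) := by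
  rw [ch.lintegral_S₁ ((ch.measurable_form c hf).enorm.pow_const 2)]
  congr 1
  refine lintegral_congr fun y => ?_
  rw [← lintegral_const_mul' _ _ (by simp)]
  refine lintegral_congr fun τ => ?_
  rw [form_equiv, enorm_mul, mul_pow, mul_comm]
  congr 1
  rw [← ofReal_norm, ← ENNReal.ofReal_pow (norm_nonneg _), Complex.norm_real,
    Real.norm_of_nonneg (Real.exp_pos _).le, ← Real.exp_nat_mul]
  congr 2
  push_cast; ring

theorem lintegral_lt_top_of_memLp {u : Config → ℂ}
    (hu : MemLp u 2 (volume.restrict (S₁ : Set Config))) :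
    ∫⁻ x in (S₁ : Set Config), ‖u x‖ₑ ^ 2 < ⊤ := by
  have := hu.2
  rw [eLpNorm_lt_top_iff_lintegral_rpow_enorm_lt_top (by norm_num) (by norm_num)] at this
  simpa using this

/-- A square integrable function `e^{c τ} f(y)` vanishes if `e^{c τ}` is not square integrable. -/
theorem form_ae_eq_zero {c : ℝ} {f : ℝ × ℝ → ℂ} (hf : Measurable f)
    (hu : MemLp (ch.form c f) 2 (volume.restrict (S₁ : Set Config)))
    (hinf : ∀ y ∈ ch.base, ∫⁻ τ in ch.slice y, ENNReal.ofReal (Real.exp (2 * c * τ)) = ⊤) :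
    ch.form c f =ᵐ[volume.restrict (S₁ : Set Config)] 0 := by
  have h1 := lintegral_lt_top_of_memLp hu
  rw [ch.lintegral_form c hf, setLIntegral_congr_fun ch.isOpen_base.measurableSet
    (g := fun y => ‖f y‖ₑ ^ 2 * ⊤) (fun y hy => by simp only [hinf y hy])] at h1
  have hm : Measurable fun y => ‖f y‖ₑ ^ 2 * (⊤ : ENNReal) := (hf.enorm.pow_const 2).mul_const _
  have h2 : ∫⁻ y in ch.base, ‖f y‖ₑ ^ 2 * (⊤ : ENNReal) ≠ ⊤ := by
    intro h
    rw [h] at h1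
    simp at h1
  have h3 : ∫⁻ y in ch.base, ‖f y‖ₑ ^ 2 * (⊤ : ENNReal) = 0 := by
    rw [lintegral_mul_const _ (hf.enorm.pow_const 2)] at h2 ⊢
    by_contra h0
    have : ∫⁻ y in ch.base, ‖f y‖ₑ ^ 2 ≠ 0 := fun h => h0 (by rw [h, zero_mul])
    exact h2 (ENNReal.mul_top this)
  have h4 : ∫⁻ x in (S₁ : Set Config), ‖ch.form c f x‖ₑ ^ 2 = 0 := by
    rw [ch.lintegral_form c hf, setLIntegral_congr_fun ch.isOpen_base.measurableSet
      (g := fun y => ‖f y‖ₑ ^ 2 * ⊤) (fun y hy => by simp only [hinf y hy]), h3, mul_zero]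
  rw [lintegral_eq_zero_iff ((ch.measurable_form c hf).enorm.pow_const 2)] at h4
  filter_upwards [h4] with x hx
  simpa using hx

end CharChart

/-! ### Uniqueness of traces -/

section Trace

variable {N : Opens Config} {ι : ℝ × ℝ → Config} {κ : ℝ} {d : Config}

/-- The complexification of a real test function. -/
def complexTest {N : Opens Config} (g : Config → ℝ) (hg : ContDiff ℝ ∞ g)
    (hgc : HasCompactSupport g) (hgs : tsupport g ⊆ (N : Set Config)) : TestFunction N ℂ ⊤ :=
  ⟨fun x => (g x : ℂ), Complex.ofRealCLM.contDiff.comp hg,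
    hgc.comp_left (g := fun r : ℝ => (r : ℂ)) (by simp),
    (tsupport_comp_subset (g := fun r : ℝ => (r : ℂ)) Complex.ofReal_zero g).trans hgs⟩

theorem HasTrace.congr_trace {u : Config → ℂ} {g g' : ℝ × ℝ → ℂ} (hN : MeasurableSet (ι ⁻¹' (N : Set Config)))
    (h : HasTrace N ι κ d u g) (hg : ∀ p, ι p ∈ N → g p = g' p) : HasTrace N ι κ d u g' := by
  obtain ⟨hl, w, hw, hG⟩ := h
  refine ⟨hl.congr ((ae_restrict_iff' hN).2 (Eventually.of_forall hg)), w, hw, fun φ => ?_⟩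
  rw [hG φ]
  congr 1
  exact setIntegral_congr_fun hN fun p hp => by simp only [hg p hp]

/-- Test functions supported in `S₁` do not see the face, so Green's formula for `u = 0` makes the
weak derivative `w` vanish. What remains says that `g` is orthogonal to all restrictions of test
functions to the face, and every test function on the face is such a restriction. -/
theorem ae_eq_zero_of_hasTrace_zero (hN : S₁ ≤ N) (hι : IsClosedEmbedding ι)
    (hS : ∀ p, ι p ∉ (S₁ : Set Config)) {ρ : Config → ℝ × ℝ} (hρ : ContDiff ℝ ∞ ρ)
    (hρι : ∀ p, ρ (ι p) = p) (hκ : κ ≠ 0) {g : ℝ × ℝ → ℂ}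
    (h : HasTrace N ι κ d (fun _ => 0) g) : ∀ᵐ p, p ∈ ι ⁻¹' (N : Set Config) → g p = 0 := by
  obtain ⟨hl, w, hw, hG⟩ := h
  have hw0 : ∀ᵐ x, x ∈ (S₁ : Set Config) → w x = 0 := by
    refine S₁.isOpen.ae_eq_zero_of_integral_contDiff_smul_eq_zero
      (locallyIntegrableOn_of_locallyIntegrable_restrict (hw.locallyIntegrable (by norm_num)))
      fun k hk hkc hks => ?_
    have h1 := hG (complexTest k hk hkc (hks.trans hN))
    have h2 : ∀ p, (complexTest k hk hkc (hks.trans hN) : Config → ℂ) (ι p) = 0 := fun p => by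
      change ((k (ι p) : ℝ) : ℂ) = 0
      rw [image_eq_zero_of_notMem_tsupport fun hp => hS p (hks hp), Complex.ofReal_zero]
    simp only [h2, mul_zero, integral_zero, zero_mul, zero_add] at h1
    rw [← integral_indicator measurableSet_S₁] at h1
    rw [← h1]
    refine integral_congr_ae (Eventually.of_forall fun x => ?_)
    by_cases hx : x ∈ (S₁ : Set Config)
    · simp only [indicator_of_mem hx]
      rw [Complex.real_smul, mul_comm]
      rfl
    · simp only [indicator_of_notMem hx]
      rw [image_eq_zero_of_notMem_tsupport fun hp => hx (hks hp), zero_smul]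
  have hw1 : ∀ φ : TestFunction N ℂ ⊤, ∫ p in ι ⁻¹' (N : Set Config), g p * φ (ι p) = 0 := by
    intro φ
    have h1 := hG φ
    rw [integral_congr_ae (g := fun _ => 0) (by
      filter_upwards [(ae_restrict_iff' measurableSet_S₁).2 hw0] with x hx
      simp [hx]), integral_zero] at h1
    exact (mul_eq_zero.1 h1.symm).resolve_left (by exact_mod_cast hκ)
  have hNo : IsOpen (ι ⁻¹' (N : Set Config)) := N.isOpen.preimage hι.continuous
  refine hNo.ae_eq_zero_of_integral_contDiff_smul_eq_zero hl fun k hk hkc hks => ?_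
  have hK : IsCompact (ι '' tsupport k) := hkc.isCompact.image hι.continuous
  obtain ⟨K', hK', hKK', hK'N⟩ := exists_compact_between hK N.isOpen (image_subset_iff.2 hks)
  -- `k ∘ ρ` extends `k` from the face to the whole space, but its support need not be compact or
  -- lie in `N`. The cutoff `χ` repairs this without changing the values on the support of `k`.
  obtain ⟨χ, hχ1, hχ0, -⟩ := exists_contMDiffMap_one_nhds_of_subset_interior (n := (⊤ : ℕ∞))
    (modelWithCornersSelf ℝ Config) hK.isClosed hKK'
  have hχ1' := hχ1.self_of_nhdsSet
  have hsupp : tsupport (fun x => χ x * k (ρ x)) ⊆ K' := by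
    refine closure_minimal (fun x hx => ?_) hK'.isClosed
    by_contra hxK
    exact hx (by simp [hχ0 x hxK])
  have h1 := hw1 (complexTest (fun x => χ x * k (ρ x))
    (χ.contMDiff.contDiff.mul (hk.comp hρ)) (hK'.of_isClosed_subset (isClosed_tsupport _) hsupp)
    (hsupp.trans hK'N))
  rw [← integral_indicator hNo.measurableSet] at h1
  rw [← h1]
  refine integral_congr_ae (Eventually.of_forall fun p => ?_)
  by_cases hp : p ∈ tsupport k
  · have e : (complexTest (N := N) (fun x => χ x * k (ρ x)) (χ.contMDiff.contDiff.mul (hk.comp hρ))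
        (hK'.of_isClosed_subset (isClosed_tsupport _) hsupp) (hsupp.trans hK'N) : Config → ℂ) (ι p) =
        (k p : ℂ) := by
      change ((χ (ι p) * k (ρ (ι p)) : ℝ) : ℂ) = _
      rw [hρι, hχ1' _ (mem_image_of_mem _ hp), one_mul]
    simp only [indicator_of_mem (hks hp), e]
    rw [Complex.real_smul, mul_comm]
  · have hk0 := image_eq_zero_of_notMem_tsupport hp
    by_cases hpN : p ∈ ι ⁻¹' (N : Set Config)
    · simp only [indicator_of_mem hpN, hk0]
      change (0 : ℝ) • g p = g p * ((χ (ι p) * k (ρ (ι p)) : ℝ) : ℂ)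
      rw [hρι, hk0]; simp
    · simp only [indicator_of_notMem hpN, hk0, zero_smul]

/-- The trace is unique. -/
theorem HasTrace.ae_unique (hN : S₁ ≤ N) (hι : IsClosedEmbedding ι)
    (hS : ∀ p, ι p ∉ (S₁ : Set Config)) {ρ : Config → ℝ × ℝ} (hρ : ContDiff ℝ ∞ ρ)
    (hρι : ∀ p, ρ (ι p) = p) (hκ : κ ≠ 0) {u : Config → ℂ} {g g' : ℝ × ℝ → ℂ}
    (hu : MemLp u 2 (volume.restrict (S₁ : Set Config)))
    (h : HasTrace N ι κ d u g) (h' : HasTrace N ι κ d u g') :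
    ∀ᵐ p, p ∈ ι ⁻¹' (N : Set Config) → g p = g' p := by
  have h1 := (h.add hι hu (hu.const_mul (-1)) (h'.const_mul (-1))).congr (u' := fun _ => 0)
    (Eventually.of_forall fun x => by ring)
  filter_upwards [ae_eq_zero_of_hasTrace_zero hN hι hS hρ hρι hκ h1] with p hp hpN
  linear_combination hp hpN

end Trace

/-! ### Characteristic coordinates that start from a face -/

/-- Characteristic coordinates for which `τ = 0` on the face of `S₁` parametrized by `ι`, and for
which the characteristics do not leave `S₁` elsewhere in `N`. -/
structure FaceChart (N : Opens Config) (ι : ℝ × ℝ → Config) extends CharChart where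
  face : (ℝ × ℝ) ≃L[ℝ] (ℝ × ℝ)
  volume_face : (volume : Measure (ℝ × ℝ)) = (2 : ENNReal) • Measure.map face volume
  equiv_zero : ∀ y, equiv (0, y) = ι (face y)
  mem_base_iff : ∀ y, y ∈ base ↔ ι (face y) ∈ N
  slice_eq : ∀ y ∈ base, slice y = Ioi 0 ∨ ∃ ℓ, 0 < ℓ ∧ slice y = Ioo 0 ℓ ∧ equiv (ℓ, y) ∉ N

namespace FaceChart

variable {N : Opens Config} {ι : ℝ × ℝ → Config} (ch : FaceChart N ι)

theorem preimage_face : ch.face ⁻¹' (ι ⁻¹' (N : Set Config)) = ch.base := by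
  ext y
  exact (ch.mem_base_iff y).symm

theorem setIntegral_face (G : ℝ × ℝ → ℂ) :
    ∫ p in ι ⁻¹' (N : Set Config), G p = 2 * ∫ y in ch.base, G (ch.face y) := by
  have h2 : (2 : ENNReal).toReal = 2 := by norm_num
  have h1 := ch.face.toHomeomorph.measurableEmbedding.setIntegral_map (μ := volume) G
    (ι ⁻¹' (N : Set Config))
  change ∫ p in ι ⁻¹' (N : Set Config), G p ∂(Measure.map ch.face volume) =
    ∫ y in ch.face ⁻¹' (ι ⁻¹' (N : Set Config)), G (ch.face y) at h1
  rw [ch.preimage_face] at h1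
  conv_lhs => rw [ch.volume_face, Measure.restrict_smul, integral_smul_measure, h1, h2,
    Complex.real_smul]
  norm_cast

/-- The integrand is the derivative of `e^{c τ} φ` along the characteristic. Only the end `τ = 0`
contributes: on a half-line `φ` has compact support, and the far end of a segment lies outside `N`,
where `φ` vanishes. -/
theorem integral_slice (c : ℝ) (φ : TestFunction N ℂ ⊤) {y : ℝ × ℝ} (hy : y ∈ ch.base) :
    ∫ τ in ch.slice y, ((Real.exp (c * τ) : ℂ) * fderiv ℝ φ (ch.equiv (τ, y)) ch.direction +
      c * (Real.exp (c * τ) : ℂ) * φ (ch.equiv (τ, y))) = -φ (ι (ch.face y)) := by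
  let F : ℝ → ℂ := fun τ => (Real.exp (c * τ) : ℂ) * φ (ch.equiv (τ, y))
  have hline : ∀ τ, HasDerivAt (fun τ => ch.equiv (τ, y)) ch.direction τ := by
    intro τ
    have h1 : ∀ τ : ℝ, ch.equiv (τ, y) = ch.equiv (0, y) + τ • ch.direction := fun τ => by
      simpa using ch.equiv_add 0 τ y
    rw [show (fun τ => ch.equiv (τ, y)) = fun τ => ch.equiv (0, y) + τ • ch.direction from funext h1]
    simpa using ((hasDerivAt_id τ).smul_const ch.direction).const_add (ch.equiv (0, y))
  have hF : ∀ τ, HasDerivAt F ((Real.exp (c * τ) : ℂ) *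
      fderiv ℝ φ (ch.equiv (τ, y)) ch.direction +
      c * (Real.exp (c * τ) : ℂ) * φ (ch.equiv (τ, y))) τ := by
    intro τ
    have h1 : HasDerivAt (fun τ => φ (ch.equiv (τ, y)))
        (fderiv ℝ φ (ch.equiv (τ, y)) ch.direction) τ :=
      (φ.contDiff.differentiable (by simp) _).hasFDerivAt.comp_hasDerivAt τ (hline τ)
    have h2 : HasDerivAt (fun τ : ℝ => (Real.exp (c * τ) : ℂ)) ((Real.exp (c * τ) * c : ℝ) : ℂ) τ := by
      have := ((hasDerivAt_id τ).const_mul c).exp.ofReal_comp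
      simpa using this
    refine (h2.mul h1).congr_deriv ?_
    push_cast; ring
  have hd : deriv F = fun τ => (Real.exp (c * τ) : ℂ) * fderiv ℝ φ (ch.equiv (τ, y)) ch.direction +
      c * (Real.exp (c * τ) : ℂ) * φ (ch.equiv (τ, y)) := funext fun τ => (hF τ).deriv
  have hemb : IsClosedEmbedding fun τ : ℝ => ch.equiv (τ, y) :=
    Function.LeftInverse.isClosedEmbedding (f := fun x => (ch.equiv.symm x).1)
      (fun τ => by simp) (by fun_prop) (by fun_prop)
  have hFc : HasCompactSupport F :=
    (φ.hasCompactSupport.comp_isClosedEmbedding hemb).mul_left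
  have hlin : ContDiff ℝ 1 fun τ : ℝ => ch.equiv (τ, y) :=
    ch.equiv.contDiff.comp (contDiff_id.prodMk contDiff_const)
  have hF1 : ContDiff ℝ 1 F :=
    (Complex.ofRealCLM.contDiff.comp (Real.contDiff_exp.comp (contDiff_const.mul contDiff_id))).mul
      ((φ.contDiff.of_le (by simp)).comp hlin)
  have hF0 : F 0 = φ (ι (ch.face y)) := by simp [F, ch.equiv_zero]
  rw [← hF0]
  rcases ch.slice_eq y hy with hs | ⟨ℓ, hℓ, hs, hN⟩
  · rw [hs, ← hFc.integral_Ioi_deriv_eq hF1, hd]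
  · have hℓ0 : F ℓ = 0 := by
      simp only [F]
      rw [image_eq_zero_of_notMem_tsupport fun h => hN (φ.tsupport_subset h), mul_zero]
    have h1 := intervalIntegral.integral_eq_sub_of_hasDerivAt (a := 0) (b := ℓ) (fun τ _ => hF τ)
      (by rw [← hd]; exact (hF1.continuous_deriv le_rfl).intervalIntegrable _ _)
    rw [hs, ← integral_Ioc_eq_integral_Ioo, ← intervalIntegral.integral_of_le hℓ.le, h1, hℓ0, zero_sub]

/-- Green's formula for `e^{c τ} f(y)`. -/
theorem integral_form {c : ℝ} {f : ℝ × ℝ → ℂ} {u : Config → ℂ}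
    (huf : u =ᵐ[volume.restrict (S₁ : Set Config)] ch.form c f)
    (hu : MemLp u 2 (volume.restrict (S₁ : Set Config))) (φ : TestFunction N ℂ ⊤) :
    ∫ x in (S₁ : Set Config), (u x * fderiv ℝ φ x ch.direction + c * u x * φ x) =
      -2 * ∫ p in ι ⁻¹' (N : Set Config), f (ch.face.symm p) * φ (ι p) := by
  have hi := integrable_interior (d := ch.direction) hu (hu.const_mul (c : ℂ)) φ
  have hcongr : (fun x => u x * fderiv ℝ φ x ch.direction + c * u x * φ x)
      =ᵐ[volume.restrict (S₁ : Set Config)]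
      fun x => ch.form c f x * fderiv ℝ φ x ch.direction + c * ch.form c f x * φ x := by
    filter_upwards [huf] with x hx
    rw [hx]
  -- The Jacobian `4` of the chart against the Jacobian `2` of the face, and the sign from the lower
  -- end of each slice, make up the factor `-2`.
  rw [integral_congr_ae hcongr, ch.integral_S₁ (hi.congr hcongr), ch.setIntegral_face]
  simp only [ContinuousLinearEquiv.symm_apply_apply]
  have h1 : ∀ y ∈ ch.base, ∫ τ in ch.slice y, (ch.form c f (ch.equiv (τ, y)) *
      fderiv ℝ φ (ch.equiv (τ, y)) ch.direction +
      c * ch.form c f (ch.equiv (τ, y)) * φ (ch.equiv (τ, y))) = -(f y * φ (ι (ch.face y))) := by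
    intro y hy
    rw [← mul_neg, ← ch.integral_slice c φ hy, ← integral_const_mul]
    refine integral_congr_ae (Eventually.of_forall fun τ => ?_)
    simp only [ch.form_equiv]
    ring
  rw [setIntegral_congr_fun ch.isOpen_base.measurableSet h1, integral_neg]
  ring

/-- Near an interior point of the characteristic, `f` is integrable as a function of three variables
that ignores `τ`. By Fubini it is integrable in `y` for almost every fixed `τ`, hence near every
label in the base and, through `face`, locally on the face. -/
theorem locallyIntegrableOn_face {c : ℝ} {f : ℝ × ℝ → ℂ} {u : Config → ℂ}
    (huf : u =ᵐ[volume.restrict (S₁ : Set Config)] ch.form c f)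
    (hu : MemLp u 2 (volume.restrict (S₁ : Set Config))) :
    LocallyIntegrableOn (fun p => f (ch.face.symm p)) (ι ⁻¹' (N : Set Config)) := by
  intro p hp
  set y := ch.face.symm p
  have hy : y ∈ ch.base := by
    rw [ch.mem_base_iff]
    simpa [y] using hp
  have hx : ch.equiv (ch.mid y, y) ∈ (S₁ : Set Config) := (ch.mem_iff _ _).2 ⟨hy, ch.mid_mem y hy⟩
  obtain ⟨K, hK, hxK, hKS⟩ := exists_compact_subset S₁.isOpen hx
  have hint : IntegrableOn (fun x => f (ch.equiv.symm x).2) K := by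
    have h1 : IntegrableOn (ch.form c f) K := by
      have h2 : IntegrableOn u K (volume.restrict (S₁ : Set Config)) :=
        (hu.locallyIntegrable (by norm_num)).integrableOn_isCompact hK
      rw [IntegrableOn, Measure.restrict_restrict_of_subset hKS] at h2
      exact h2.congr (ae_restrict_of_ae_restrict_of_subset hKS huf)
    have hc : Continuous fun x => (Real.exp (-c * (ch.equiv.symm x).1) : ℂ) := by fun_prop
    refine (h1.continuousOn_mul hc.continuousOn hK).congr_fun (fun x _ => ?_) hK.measurableSet
    simp only [CharChart.form]
    rw [← mul_assoc, ← Complex.ofReal_mul, ← Real.exp_add]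
    simp
  have hpre : ch.equiv ⁻¹' K ∈ 𝓝 (ch.mid y, y) :=
    ch.equiv.continuous.continuousAt.preimage_mem_nhds (mem_interior_iff_mem_nhds.1 hxK)
  obtain ⟨U, hU, V, hV, hUV⟩ := mem_nhds_prod_iff.1 hpre
  obtain ⟨V', hV'V, hV'o, hyV'⟩ := mem_nhds_iff.1 hV
  obtain ⟨U', hU'U, hU'o, hyU'⟩ := mem_nhds_iff.1 hU
  have hint2 : IntegrableOn (fun z : ℝ × ℝ × ℝ => f z.2) (U' ×ˢ V') := by
    have h1 : IntegrableOn (fun z : ℝ × ℝ × ℝ => f z.2) (ch.equiv ⁻¹' K) := by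
      rw [ch.volume_eq, IntegrableOn, Measure.restrict_smul,
        integrable_smul_measure (by norm_num) (by norm_num)] at hint
      have := (ch.equiv.toHomeomorph.measurableEmbedding.integrableOn_map_iff (μ := volume)).1 hint
      simpa [Function.comp_def, IntegrableOn] using this
    exact h1.mono_set ((prod_mono hU'U hV'V).trans hUV)
  rw [IntegrableOn, Measure.volume_eq_prod, ← Measure.prod_restrict] at hint2
  have hpos : volume.restrict U' ≠ 0 := by
    rw [Ne, Measure.restrict_eq_zero]
    exact (hU'o.measure_pos volume ⟨_, hyU'⟩).ne'
  have : (ae (volume.restrict U')).NeBot := ae_neBot.2 hpos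
  obtain ⟨τ, hτ⟩ := hint2.prod_right_ae.exists
  have hτ' : IntegrableOn f V' := hτ
  refine ⟨ch.face '' V', mem_nhdsWithin_of_mem_nhds ?_, ?_⟩
  · have : ch.face.symm ⁻¹' V' ∈ 𝓝 p :=
      ch.face.symm.continuous.continuousAt.preimage_mem_nhds (hV'o.mem_nhds hyV')
    rwa [← ch.face.image_eq_preimage_symm] at this
  · rw [ch.volume_face, IntegrableOn, Measure.restrict_smul,
      integrable_smul_measure (by norm_num) (by norm_num)]
    refine (ch.face.toHomeomorph.measurableEmbedding.integrableOn_map_iff (μ := volume)).2 ?_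
    have e : ch.face.toHomeomorph ⁻¹' (ch.face '' V') = V' := ch.face.injective.preimage_image V'
    rw [e]
    simpa [Function.comp_def] using hτ'

/-- The trace of `e^{c τ} f(y)` is given by `f`. -/
theorem hasTrace_form {c : ℝ} {f : ℝ × ℝ → ℂ} {u : Config → ℂ}
    (huf : u =ᵐ[volume.restrict (S₁ : Set Config)] ch.form c f)
    (hu : MemLp u 2 (volume.restrict (S₁ : Set Config))) {κ σ : ℝ} {d : Config}
    (hd : d = σ • ch.direction) (hκ : κ = -2 * σ) :
    HasTrace N ι κ d u (fun p => f (ch.face.symm p)) := by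
  refine ⟨ch.locallyIntegrableOn_face huf hu, fun x => (σ * c : ℂ) * u x,
    hu.const_mul _, fun φ => ?_⟩
  have h1 := ch.integral_form huf hu φ
  have h2 : ∀ x, u x * fderiv ℝ φ x d + σ * c * u x * φ x =
      σ * (u x * fderiv ℝ φ x ch.direction + c * u x * φ x) := by
    intro x
    rw [hd, map_smul, Complex.real_smul]
    ring
  simp_rw [h2]
  rw [integral_const_mul, h1, hκ]
  push_cast; ring

/-- Functions `e^{c τ} f(y)` are weak solutions of `D u = c u`. -/
theorem weak_form (hN : S₁ ≤ N) (hS : ∀ p, ι p ∉ (S₁ : Set Config))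
    {c : ℝ} {f : ℝ × ℝ → ℂ} {u : Config → ℂ}
    (huf : u =ᵐ[volume.restrict (S₁ : Set Config)] ch.form c f)
    (hu : MemLp u 2 (volume.restrict (S₁ : Set Config))) (φ : TestFunction S₁ ℂ ⊤) :
    ∫ x in (S₁ : Set Config), (u x * fderiv ℝ φ x ch.direction + c * u x * φ x) = 0 := by
  have h := ch.integral_form huf hu
    ⟨φ, φ.contDiff, φ.hasCompactSupport, φ.tsupport_subset.trans hN⟩
  refine h.trans ?_
  have : ∀ p, φ (ι p) = 0 := fun p =>
    image_eq_zero_of_notMem_tsupport fun h => hS p (φ.tsupport_subset h)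
  simp [this]

end FaceChart

/-! ### The characteristic coordinates of the eight components -/

/-- The standard basis of `ℝ × ℝ × ℝ`. -/
def configBasis : Module.Basis (Fin 3) ℝ Config :=
  Module.Basis.ofEquivFun
    { toFun := fun x => ![x.1, x.2.1, x.2.2]
      invFun := fun v => (v 0, v 1, v 2)
      map_add' := fun x y => by ext i; fin_cases i <;> rfl
      map_smul' := fun c x => by ext i; fin_cases i <;> rfl
      left_inv := fun x => rfl
      right_inv := fun v => by ext i; fin_cases i <;> rfl }

theorem configBasis_apply (j : Fin 3) :
    configBasis j = ((Pi.single j 1 : Fin 3 → ℝ) 0, (Pi.single j 1 : Fin 3 → ℝ) 1,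
      (Pi.single j 1 : Fin 3 → ℝ) 2) := by
  rw [configBasis, Module.Basis.coe_ofEquivFun]
  rfl

theorem configBasis_repr (x : Config) (i : Fin 3) :
    configBasis.repr x i = ![x.1, x.2.1, x.2.2] i := rfl

theorem det_config (e : Config →ₗ[ℝ] Config) : LinearMap.det e =
    Matrix.det !![(e (1, 0, 0)).1, (e (0, 1, 0)).1, (e (0, 0, 1)).1;
      (e (1, 0, 0)).2.1, (e (0, 1, 0)).2.1, (e (0, 0, 1)).2.1;
      (e (1, 0, 0)).2.2, (e (0, 1, 0)).2.2, (e (0, 0, 1)).2.2] := by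
  rw [← LinearMap.det_toMatrix configBasis]
  congr 1
  ext i j
  rw [LinearMap.toMatrix_apply, configBasis_repr, configBasis_apply]
  fin_cases i <;> fin_cases j <;> simp

theorem det_plane (e : ℝ × ℝ →ₗ[ℝ] ℝ × ℝ) : LinearMap.det e =
    (e (1, 0)).1 * (e (0, 1)).2 - (e (0, 1)).1 * (e (1, 0)).2 := by
  rw [← LinearMap.det_toMatrix (Module.Basis.finTwoProd ℝ), Matrix.det_fin_two]
  simp [LinearMap.toMatrix_apply]

theorem volume_eq_smul_map_of_det {E : Type*} [NormedAddCommGroup E] [NormedSpace ℝ E]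
    [FiniteDimensional ℝ E] [MeasureSpace E] [BorelSpace E] [(volume : Measure E).IsAddHaarMeasure]
    (e : E ≃L[ℝ] E) {c : NNReal} (hc : c ≠ 0)
    (h : |LinearMap.det ((e : E ≃ₗ[ℝ] E) : E →ₗ[ℝ] E)| = c) :
    (volume : Measure E) = (c : ENNReal) • Measure.map e volume := by
  have h0 : LinearMap.det ((e : E ≃ₗ[ℝ] E) : E →ₗ[ℝ] E) ≠ 0 := by
    intro h0
    rw [h0, abs_zero] at h
    exact hc (by exact_mod_cast h.symm)
  have h1 := Measure.map_linearMap_addHaar_eq_smul_addHaar (volume : Measure E) h0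
  change Measure.map e volume = _ at h1
  rw [h1, smul_smul, abs_inv, h, ← NNReal.coe_inv, ENNReal.ofReal_coe_nnreal, ← ENNReal.coe_mul,
    mul_inv_cancel₀ hc, ENNReal.coe_one, one_smul]

/-- Opposite directions share their lines, so the eight components need only four families of lines:
`equivA` and `equivB` for the half-lines from `C₁` and `C₂`, `equivF` for the whole lines, and the
segments. The segments meet both faces and get two charts, `equivM` and `equivM'`, one from each
end. -/
def equivA : (ℝ × ℝ × ℝ) ≃L[ℝ] Config :=
  LinearEquiv.toContinuousLinearEquiv
    { toFun := fun z => (z.2.1 + z.1, z.2.1 - z.1, z.2.1 + z.1 + 2 * z.2.2)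
      invFun := fun x => (relS x, x.1 - relS x, relT x)
      map_add' := fun x y => by ext <;> simp <;> ring
      map_smul' := fun c x => by ext <;> simp <;> ring
      left_inv := fun z => by ext <;> simp [relS, relT]
      right_inv := fun x => by ext <;> simp [relS, relT] <;> ring }

def equivB : (ℝ × ℝ × ℝ) ≃L[ℝ] Config :=
  LinearEquiv.toContinuousLinearEquiv
    { toFun := fun z => (z.2.1 - z.1, z.2.1 - z.1 - 2 * z.2.2, z.2.1 + z.1)
      invFun := fun x => (relT x, x.1 + relT x, relS x)
      map_add' := fun x y => by ext <;> simp <;> ring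
      map_smul' := fun c x => by ext <;> simp <;> ring
      left_inv := fun z => by ext <;> simp [relS, relT]
      right_inv := fun x => by ext <;> simp [relS, relT] <;> ring }

def equivM : (ℝ × ℝ × ℝ) ≃L[ℝ] Config :=
  LinearEquiv.toContinuousLinearEquiv
    { toFun := fun z => (z.2.1 + z.1, z.2.1 - z.1, z.2.1 - z.1 + 2 * z.2.2)
      invFun := fun x => (relS x, x.1 - relS x, relS x + relT x)
      map_add' := fun x y => by ext <;> simp <;> ring
      map_smul' := fun c x => by ext <;> simp <;> ring
      left_inv := fun z => by ext <;> simp [relS, relT] <;> ring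
      right_inv := fun x => by ext <;> simp [relS, relT] <;> ring }

def equivM' : (ℝ × ℝ × ℝ) ≃L[ℝ] Config :=
  LinearEquiv.toContinuousLinearEquiv
    { toFun := fun z => (z.2.1 - z.1, z.2.1 + z.1 - 2 * z.2.2, z.2.1 + z.1)
      invFun := fun x => (relT x, x.1 + relT x, relS x + relT x)
      map_add' := fun x y => by ext <;> simp <;> ring
      map_smul' := fun c x => by ext <;> simp <;> ring
      left_inv := fun z => by ext <;> simp [relS, relT] <;> ring
      right_inv := fun x => by ext <;> simp [relS, relT] <;> ring }

def equivF : (ℝ × ℝ × ℝ) ≃L[ℝ] Config :=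
  LinearEquiv.toContinuousLinearEquiv
    { toFun := fun z => (z.1, z.1 - 2 * z.2.1, z.1 + 2 * z.2.2)
      invFun := fun x => (x.1, relS x, relT x)
      map_add' := fun x y => by ext <;> simp <;> ring
      map_smul' := fun c x => by ext <;> simp <;> ring
      left_inv := fun z => by ext <;> simp [relS, relT]
      right_inv := fun x => by ext <;> simp [relS, relT] <;> ring }

def face₁ : (ℝ × ℝ) ≃L[ℝ] (ℝ × ℝ) :=
  LinearEquiv.toContinuousLinearEquiv
    { toFun := fun y => (y.1, y.1 + 2 * y.2)
      invFun := fun p => (p.1, (p.2 - p.1) / 2)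
      map_add' := fun x y => by ext <;> simp <;> ring
      map_smul' := fun c x => by ext <;> simp <;> ring
      left_inv := fun z => by ext <;> simp
      right_inv := fun x => by ext <;> simp <;> ring }

def face₂ : (ℝ × ℝ) ≃L[ℝ] (ℝ × ℝ) :=
  LinearEquiv.toContinuousLinearEquiv
    { toFun := fun y => (y.1, y.1 - 2 * y.2)
      invFun := fun p => (p.1, (p.1 - p.2) / 2)
      map_add' := fun x y => by ext <;> simp <;> ring
      map_smul' := fun c x => by ext <;> simp <;> ring
      left_inv := fun z => by ext <;> simp
      right_inv := fun x => by ext <;> simp <;> ring }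

theorem equivA_apply (z : ℝ × ℝ × ℝ) :
    equivA z = (z.2.1 + z.1, z.2.1 - z.1, z.2.1 + z.1 + 2 * z.2.2) := rfl
theorem equivB_apply (z : ℝ × ℝ × ℝ) :
    equivB z = (z.2.1 - z.1, z.2.1 - z.1 - 2 * z.2.2, z.2.1 + z.1) := rfl
theorem equivM_apply (z : ℝ × ℝ × ℝ) :
    equivM z = (z.2.1 + z.1, z.2.1 - z.1, z.2.1 - z.1 + 2 * z.2.2) := rfl
theorem equivM'_apply (z : ℝ × ℝ × ℝ) :
    equivM' z = (z.2.1 - z.1, z.2.1 + z.1 - 2 * z.2.2, z.2.1 + z.1) := rfl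
theorem equivF_apply (z : ℝ × ℝ × ℝ) :
    equivF z = (z.1, z.1 - 2 * z.2.1, z.1 + 2 * z.2.2) := rfl
theorem face₁_apply (y : ℝ × ℝ) : face₁ y = (y.1, y.1 + 2 * y.2) := rfl
theorem face₂_apply (y : ℝ × ℝ) : face₂ y = (y.1, y.1 - 2 * y.2) := rfl

theorem volume_equivA : (volume : Measure Config) = (4 : ENNReal) • Measure.map equivA volume :=
  volume_eq_smul_map_of_det equivA (c := 4) (by norm_num) (by
    rw [det_config]
    simp [equivA_apply, Matrix.det_fin_three]
    norm_num)
theorem volume_equivB : (volume : Measure Config) = (4 : ENNReal) • Measure.map equivB volume :=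
  volume_eq_smul_map_of_det equivB (c := 4) (by norm_num) (by
    rw [det_config]
    simp [equivB_apply, Matrix.det_fin_three]
    norm_num)
theorem volume_equivM : (volume : Measure Config) = (4 : ENNReal) • Measure.map equivM volume :=
  volume_eq_smul_map_of_det equivM (c := 4) (by norm_num) (by
    rw [det_config]
    simp [equivM_apply, Matrix.det_fin_three]
    norm_num)
theorem volume_equivM' : (volume : Measure Config) = (4 : ENNReal) • Measure.map equivM' volume :=
  volume_eq_smul_map_of_det equivM' (c := 4) (by norm_num) (by
    rw [det_config]
    simp [equivM'_apply, Matrix.det_fin_three]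
    norm_num)
theorem volume_equivF : (volume : Measure Config) = (4 : ENNReal) • Measure.map equivF volume :=
  volume_eq_smul_map_of_det equivF (c := 4) (by norm_num) (by
    rw [det_config]
    simp [equivF_apply, Matrix.det_fin_three]
    norm_num)
theorem volume_face₁ : (volume : Measure (ℝ × ℝ)) = (2 : ENNReal) • Measure.map face₁ volume :=
  volume_eq_smul_map_of_det face₁ (c := 2) (by norm_num) (by
    rw [det_plane]
    simp [face₁_apply])
theorem volume_face₂ : (volume : Measure (ℝ × ℝ)) = (2 : ENNReal) • Measure.map face₂ volume :=
  volume_eq_smul_map_of_det face₂ (c := 2) (by norm_num) (by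
    rw [det_plane]
    simp [face₂_apply])

theorem mem_S₁ {x : Config} : x ∈ (S₁ : Set Config) ↔ x.2.1 < x.1 ∧ x.1 < x.2.2 := Iff.rfl

/-- The labels `(q, r)` with `r > 0`. -/
def halfPlane : Set (ℝ × ℝ) := {y | 0 < y.2}

theorem isOpen_halfPlane : IsOpen halfPlane := isOpen_lt continuous_const continuous_snd

/-- The half-lines that start from `C₁`, labelled by `(s_p - s, s̃)`. -/
def chartA : FaceChart near₁ plane₁ where
  equiv := equivA
  base := halfPlane
  slice := fun _ => Ioi 0
  mid := fun _ => 1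
  volume_eq := volume_equivA
  mem_iff := fun τ y => by
    simp only [mem_S₁, equivA_apply, halfPlane, mem_ofPred_eq, mem_Ioi]
    constructor <;> rintro ⟨h1, h2⟩ <;> constructor <;> linarith
  isOpen_base := isOpen_halfPlane
  measurable_mid := measurable_const
  mid_mem := fun _ _ => mem_Ioi.2 one_pos
  face := face₁
  volume_face := volume_face₁
  equiv_zero := fun y => by simp [equivA_apply, face₁_apply, plane₁]
  mem_base_iff := fun y => by
    change 0 < y.2 ↔ y.1 < y.1 + 2 * y.2
    constructor <;> intro h <;> linarith
  slice_eq := fun _ _ => Or.inl rfl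

/-- The half-lines that start from `C₂`, labelled by `(s_p + s̃, s)`. -/
def chartB : FaceChart near₂ plane₂ where
  equiv := equivB
  base := halfPlane
  slice := fun _ => Ioi 0
  mid := fun _ => 1
  volume_eq := volume_equivB
  mem_iff := fun τ y => by
    simp only [mem_S₁, equivB_apply, halfPlane, mem_ofPred_eq, mem_Ioi]
    constructor <;> rintro ⟨h1, h2⟩ <;> constructor <;> linarith
  isOpen_base := isOpen_halfPlane
  measurable_mid := measurable_const
  mid_mem := fun _ _ => mem_Ioi.2 one_pos
  face := face₂
  volume_face := volume_face₂
  equiv_zero := fun y => by simp [equivB_apply, face₂_apply, plane₂]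
  mem_base_iff := fun y => by
    change 0 < y.2 ↔ y.1 - 2 * y.2 < y.1
    constructor <;> intro h <;> linarith
  slice_eq := fun _ _ => Or.inl rfl

/-- The segments from `C₁` to `C₂`, labelled by `(s_p - s, s + s̃)`. -/
def chartM : FaceChart near₁ plane₁ where
  equiv := equivM
  base := halfPlane
  slice := fun y => Ioo 0 y.2
  mid := fun y => y.2 / 2
  volume_eq := volume_equivM
  mem_iff := fun τ y => by
    simp only [mem_S₁, equivM_apply, halfPlane, mem_ofPred_eq, mem_Ioo]
    constructor
    · rintro ⟨h1, h2⟩; exact ⟨by linarith, by linarith, by linarith⟩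
    · rintro ⟨h1, h2, h3⟩; exact ⟨by linarith, by linarith⟩
  isOpen_base := isOpen_halfPlane
  measurable_mid := by fun_prop
  mid_mem := fun y hy => ⟨half_pos hy, half_lt_self hy⟩
  face := face₁
  volume_face := volume_face₁
  equiv_zero := fun y => by simp [equivM_apply, face₁_apply, plane₁]
  mem_base_iff := fun y => by
    change 0 < y.2 ↔ y.1 < y.1 + 2 * y.2
    constructor <;> intro h <;> linarith
  slice_eq := fun y hy => Or.inr ⟨y.2, hy, rfl, fun h => by
    change y.1 + y.2 < y.1 - y.2 + 2 * y.2 at h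
    linarith⟩

/-- The segments from `C₂` to `C₁`, labelled by `(s_p + s̃, s + s̃)`. -/
def chartM' : FaceChart near₂ plane₂ where
  equiv := equivM'
  base := halfPlane
  slice := fun y => Ioo 0 y.2
  mid := fun y => y.2 / 2
  volume_eq := volume_equivM'
  mem_iff := fun τ y => by
    simp only [mem_S₁, equivM'_apply, halfPlane, mem_ofPred_eq, mem_Ioo]
    constructor
    · rintro ⟨h1, h2⟩; exact ⟨by linarith, by linarith, by linarith⟩
    · rintro ⟨h1, h2, h3⟩; exact ⟨by linarith, by linarith⟩
  isOpen_base := isOpen_halfPlane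
  measurable_mid := by fun_prop
  mid_mem := fun y hy => ⟨half_pos hy, half_lt_self hy⟩
  face := face₂
  volume_face := volume_face₂
  equiv_zero := fun y => by simp [equivM'_apply, face₂_apply, plane₂]
  mem_base_iff := fun y => by
    change 0 < y.2 ↔ y.1 - 2 * y.2 < y.1
    constructor <;> intro h <;> linarith
  slice_eq := fun y hy => Or.inr ⟨y.2, hy, rfl, fun h => by
    change y.1 + y.2 - 2 * y.2 < y.1 - y.2 at h
    linarith⟩

/-- The lines that do not meet the boundary, labelled by `(s, s̃)`. -/
def chartF : CharChart where
  equiv := equivF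
  base := {y | 0 < y.1 ∧ 0 < y.2}
  slice := fun _ => univ
  mid := fun _ => 0
  volume_eq := volume_equivF
  mem_iff := fun τ y => by
    simp only [mem_S₁, equivF_apply, mem_ofPred_eq, mem_univ, and_true]
    constructor <;> rintro ⟨h1, h2⟩ <;> constructor <;> linarith
  isOpen_base := (isOpen_lt continuous_const continuous_fst).inter
    (isOpen_lt continuous_const continuous_snd)
  measurable_mid := measurable_const
  mid_mem := fun _ _ => mem_univ _

theorem chartA_form (c : ℝ) (f : ℝ × ℝ → ℂ) (x : Config) :
    chartA.form c f x = (Real.exp (c * relS x) : ℂ) * f (x.1 - relS x, relT x) := rfl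
theorem chartB_form (c : ℝ) (f : ℝ × ℝ → ℂ) (x : Config) :
    chartB.form c f x = (Real.exp (c * relT x) : ℂ) * f (x.1 + relT x, relS x) := rfl
theorem chartM_form (c : ℝ) (f : ℝ × ℝ → ℂ) (x : Config) :
    chartM.form c f x = (Real.exp (c * relS x) : ℂ) * f (x.1 - relS x, relS x + relT x) := rfl
theorem chartM'_form (c : ℝ) (f : ℝ × ℝ → ℂ) (x : Config) :
    chartM'.form c f x = (Real.exp (c * relT x) : ℂ) * f (x.1 + relT x, relS x + relT x) := rfl

/-- The segments parametrized from the other end. -/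
theorem chartM_form_eq_chartM' (c : ℝ) (f : ℝ × ℝ → ℂ) :
    chartM.form c f =
      chartM'.form (-c) fun y => (Real.exp (c * y.2) : ℂ) * f (y.1 - y.2, y.2) := by
  funext x
  rw [chartM_form, chartM'_form, ← mul_assoc, ← Complex.ofReal_mul, ← Real.exp_add]
  congr 3 <;> ring_nf

theorem chartM'_form_eq_chartM (c : ℝ) (f : ℝ × ℝ → ℂ) :
    chartM'.form c f =
      chartM.form (-c) fun y => (Real.exp (c * y.2) : ℂ) * f (y.1 + y.2, y.2) := by
  funext x
  rw [chartM_form, chartM'_form, ← mul_assoc, ← Complex.ofReal_mul, ← Real.exp_add]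
  congr 3 <;> ring_nf

theorem direction_chartA : chartA.direction = dir (1, 0, 1) := by
  simp [CharChart.direction, chartA, equivA_apply, dir, sgn]
theorem direction_chartB : chartB.direction = dir (0, 0, 1) := by
  simp [CharChart.direction, chartB, equivB_apply, dir, sgn]
theorem direction_chartM : chartM.direction = dir (1, 0, 0) := by
  simp [CharChart.direction, chartM, equivM_apply, dir, sgn]
theorem direction_chartM' : chartM'.direction = dir (0, 1, 1) := by
  simp [CharChart.direction, chartM', equivM'_apply, dir, sgn]
theorem direction_chartF : chartF.direction = dir (1, 1, 1) := by
  simp [CharChart.direction, chartF, equivF_apply, dir, sgn]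

theorem S₁_le_near₁ : S₁ ≤ near₁ := fun _ h => h.2
theorem S₁_le_near₂ : S₁ ≤ near₂ := fun _ h => h.1

theorem plane₁_notMem (p : ℝ × ℝ) : plane₁ p ∉ (S₁ : Set Config) := fun h => lt_irrefl _ h.1
theorem plane₂_notMem (p : ℝ × ℝ) : plane₂ p ∉ (S₁ : Set Config) := fun h => lt_irrefl _ h.2

theorem measurableSet_face₁ : MeasurableSet (plane₁ ⁻¹' (near₁ : Set Config)) :=
  (near₁.isOpen.preimage isClosedEmbedding_plane₁.continuous).measurableSet
theorem measurableSet_face₂ : MeasurableSet (plane₂ ⁻¹' (near₂ : Set Config)) :=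
  (near₂.isOpen.preimage isClosedEmbedding_plane₂.continuous).measurableSet

theorem ae_unique_trace₁ {κ : ℝ} (hκ : κ ≠ 0) {d : Config} {u : Config → ℂ} {g g' : ℝ × ℝ → ℂ}
    (hu : MemLp u 2 (volume.restrict (S₁ : Set Config)))
    (h : HasTrace near₁ plane₁ κ d u g) (h' : HasTrace near₁ plane₁ κ d u g') :
    ∀ᵐ p, p ∈ plane₁ ⁻¹' (near₁ : Set Config) → g p = g' p :=
  h.ae_unique S₁_le_near₁ isClosedEmbedding_plane₁ plane₁_notMem (ρ := fun x => (x.1, x.2.2))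
    (by fun_prop) (fun _ => rfl) hκ hu h'

theorem ae_unique_trace₂ {κ : ℝ} (hκ : κ ≠ 0) {d : Config} {u : Config → ℂ} {g g' : ℝ × ℝ → ℂ}
    (hu : MemLp u 2 (volume.restrict (S₁ : Set Config)))
    (h : HasTrace near₂ plane₂ κ d u g) (h' : HasTrace near₂ plane₂ κ d u g') :
    ∀ᵐ p, p ∈ plane₂ ⁻¹' (near₂ : Set Config) → g p = g' p :=
  h.ae_unique S₁_le_near₂ isClosedEmbedding_plane₂ plane₂_notMem (ρ := fun x => (x.1, x.2.1))
    (by fun_prop) (fun _ => rfl) hκ hu h'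

theorem lintegral_exp_Ioi_eq_top {c : ℝ} (hc : 0 < c) :
    ∫⁻ τ in Ioi (0 : ℝ), ENNReal.ofReal (Real.exp (2 * c * τ)) = ⊤ := by
  refine top_unique ?_
  calc (⊤ : ENNReal) = ∫⁻ _ in Ioi (0 : ℝ), 1 := by simp
    _ ≤ _ := setLIntegral_mono' measurableSet_Ioi fun τ (hτ : 0 < τ) => by
      rw [← ENNReal.ofReal_one]
      exact ENNReal.ofReal_le_ofReal (Real.one_le_exp (by positivity))

/-- Whatever the sign of `c`, the exponential is at least `1` on a half-line. This excludes the
components `---` and `+++` from both deficiency spaces. -/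
theorem lintegral_exp_univ_eq_top (c : ℝ) :
    ∫⁻ τ in (univ : Set ℝ), ENNReal.ofReal (Real.exp (2 * c * τ)) = ⊤ := by
  refine top_unique ?_
  rcases le_total 0 c with hc | hc
  · calc (⊤ : ENNReal) = ∫⁻ _ in Ioi (0 : ℝ), 1 := by simp
      _ ≤ ∫⁻ τ in Ioi (0 : ℝ), ENNReal.ofReal (Real.exp (2 * c * τ)) :=
        setLIntegral_mono' measurableSet_Ioi fun τ (hτ : 0 < τ) => by
          rw [← ENNReal.ofReal_one]
          exact ENNReal.ofReal_le_ofReal (Real.one_le_exp (by positivity))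
      _ ≤ _ := lintegral_mono_set (subset_univ _)
  · calc (⊤ : ENNReal) = ∫⁻ _ in Iio (0 : ℝ), 1 := by simp
      _ ≤ ∫⁻ τ in Iio (0 : ℝ), ENNReal.ofReal (Real.exp (2 * c * τ)) :=
        setLIntegral_mono' measurableSet_Iio fun τ (hτ : τ < 0) => by
          rw [← ENNReal.ofReal_one]
          exact ENNReal.ofReal_le_ofReal (Real.one_le_exp (by nlinarith))
      _ ≤ _ := lintegral_mono_set (subset_univ _)

/-! ### The adjoint of the massless Hamiltonian -/

/-! ### Operations on test functions. -/

section TestFunctions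

variable {N : Opens Config}

/-- The component `ς` of a test spinor. -/
def compTest (ς : Spin) (Φ : TestSpinor) : TestFunction S₁ ℂ ⊤ :=
  ⟨fun x => Φ x ς,
    ((EuclideanSpace.proj (𝕜 := ℂ) ς : Spinor →L[ℂ] ℂ).restrictScalars ℝ).contDiff.comp Φ.contDiff,
    Φ.hasCompactSupport.comp_left (g := fun v : Spinor => v ς) rfl,
    (tsupport_comp_subset (g := fun v : Spinor => v ς) rfl Φ).trans Φ.tsupport_subset⟩

theorem compTest_apply (ς : Spin) (Φ : TestSpinor) (x : Config) : compTest ς Φ x = Φ x ς := rfl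

/-- The complex conjugate of a test function. -/
def conjTest (φ : TestFunction N ℂ ⊤) : TestFunction N ℂ ⊤ :=
  ⟨fun x => (starRingEnd ℂ) (φ x), Complex.conjCLE.contDiff.comp φ.contDiff,
    φ.hasCompactSupport.comp_left (map_zero _),
    (tsupport_comp_subset (map_zero (starRingEnd ℂ)) φ).trans φ.tsupport_subset⟩

theorem conjTest_apply (φ : TestFunction N ℂ ⊤) (x : Config) :
    conjTest φ x = (starRingEnd ℂ) (φ x) := rfl

theorem conjTest_conjTest (φ : TestFunction N ℂ ⊤) : conjTest (conjTest φ) = φ := by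
  ext x
  simp [conjTest_apply]

theorem testFunction_hasFDerivAt (φ : TestFunction N ℂ ⊤) (x : Config) :
    HasFDerivAt φ (fderiv ℝ φ x) x :=
  (φ.contDiff.differentiable (by simp) x).hasFDerivAt

theorem fderiv_conjTest (φ : TestFunction N ℂ ⊤) (x d : Config) :
    fderiv ℝ (conjTest φ) x d = (starRingEnd ℂ) (fderiv ℝ φ x d) := by
  have h : HasFDerivAt (conjTest φ) _ x :=
    (Complex.conjCLE : ℂ →L[ℝ] ℂ).hasFDerivAt.comp x (testFunction_hasFDerivAt φ x)
  rw [h.fderiv]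
  rfl

/-- The spinor-valued function with the single component `φ`. -/
def singleFun (ς : Spin) (φ : Config → ℂ) (x : Config) : Spinor := EuclideanSpace.single ς (φ x)

theorem contDiff_singleFun (ς : Spin) (φ : TestFunction N ℂ ⊤) : ContDiff ℝ ∞ (singleFun ς φ) := by
  rw [contDiff_piLp 2]
  intro i
  simp only [singleFun, PiLp.single_apply]
  split_ifs
  · exact φ.contDiff
  · exact contDiff_const

theorem hasCompactSupport_singleFun (ς : Spin) (φ : TestFunction N ℂ ⊤) :
    HasCompactSupport (singleFun ς φ) :=
  φ.hasCompactSupport.comp_left (g := fun z => (EuclideanSpace.single ς z : Spinor)) (by simp)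

def singleTest (ς : Spin) (φ : TestFunction S₁ ℂ ⊤) : TestSpinor :=
  ⟨singleFun ς φ, contDiff_singleFun ς φ, hasCompactSupport_singleFun ς φ,
    (tsupport_comp_subset (g := fun z => (EuclideanSpace.single ς z : Spinor)) (by simp) φ).trans
      φ.tsupport_subset⟩

theorem compTest_singleTest (ς : Spin) (φ : TestFunction S₁ ℂ ⊤) :
    compTest ς (singleTest ς φ) = φ := by
  ext x
  change (EuclideanSpace.single ς (φ x) : Spinor) ς = φ x
  simp

theorem compTest_singleTest_of_ne {ς ς' : Spin} (h : ς' ≠ ς) (φ : TestFunction S₁ ℂ ⊤) :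
    compTest ς' (singleTest ς φ) = 0 := by
  ext x
  change (EuclideanSpace.single ς (φ x) : Spinor) ς' = 0
  simp [h]

theorem memLp_singleFun (ς : Spin) (φ : TestFunction N ℂ ⊤) :
    MemLp (singleFun ς φ) 2 (volume.restrict (S₁ : Set Config)) :=
  ((contDiff_singleFun ς φ).continuous.memLp_of_hasCompactSupport
    (hasCompactSupport_singleFun ς φ)).restrict _

theorem memLp_testFunction (φ : TestFunction N ℂ ⊤) :
    MemLp φ 2 (volume.restrict (S₁ : Set Config)) :=
  (φ.continuous.memLp_of_hasCompactSupport φ.hasCompactSupport).restrict _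

/-- The directional derivative of a test function. -/
def derivTest (d : Config) (φ : TestFunction N ℂ ⊤) : TestFunction N ℂ ⊤ :=
  ⟨fun x => fderiv ℝ φ x d, (φ.contDiff.fderiv_right (m := ∞) (by simp)).clm_apply contDiff_const,
    φ.hasCompactSupport.fderiv_apply ℝ d,
    (tsupport_fderiv_apply_subset ℝ d).trans φ.tsupport_subset⟩

theorem integral_mul_fderiv_add (φ : TestFunction N ℂ ⊤) (φ' : TestFunction S₁ ℂ ⊤) (d : Config) :
    ∫ x in (S₁ : Set Config), (φ x * fderiv ℝ φ' x d + fderiv ℝ φ x d * φ' x) = 0 := by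
  have hc1 : Continuous fun x => φ x * fderiv ℝ φ' x d :=
    φ.continuous.mul (derivTest d φ').continuous
  have hc2 : Continuous fun x => fderiv ℝ φ x d * φ' x := (derivTest d φ).continuous.mul φ'.continuous
  have hi1 : Integrable fun x => φ x * fderiv ℝ φ' x d :=
    hc1.integrable_of_hasCompactSupport φ.hasCompactSupport.mul_right
  have hi2 : Integrable fun x => fderiv ℝ φ x d * φ' x :=
    hc2.integrable_of_hasCompactSupport φ'.hasCompactSupport.mul_left
  have hi3 : Integrable fun x => φ x * φ' x :=
    (φ.continuous.mul φ'.continuous).integrable_of_hasCompactSupport φ'.hasCompactSupport.mul_left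
  have h := integral_mul_fderiv_eq_neg_fderiv_mul_of_integrable hi2 hi1 hi3
    (fun x _ => (testFunction_hasFDerivAt φ x).differentiableAt)
    (fun x _ => (testFunction_hasFDerivAt φ' x).differentiableAt)
  rw [setIntegral_eq_integral_of_forall_compl_eq_zero, integral_add hi1 hi2, h, neg_add_cancel]
  intro x hx
  have hx' : x ∉ tsupport φ' := fun h => hx (φ'.tsupport_subset h)
  rw [fderiv_of_notMem_tsupport ℝ hx', image_eq_zero_of_notMem_tsupport hx']
  simp

end TestFunctions

theorem dir_eq (ς : Spin) :
    dir ς = sgn ς.1 • ((1, 0, 0) : Config) + sgn ς.2.1 • (0, 1, 0) + sgn ς.2.2 • (0, 0, 1) := by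
  ext <;> simp [dir]

theorem fderiv_compTest (ς : Spin) (Φ : TestSpinor) (x d : Config) :
    fderiv ℝ (compTest ς Φ) x d = fderiv ℝ Φ x d ς := by
  have h : HasFDerivAt (compTest ς Φ) _ x :=
    ((EuclideanSpace.proj (𝕜 := ℂ) ς : Spinor →L[ℂ] ℂ).restrictScalars ℝ).hasFDerivAt.comp x
      (testSpinor_differentiableAt Φ x).hasFDerivAt
  rw [h.fderiv]
  rfl

theorem hamExpr_eq (ħ : ℝ) (Φ : TestSpinor) (x : Config) (ς : Spin) :
    hamExpr ħ 0 Φ x ς = Complex.I * ħ * fderiv ℝ (compTest ς Φ) x (dir ς) := by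
  rw [hamExpr_massless, dir_eq, map_add, map_add, map_smul, map_smul, map_smul,
    fderiv_compTest, fderiv_compTest, fderiv_compTest]
  simp only [Complex.real_smul]

theorem inner_toLp (Ψ : WaveFn) {F : Config → Spinor}
    (hF : MemLp F 2 (volume.restrict (S₁ : Set Config))) :
    ⟪Ψ, hF.toLp F⟫_ℂ =
      ∑ ς : Spin, ∫ x in (S₁ : Set Config), (starRingEnd ℂ) (comp ς Ψ x) * F x ς := by
  rw [L2.inner_def, ← integral_finsetSum]
  · refine integral_congr_ae ?_
    filter_upwards [hF.coeFn_toLp] with x hx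
    rw [hx, PiLp.inner_apply]
    refine Finset.sum_congr rfl fun ς _ => ?_
    rw [RCLike.inner_apply']
    rfl
  · intro ς _
    have h1 : MemLp (fun x => F x ς) 2 (volume.restrict (S₁ : Set Config)) :=
      (EuclideanSpace.proj (𝕜 := ℂ) ς : Spinor →L[ℂ] ℂ).comp_memLp' hF
    exact (comp_memLp ς Ψ).star.integrable_mul h1

/-- This turns the relation that defines the adjoint into eight scalar weak equations. The inner
product is sesquilinear while weak derivatives are bilinear pairings, hence the conjugated test
functions. The factor `-i/ħ` undoes the `iħ` of the Hamiltonian. -/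
theorem inner_hamTest_sub (ħ : ℝ) (hħ : 0 < ħ) (Ψ Θ : WaveFn) (Φ : TestSpinor) :
    ⟪Ψ, hamTest ħ 0 Φ⟫_ℂ - ⟪Θ, testIncl Φ⟫_ℂ =
      ∑ ς : Spin, Complex.I * ħ * (starRingEnd ℂ) (∫ x in (S₁ : Set Config),
        (comp ς Ψ x * fderiv ℝ (conjTest (compTest ς Φ)) x (dir ς) +
          (-Complex.I / ħ * comp ς Θ x) * conjTest (compTest ς Φ) x)) := by
  have hħ' : (ħ : ℂ) ≠ 0 := by exact_mod_cast hħ.ne'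
  change ⟪Ψ, (hamExpr_memLp ħ 0 Φ).toLp _⟫_ℂ - ⟪Θ, (testSpinor_memLp Φ).toLp _⟫_ℂ = _
  rw [inner_toLp, inner_toLp, ← Finset.sum_sub_distrib]
  refine Finset.sum_congr rfl fun ς _ => ?_
  have hi1 : Integrable (fun x => (starRingEnd ℂ) (comp ς Ψ x) * hamExpr ħ 0 Φ x ς)
      (volume.restrict (S₁ : Set Config)) :=
    (comp_memLp ς Ψ).star.integrable_mul
      ((EuclideanSpace.proj (𝕜 := ℂ) ς : Spinor →L[ℂ] ℂ).comp_memLp' (hamExpr_memLp ħ 0 Φ))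
  have hi2 : Integrable (fun x => (starRingEnd ℂ) (comp ς Θ x) * Φ x ς)
      (volume.restrict (S₁ : Set Config)) :=
    (comp_memLp ς Θ).star.integrable_mul
      ((EuclideanSpace.proj (𝕜 := ℂ) ς : Spinor →L[ℂ] ℂ).comp_memLp' (testSpinor_memLp Φ))
  rw [← integral_sub hi1 hi2, ← integral_conj, ← integral_const_mul]
  refine integral_congr_ae (Eventually.of_forall fun x => ?_)
  simp only [fderiv_conjTest, conjTest_apply, hamExpr_eq, compTest_apply, map_add, map_mul,
    map_div₀, map_neg, Complex.conj_I, Complex.conj_ofReal, Complex.conj_conj]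
  field_simp
  linear_combination (-(starRingEnd ℂ (comp ς Θ x)) * Φ x ς) * Complex.I_sq

theorem dense_domain_hamiltonian (ħ m : ℝ) : Dense ((hamiltonian ħ m).domain : Set WaveFn) := by
  change Dense ((LinearMap.range testIncl : Submodule ℂ WaveFn) : Set WaveFn)
  rw [Submodule.dense_iff_topologicalClosure_eq_top, Submodule.topologicalClosure_eq_top_iff,
    Submodule.eq_bot_iff]
  intro Ψ hΨ
  have h0 : ∀ ς, ∀ᵐ x, x ∈ (S₁ : Set Config) → (starRingEnd ℂ) (comp ς Ψ x) = 0 := by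
    intro ς
    refine S₁.isOpen.ae_eq_zero_of_integral_contDiff_smul_eq_zero
      (locallyIntegrableOn_of_locallyIntegrable_restrict
        ((comp_memLp ς Ψ).star.locallyIntegrable (by norm_num))) fun k hk hkc hks => ?_
    have h1 : ⟪Ψ, testIncl (singleTest ς (complexTest k hk hkc hks))⟫_ℂ = 0 :=
      Submodule.inner_left_of_mem_orthogonal (LinearMap.mem_range_self _ _) hΨ
    change ⟪Ψ, (testSpinor_memLp _).toLp _⟫_ℂ = 0 at h1
    rw [inner_toLp, Finset.sum_eq_single ς] at h1
    · rw [← h1, ← integral_indicator measurableSet_S₁]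
      refine integral_congr_ae (Eventually.of_forall fun x => ?_)
      have e : (singleTest ς (complexTest k hk hkc hks)) x ς = (k x : ℂ) :=
        congrArg (fun φ : TestFunction S₁ ℂ ⊤ => φ x)
          (compTest_singleTest ς (complexTest k hk hkc hks))
      by_cases hx : x ∈ (S₁ : Set Config)
      · simp only [indicator_of_mem hx, e]
        rw [Complex.real_smul, mul_comm]
      · simp only [indicator_of_notMem hx]
        rw [image_eq_zero_of_notMem_tsupport fun hp => hx (hks hp), zero_smul]
    · intro ς' _ hne
      have e : ∀ x, (singleTest ς (complexTest k hk hkc hks)) x ς' = 0 := fun x =>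
        congrArg (fun φ : TestFunction S₁ ℂ ⊤ => φ x)
          (compTest_singleTest_of_ne hne (complexTest k hk hkc hks))
      simp [e]
    · simp
  rw [Lp.eq_zero_iff_ae_eq_zero]
  have h1 : ∀ᵐ x ∂(volume.restrict (S₁ : Set Config)), ∀ ς, (starRingEnd ℂ) (comp ς Ψ x) = 0 :=
    ae_all_iff.2 fun ς => (ae_restrict_iff' measurableSet_S₁).2 (h0 ς)
  filter_upwards [h1] with x hx
  ext ς
  simpa [comp] using hx ς

/-- The adjoint of the massless Hamiltonian acts by weak directional derivatives. -/
theorem mem_adjoint_hamiltonian_graph_iff {ħ : ℝ} (hħ : 0 < ħ) {Ψ Θ : WaveFn} :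
    (Ψ, Θ) ∈ (hamiltonian ħ 0)†.graph ↔ ∀ (ς : Spin) (φ : TestFunction S₁ ℂ ⊤),
      ∫ x in (S₁ : Set Config),
        (comp ς Ψ x * fderiv ℝ φ x (dir ς) + (-Complex.I / ħ * comp ς Θ x) * φ x) = 0 := by
  have hħ' : (ħ : ℂ) ≠ 0 := by exact_mod_cast hħ.ne'
  rw [mem_adjoint_graph_iff (dense_domain_hamiltonian ħ 0)]
  have h1 : (∀ v : (hamiltonian ħ 0).domain, ⟪Θ, (v : WaveFn)⟫_ℂ = ⟪Ψ, hamiltonian ħ 0 v⟫_ℂ) ↔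
      ∀ Φ : TestSpinor, ⟪Ψ, hamTest ħ 0 Φ⟫_ℂ - ⟪Θ, testIncl Φ⟫_ℂ = 0 := by
    constructor
    · intro h Φ
      have := h ⟨testIncl Φ, LinearMap.mem_range_self _ Φ⟩
      rw [hamiltonian_testIncl] at this
      rw [sub_eq_zero]
      exact this.symm
    · rintro h ⟨_, Φ, rfl⟩
      rw [hamiltonian_testIncl]
      exact (sub_eq_zero.1 (h Φ)).symm
  rw [h1]
  constructor
  · intro h ς φ
    have h2 := h (singleTest ς (conjTest φ))
    rw [inner_hamTest_sub ħ hħ, Finset.sum_eq_single ς, compTest_singleTest, conjTest_conjTest] at h2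
    · simpa [hħ'] using h2
    · intro ς' _ hne
      rw [compTest_singleTest_of_ne hne]
      have e1 : ∀ x, conjTest (0 : TestFunction S₁ ℂ ⊤) x = 0 := fun x => by
        simp [conjTest_apply]
      have e2 : ∀ x, fderiv ℝ (conjTest (0 : TestFunction S₁ ℂ ⊤)) x (dir ς') = 0 := fun x => by
        rw [fderiv_conjTest, show ((0 : TestFunction S₁ ℂ ⊤) : Config → ℂ) = fun _ => 0 from rfl]
        simp
      simp [e1, e2]
    · simp
  · intro h Φ
    rw [inner_hamTest_sub ħ hħ]
    exact Finset.sum_eq_zero fun ς _ => by rw [h, map_zero, mul_zero]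

/-- The eigenvalue equation becomes `D_ς u = c u` in every component. For `z = ∓i` the rate `c =
∓ħ⁻¹` is real, so the solutions are real exponentials along the characteristics. -/
theorem mem_deficiency_hamiltonian_iff {ħ : ℝ} (hħ : 0 < ħ) {Ψ : WaveFn} {z : ℂ} {c : ℝ}
    (hz : -Complex.I / ħ * z = c) :
    Ψ ∈ deficiency (hamiltonian ħ 0) z ↔ ∀ (ς : Spin) (φ : TestFunction S₁ ℂ ⊤),
      ∫ x in (S₁ : Set Config), (comp ς Ψ x * fderiv ℝ φ x (dir ς) + c * comp ς Ψ x * φ x) = 0 := by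
  rw [mem_deficiency_iff_graph, mem_adjoint_hamiltonian_graph_iff hħ]
  refine forall_congr' fun ς => forall_congr' fun φ => ?_
  have : ∫ x in (S₁ : Set Config), (comp ς Ψ x * fderiv ℝ φ x (dir ς) +
      (-Complex.I / ħ * comp ς (z • Ψ) x) * φ x) =
      ∫ x in (S₁ : Set Config), (comp ς Ψ x * fderiv ℝ φ x (dir ς) + c * comp ς Ψ x * φ x) := by
    refine integral_congr_ae ?_
    filter_upwards [comp_smul ς z Ψ] with x hx
    rw [← hx, ← mul_assoc, hz]
  rw [this]

theorem comp_toLp {F : Config → Spinor} (hF : MemLp F 2 (volume.restrict (S₁ : Set Config)))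
    (ς : Spin) : comp ς (hF.toLp F) =ᵐ[volume.restrict (S₁ : Set Config)] fun x => F x ς := by
  filter_upwards [hF.coeFn_toLp] with x hx
  simp only [comp, hx]

/-- Smooth compactly supported functions, restricted to `S₁`, lie in the domain of the adjoint. -/
theorem singleFun_mem_adjoint_graph {ħ : ℝ} (hħ : 0 < ħ) {N : Opens Config} (ς : Spin)
    (φ : TestFunction N ℂ ⊤) :
    ((memLp_singleFun ς φ).toLp _,
      (Complex.I * ħ) • (memLp_singleFun ς (derivTest (dir ς) φ)).toLp _) ∈
        (hamiltonian ħ 0)†.graph := by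
  have hħ' : (ħ : ℂ) ≠ 0 := by exact_mod_cast hħ.ne'
  rw [mem_adjoint_hamiltonian_graph_iff hħ]
  intro ς' φ'
  by_cases hς : ς' = ς
  · subst hς
    rw [← integral_mul_fderiv_add φ φ' (dir ς')]
    refine integral_congr_ae ?_
    filter_upwards [comp_toLp (memLp_singleFun ς' φ) ς',
      comp_toLp (memLp_singleFun ς' (derivTest (dir ς') φ)) ς', comp_smul ς' (Complex.I * ħ)
        ((memLp_singleFun ς' (derivTest (dir ς') φ)).toLp _)] with x h1 h2 h3
    rw [← h3, h1, h2]
    simp only [singleFun, PiLp.single_apply, if_true]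
    change _ = φ x * fderiv ℝ φ' x (dir ς') + derivTest (dir ς') φ x * φ' x
    field_simp
    linear_combination (-derivTest (dir ς') φ x * φ' x) * Complex.I_sq
  · rw [← integral_zero Config ℂ (μ := volume.restrict (S₁ : Set Config))]
    refine integral_congr_ae ?_
    filter_upwards [comp_toLp (memLp_singleFun ς φ) ς',
      comp_toLp (memLp_singleFun ς (derivTest (dir ς) φ)) ς', comp_smul ς' (Complex.I * ħ)
        ((memLp_singleFun ς (derivTest (dir ς) φ)).toLp _)] with x h1 h2 h3
    rw [← h3, h1, h2]
    simp [singleFun, hς]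

theorem hamiltonian_le_adjoint {ħ : ℝ} (hħ : 0 < ħ) : hamiltonian ħ 0 ≤ (hamiltonian ħ 0)† := by
  have hħ' : (ħ : ℂ) ≠ 0 := by exact_mod_cast hħ.ne'
  apply LinearPMap.le_of_le_graph
  rintro ⟨Ψ, Θ⟩ h
  obtain ⟨⟨Φ, rfl⟩, rfl⟩ := mem_graph_iff_exists.1 h
  rw [hamiltonian_testIncl, mem_adjoint_hamiltonian_graph_iff hħ]
  intro ς φ
  rw [← integral_mul_fderiv_add (compTest ς Φ) φ (dir ς)]
  refine integral_congr_ae ?_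
  filter_upwards [comp_toLp (testSpinor_memLp Φ) ς, comp_toLp (hamExpr_memLp ħ 0 Φ) ς] with x h1 h2
  change comp ς (testIncl Φ) x = _ at h1
  change comp ς (hamTest ħ 0 Φ) x = _ at h2
  rw [h1, h2, hamExpr_eq, compTest_apply]
  field_simp
  linear_combination (-fderiv ℝ (compTest ς Φ) x (dir ς) * φ x) * Complex.I_sq

/-- Elements of the domain of the closure have vanishing traces. -/
theorem hasTrace_zero_of_mem_closure_domain {ħ : ℝ} (hħ : 0 < ħ) {Ψ : WaveFn}
    (h : Ψ ∈ (hamiltonian ħ 0).closure.domain) (N : Opens Config) (ι : ℝ × ℝ → Config) (κ : ℝ)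
    (ς : Spin) : HasTrace N ι κ (dir ς) (comp ς Ψ) (fun _ => 0) := by
  have hħ' : (ħ : ℂ) ≠ 0 := by exact_mod_cast hħ.ne'
  set Θ := (hamiltonian ħ 0).closure ⟨Ψ, h⟩
  have hg : (Ψ, Θ) ∈ (hamiltonian ħ 0).closure.graph := (hamiltonian ħ 0).closure.mem_graph ⟨Ψ, h⟩
  refine ⟨locallyIntegrableOn_zero, fun x => -Complex.I / ħ * comp ς Θ x,
    (comp_memLp ς Θ).const_mul _, fun φ => ?_⟩
  -- A test function of `N` restricted to `S₁` belongs to the domain of the adjoint even if it does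
  -- not vanish on the boundary. Pairing it with an element of the closure therefore gives Green's
  -- formula without boundary term.
  have h1 := inner_closure_graph (dense_domain_hamiltonian ħ 0) (hamiltonian_le_adjoint hħ) hg
    (singleFun_mem_adjoint_graph hħ ς (conjTest φ))
  have hs : ∀ (Ξ : WaveFn) (φ : TestFunction N ℂ ⊤), ⟪Ξ, (memLp_singleFun ς φ).toLp _⟫_ℂ =
      ∫ x in (S₁ : Set Config), (starRingEnd ℂ) (comp ς Ξ x) * φ x := by
    intro Ξ φ
    rw [inner_toLp, Finset.sum_eq_single ς]
    · simp [singleFun]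
    · intro ς' _ hne
      simp [singleFun, hne]
    · simp
  rw [inner_smul_left, ← inner_conj_symm _ Ψ, ← inner_conj_symm _ Θ, hs, hs, ← integral_conj,
    ← integral_conj] at h1
  have e1 : ∀ x, (starRingEnd ℂ) ((starRingEnd ℂ) (comp ς Ψ x) * derivTest (dir ς) (conjTest φ) x) =
      comp ς Ψ x * fderiv ℝ φ x (dir ς) := fun x => by
    change (starRingEnd ℂ) (_ * fderiv ℝ (conjTest φ) x (dir ς)) = _
    rw [fderiv_conjTest]; simp
  have e2 : ∀ x, (starRingEnd ℂ) ((starRingEnd ℂ) (comp ς Θ x) * conjTest φ x) =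
      comp ς Θ x * φ x := fun x => by simp [conjTest_apply]
  simp only [e1, e2] at h1
  have hi1 : Integrable (fun x => comp ς Ψ x * fderiv ℝ φ x (dir ς))
      (volume.restrict (S₁ : Set Config)) :=
    (comp_memLp ς Ψ).integrable_mul (memLp_testFunction (derivTest (dir ς) φ))
  have hi2 : Integrable (fun x => comp ς Θ x * φ x) (volume.restrict (S₁ : Set Config)) :=
    (comp_memLp ς Θ).integrable_mul (memLp_testFunction φ)
  simp only [mul_assoc]
  rw [integral_add hi1 (hi2.const_mul _), integral_const_mul, ← h1]
  simp only [map_mul, Complex.conj_I, Complex.conj_ofReal, zero_mul, integral_zero, mul_zero]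
  field_simp
  linear_combination (∫ x in (S₁ : Set Config), comp ς Ψ x * fderiv ℝ φ x (dir ς)) * Complex.I_sq

/-! ### The deficiency spaces -/

theorem forall_spin {P : Spin → Prop} : (∀ ς, P ς) ↔
    P (0, 0, 0) ∧ P (0, 0, 1) ∧ P (0, 1, 0) ∧ P (0, 1, 1) ∧
    P (1, 0, 0) ∧ P (1, 0, 1) ∧ P (1, 1, 0) ∧ P (1, 1, 1) := by
  simp only [Prod.forall, Fin.forall_fin_two, and_assoc]

theorem sum_spin {M : Type*} [AddCommMonoid M] (F : Spin → M) : ∑ ς, F ς =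
    F (0, 0, 0) + F (0, 0, 1) + F (0, 1, 0) + F (0, 1, 1) +
    F (1, 0, 0) + F (1, 0, 1) + F (1, 1, 0) + F (1, 1, 1) := by
  simp only [Fintype.sum_prod_type, Fin.sum_univ_two, add_assoc]

theorem ae_eq_iff_comp {Ψ : WaveFn} {F : Config → Spinor} :
    Ψ =ᵐ[volume.restrict (S₁ : Set Config)] F ↔
      ∀ ς, comp ς Ψ =ᵐ[volume.restrict (S₁ : Set Config)] fun x => F x ς := by
  constructor
  · intro h ς
    filter_upwards [h] with x hx
    simp only [comp, hx]
  · intro h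
    filter_upwards [ae_all_iff.2 h] with x hx
    ext ς
    exact hx ς

/-- The general form of an element of `Ker (i - Ĥ*)`. -/
def plusForm (ħ : ℝ) (g₂ g₃ g₄ g₆ : ℝ × ℝ → ℂ) (x : Config) : Spinor :=
  WithLp.toLp 2 fun ς => match ς with
    | (0, 1, 0) => chartA.form (-ħ⁻¹) g₂ x
    | (0, 1, 1) => chartM.form (-ħ⁻¹) g₃ x
    | (1, 0, 0) => chartM'.form (-ħ⁻¹) g₄ x
    | (1, 1, 0) => chartB.form (-ħ⁻¹) g₆ x
    | _ => 0

section Components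

variable (ħ : ℝ) (f₁ f₃ f₄ f₅ : ℝ × ℝ → ℂ) (x : Config)

theorem neg_div_eq_neg_inv_mul (a : ℝ) : -a / ħ = -ħ⁻¹ * a := by
  rw [div_eq_mul_inv]; ring

theorem minusForm_001 : minusForm ħ f₁ f₃ f₄ f₅ x (0, 0, 1) = chartB.form (-ħ⁻¹) f₁ x := by
  rw [chartB_form, ← neg_div_eq_neg_inv_mul]; rfl
theorem minusForm_011 : minusForm ħ f₁ f₃ f₄ f₅ x (0, 1, 1) = chartM'.form (-ħ⁻¹) f₃ x := by
  rw [chartM'_form, ← neg_div_eq_neg_inv_mul]; rfl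
theorem minusForm_100 : minusForm ħ f₁ f₃ f₄ f₅ x (1, 0, 0) = chartM.form (-ħ⁻¹) f₄ x := by
  rw [chartM_form, ← neg_div_eq_neg_inv_mul, add_comm (relS x)]; rfl
theorem minusForm_101 : minusForm ħ f₁ f₃ f₄ f₅ x (1, 0, 1) = chartA.form (-ħ⁻¹) f₅ x := by
  rw [chartA_form, ← neg_div_eq_neg_inv_mul]; rfl

end Components

/-- One chart serves a direction and its opposite: reversing the direction, `σ = -1`, reverses the
sign of the rate. -/
theorem CharChart.exists_form_of_dir (ch : CharChart) {u : Config → ℂ}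
    (hu : MemLp u 2 (volume.restrict (S₁ : Set Config))) {c σ : ℝ} (hσ : σ * σ = 1) {d : Config}
    (hd : d = σ • ch.direction)
    (h : ∀ φ : TestFunction S₁ ℂ ⊤,
      ∫ x in (S₁ : Set Config), (u x * fderiv ℝ φ x d + c * u x * φ x) = 0) :
    ∃ f : ℝ × ℝ → ℂ, Measurable f ∧
      u =ᵐ[volume.restrict (S₁ : Set Config)] ch.form (σ * c) f := by
  refine ch.exists_form hu fun φ => ?_
  have hσ' : (σ : ℂ) * σ = 1 := by exact_mod_cast hσ
  have e : ∀ x, u x * fderiv ℝ φ x ch.direction + ((σ * c : ℝ) : ℂ) * u x * φ x =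
      σ * (u x * fderiv ℝ φ x d + c * u x * φ x) := by
    intro x
    rw [hd, map_smul, Complex.real_smul]
    push_cast
    linear_combination (-u x * fderiv ℝ φ x ch.direction) * hσ'
  simp_rw [e]
  rw [integral_const_mul, h φ, mul_zero]

theorem CharChart.ae_eq_zero_of_dir (ch : CharChart) {u : Config → ℂ}
    (hu : MemLp u 2 (volume.restrict (S₁ : Set Config))) {c σ : ℝ} (hσ : σ * σ = 1) {d : Config}
    (hd : d = σ • ch.direction)
    (h : ∀ φ : TestFunction S₁ ℂ ⊤,
      ∫ x in (S₁ : Set Config), (u x * fderiv ℝ φ x d + c * u x * φ x) = 0)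
    (hinf : ∀ y ∈ ch.base, ∫⁻ τ in ch.slice y, ENNReal.ofReal (Real.exp (2 * (σ * c) * τ)) = ⊤) :
    u =ᵐ[volume.restrict (S₁ : Set Config)] fun _ => 0 := by
  obtain ⟨f, hf, huf⟩ := ch.exists_form_of_dir hu hσ hd h
  exact huf.trans (ch.form_ae_eq_zero hf ((memLp_congr_ae huf).1 hu) hinf)

theorem FaceChart.weak_form_of_dir {N : Opens Config} {ι : ℝ × ℝ → Config} (ch : FaceChart N ι)
    (hN : S₁ ≤ N) (hS : ∀ p, ι p ∉ (S₁ : Set Config)) {u : Config → ℂ}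
    (hu : MemLp u 2 (volume.restrict (S₁ : Set Config))) {c σ : ℝ} (hσ : σ * σ = 1) {d : Config}
    (hd : d = σ • ch.direction) {f : ℝ × ℝ → ℂ}
    (huf : u =ᵐ[volume.restrict (S₁ : Set Config)] ch.form (σ * c) f) (φ : TestFunction S₁ ℂ ⊤) :
    ∫ x in (S₁ : Set Config), (u x * fderiv ℝ φ x d + c * u x * φ x) = 0 := by
  have hσ' : (σ : ℂ) * σ = 1 := by exact_mod_cast hσ
  have e : ∀ x, u x * fderiv ℝ φ x d + c * u x * φ x =
      σ * (u x * fderiv ℝ φ x ch.direction + ((σ * c : ℝ) : ℂ) * u x * φ x) := by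
    intro x
    rw [hd, map_smul, Complex.real_smul]
    push_cast
    linear_combination (-c * u x * φ x) * hσ'
  simp_rw [e]
  rw [integral_const_mul, ch.weak_form hN hS huf hu φ, mul_zero]

theorem weak_zero {u : Config → ℂ} (h : u =ᵐ[volume.restrict (S₁ : Set Config)] fun _ => 0) (c : ℝ)
    (d : Config) (φ : TestFunction S₁ ℂ ⊤) :
    ∫ x in (S₁ : Set Config), (u x * fderiv ℝ φ x d + c * u x * φ x) = 0 := by
  rw [← integral_zero Config ℂ (μ := volume.restrict (S₁ : Set Config))]
  refine integral_congr_ae ?_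
  filter_upwards [h] with x hx
  simp [hx]

theorem dir_101 : dir (1, 0, 1) = (1 : ℝ) • chartA.direction := by
  rw [direction_chartA, one_smul]
theorem dir_001 : dir (0, 0, 1) = (1 : ℝ) • chartB.direction := by
  rw [direction_chartB, one_smul]
theorem dir_100 : dir (1, 0, 0) = (1 : ℝ) • chartM.direction := by
  rw [direction_chartM, one_smul]
theorem dir_011 : dir (0, 1, 1) = (1 : ℝ) • chartM'.direction := by
  rw [direction_chartM', one_smul]
theorem dir_111 : dir (1, 1, 1) = (1 : ℝ) • chartF.direction := by
  rw [direction_chartF, one_smul]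
theorem dir_010 : dir (0, 1, 0) = (-1 : ℝ) • chartA.direction := by
  rw [direction_chartA]; simp [dir, sgn]
theorem dir_110 : dir (1, 1, 0) = (-1 : ℝ) • chartB.direction := by
  rw [direction_chartB]; simp [dir, sgn]
theorem dir_011_neg : dir (0, 1, 1) = (-1 : ℝ) • chartM.direction := by
  rw [direction_chartM]; simp [dir, sgn]
theorem dir_100_neg : dir (1, 0, 0) = (-1 : ℝ) • chartM'.direction := by
  rw [direction_chartM']; simp [dir, sgn]
theorem dir_000 : dir (0, 0, 0) = (-1 : ℝ) • chartF.direction := by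
  rw [direction_chartF]; simp [dir, sgn]

section Deficiency

variable {ħ : ℝ} (hħ : 0 < ħ)
include hħ

theorem mem_deficiency_neg_I_iff_weak {Ψ : WaveFn} :
    Ψ ∈ deficiency (hamiltonian ħ 0) (-Complex.I) ↔ ∀ (ς : Spin) (φ : TestFunction S₁ ℂ ⊤),
      ∫ x in (S₁ : Set Config),
        (comp ς Ψ x * fderiv ℝ φ x (dir ς) + ((-ħ⁻¹ : ℝ) : ℂ) * comp ς Ψ x * φ x) = 0 :=
  mem_deficiency_hamiltonian_iff hħ (by
    have : (ħ : ℂ) ≠ 0 := by exact_mod_cast hħ.ne'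
    push_cast
    field_simp
    exact Complex.I_sq)

theorem mem_deficiency_I_iff_weak {Ψ : WaveFn} :
    Ψ ∈ deficiency (hamiltonian ħ 0) Complex.I ↔ ∀ (ς : Spin) (φ : TestFunction S₁ ℂ ⊤),
      ∫ x in (S₁ : Set Config),
        (comp ς Ψ x * fderiv ℝ φ x (dir ς) + ((ħ⁻¹ : ℝ) : ℂ) * comp ς Ψ x * φ x) = 0 :=
  mem_deficiency_hamiltonian_iff hħ (by
    have : (ħ : ℂ) ≠ 0 := by exact_mod_cast hħ.ne'
    push_cast
    field_simp
    rw [Complex.I_sq, neg_neg])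

/-- The elements of `Ker (i + Ĥ*)`. -/
theorem mem_deficiency_neg_I_iff {Ψ : WaveFn} :
    Ψ ∈ deficiency (hamiltonian ħ 0) (-Complex.I) ↔
      ∃ f₁ f₃ f₄ f₅ : ℝ × ℝ → ℂ, Measurable f₁ ∧ Measurable f₃ ∧ Measurable f₄ ∧ Measurable f₅ ∧
        Ψ =ᵐ[volume.restrict (S₁ : Set Config)] minusForm ħ f₁ f₃ f₄ f₅ := by
  have hc : 0 < ħ⁻¹ := inv_pos.2 hħ
  rw [mem_deficiency_neg_I_iff_weak hħ]
  constructor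
  · intro h
    have hu := fun ς => comp_memLp ς Ψ
    obtain ⟨f₁, hf₁, h₁⟩ := chartB.exists_form_of_dir (hu _) (by norm_num) dir_001 (h _)
    obtain ⟨f₃, hf₃, h₃⟩ := chartM'.exists_form_of_dir (hu _) (by norm_num) dir_011 (h _)
    obtain ⟨f₄, hf₄, h₄⟩ := chartM.exists_form_of_dir (hu _) (by norm_num) dir_100 (h _)
    obtain ⟨f₅, hf₅, h₅⟩ := chartA.exists_form_of_dir (hu _) (by norm_num) dir_101 (h _)
    rw [one_mul] at h₁ h₃ h₄ h₅
    refine ⟨f₁, f₃, f₄, f₅, hf₁, hf₃, hf₄, hf₅, ?_⟩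
    rw [ae_eq_iff_comp, forall_spin]
    simp only [minusForm_001, minusForm_011, minusForm_100, minusForm_101]
    -- With rate `-ħ⁻¹` in the direction `dir ς`, the exponential decays on half-lines that are run
    -- through away from their face (`--+`, `+-+`) and grows on those run through towards it (`-+-`,
    -- `++-`). On whole lines it is never square integrable.
    refine ⟨?_, h₁, ?_, h₃, h₄, h₅, ?_, ?_⟩
    · exact chartF.ae_eq_zero_of_dir (hu _) (by norm_num) dir_000 (h _)
        fun _ _ => lintegral_exp_univ_eq_top _
    · exact chartA.ae_eq_zero_of_dir (hu _) (by norm_num) dir_010 (h _)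
        fun _ _ => lintegral_exp_Ioi_eq_top (by simpa using hħ)
    · exact chartB.ae_eq_zero_of_dir (hu _) (by norm_num) dir_110 (h _)
        fun _ _ => lintegral_exp_Ioi_eq_top (by simpa using hħ)
    · exact chartF.ae_eq_zero_of_dir (hu _) (by norm_num) dir_111 (h _)
        fun _ _ => lintegral_exp_univ_eq_top _
  · rintro ⟨f₁, f₃, f₄, f₅, -, -, -, -, h⟩
    rw [ae_eq_iff_comp, forall_spin] at h
    simp only [minusForm_001, minusForm_011, minusForm_100, minusForm_101] at h
    obtain ⟨h0, h1, h2, h3, h4, h5, h6, h7⟩ := h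
    have hu := fun ς => comp_memLp ς Ψ
    rw [forall_spin]
    refine ⟨weak_zero h0 _ _, ?_, weak_zero h2 _ _, ?_, ?_, ?_, weak_zero h6 _ _,
      weak_zero h7 _ _⟩
    · exact chartB.weak_form_of_dir S₁_le_near₂ plane₂_notMem (hu _) (by norm_num) dir_001
        (by rw [one_mul]; exact h1)
    · exact chartM'.weak_form_of_dir S₁_le_near₂ plane₂_notMem (hu _) (by norm_num) dir_011
        (by rw [one_mul]; exact h3)
    · exact chartM.weak_form_of_dir S₁_le_near₁ plane₁_notMem (hu _) (by norm_num) dir_100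
        (by rw [one_mul]; exact h4)
    · exact chartA.weak_form_of_dir S₁_le_near₁ plane₁_notMem (hu _) (by norm_num) dir_101
        (by rw [one_mul]; exact h5)

/-- The elements of `Ker (i - Ĥ*)`. -/
theorem mem_deficiency_I_iff {Ψ : WaveFn} :
    Ψ ∈ deficiency (hamiltonian ħ 0) Complex.I ↔
      ∃ g₂ g₃ g₄ g₆ : ℝ × ℝ → ℂ, Measurable g₂ ∧ Measurable g₃ ∧ Measurable g₄ ∧ Measurable g₆ ∧
        Ψ =ᵐ[volume.restrict (S₁ : Set Config)] plusForm ħ g₂ g₃ g₄ g₆ := by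
  have hc : 0 < ħ⁻¹ := inv_pos.2 hħ
  rw [mem_deficiency_I_iff_weak hħ]
  constructor
  · intro h
    have hu := fun ς => comp_memLp ς Ψ
    -- The rate now has the opposite sign, so the half-line components exchange their roles. On the
    -- segments the chart is taken from the other end, so that all exponents are again `-τ/ħ`.
    obtain ⟨g₂, hg₂, h₂⟩ := chartA.exists_form_of_dir (hu _) (by norm_num) dir_010 (h _)
    obtain ⟨g₃, hg₃, h₃⟩ := chartM.exists_form_of_dir (hu _) (by norm_num) dir_011_neg (h _)
    obtain ⟨g₄, hg₄, h₄⟩ := chartM'.exists_form_of_dir (hu _) (by norm_num) dir_100_neg (h _)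
    obtain ⟨g₆, hg₆, h₆⟩ := chartB.exists_form_of_dir (hu _) (by norm_num) dir_110 (h _)
    rw [neg_one_mul] at h₂ h₃ h₄ h₆
    refine ⟨g₂, g₃, g₄, g₆, hg₂, hg₃, hg₄, hg₆, ?_⟩
    rw [ae_eq_iff_comp, forall_spin]
    refine ⟨?_, ?_, h₂, h₃, h₄, ?_, h₆, ?_⟩
    · exact chartF.ae_eq_zero_of_dir (hu _) (by norm_num) dir_000 (h _)
        fun _ _ => lintegral_exp_univ_eq_top _
    · exact chartB.ae_eq_zero_of_dir (hu _) (by norm_num) dir_001 (h _)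
        fun _ _ => lintegral_exp_Ioi_eq_top (by simpa using hħ)
    · exact chartA.ae_eq_zero_of_dir (hu _) (by norm_num) dir_101 (h _)
        fun _ _ => lintegral_exp_Ioi_eq_top (by simpa using hħ)
    · exact chartF.ae_eq_zero_of_dir (hu _) (by norm_num) dir_111 (h _)
        fun _ _ => lintegral_exp_univ_eq_top _
  · rintro ⟨g₂, g₃, g₄, g₆, -, -, -, -, h⟩
    rw [ae_eq_iff_comp, forall_spin] at h
    obtain ⟨h0, h1, h2, h3, h4, h5, h6, h7⟩ := h
    have hu := fun ς => comp_memLp ς Ψ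
    rw [forall_spin]
    refine ⟨weak_zero h0 _ _, weak_zero h1 _ _, ?_, ?_, ?_, weak_zero h5 _ _, ?_,
      weak_zero h7 _ _⟩
    · exact chartA.weak_form_of_dir S₁_le_near₁ plane₁_notMem (hu _) (by norm_num) dir_010
        (by rw [neg_one_mul]; exact h2)
    · exact chartM.weak_form_of_dir S₁_le_near₁ plane₁_notMem (hu _) (by norm_num) dir_011_neg
        (by rw [neg_one_mul]; exact h3)
    · exact chartM'.weak_form_of_dir S₁_le_near₂ plane₂_notMem (hu _) (by norm_num) dir_100_neg
        (by rw [neg_one_mul]; exact h4)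
    · exact chartB.weak_form_of_dir S₁_le_near₂ plane₂_notMem (hu _) (by norm_num) dir_110
        (by rw [neg_one_mul]; exact h6)

end Deficiency

/-! ### The boundary conditions on the deficiency spaces -/

theorem HasTrace.zero_of_ae {N : Opens Config} {ι : ℝ × ℝ → Config} {κ : ℝ} {d : Config}
    {u : Config → ℂ} (h : u =ᵐ[volume.restrict (S₁ : Set Config)] fun _ => 0) :
    HasTrace N ι κ d u (fun _ => 0) :=
  HasTrace.zero.congr h.symm

theorem dist₁₂_plane₁ (p : ℝ × ℝ) (hp : plane₁ p ∈ near₁) :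
    dist₁₂ (plane₁ p) = 2 * (face₁.symm p).2 := by
  change p.1 < p.2 at hp
  change |p.1 - p.2| = 2 * ((p.2 - p.1) / 2)
  rw [abs_of_neg (by linarith)]; ring

theorem dist₁₂_plane₂ (p : ℝ × ℝ) (hp : plane₂ p ∈ near₂) :
    dist₁₂ (plane₂ p) = 2 * (face₂.symm p).2 := by
  change p.2 < p.1 at hp
  change |p.2 - p.1| = 2 * ((p.1 - p.2) / 2)
  rw [abs_of_neg (by linarith)]; ring

theorem mem_leakyConditions_iff {θ₁ θ₂ : ℝ} {m : ℝ → ℝ} {Ψ : WaveFn} :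
    Ψ ∈ leakyConditions θ₁ θ₂ m ↔
      (Ψ ∈ bc₁ (1, 0, 0) (0, 1, 0)
          (fun p => Complex.exp (Complex.I * θ₁) * m (dist₁₂ (plane₁ p))) ∧
        Ψ ∈ bc₁ (1, 0, 1) (0, 1, 1)
          (fun p => Complex.exp (Complex.I * θ₁) * m (dist₁₂ (plane₁ p)))) ∧
      (Ψ ∈ bc₂ (0, 0, 1) (1, 0, 0)
          (fun p => Complex.exp (Complex.I * θ₂) * m (dist₁₂ (plane₂ p))) ∧
        Ψ ∈ bc₂ (0, 1, 1) (1, 1, 0)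
          (fun p => Complex.exp (Complex.I * θ₂) * m (dist₁₂ (plane₂ p)))) := by
  simp only [leakyConditions, Submodule.mem_inf, Submodule.mem_iInf, Fin.forall_fin_two]

/-- The amplitude `e^{-r/ħ}` of a segment of length `r`. -/
def amp (ħ r : ℝ) : ℝ := Real.exp (-ħ⁻¹ * r)

section LeakyConditions

variable {ħ : ℝ} {θ₁ θ₂ : ℝ} {m : ℝ → ℝ}

/-- The boundary conditions for the sum of elements of `Ker (i + Ĥ*)` and `Ker (i - Ĥ*)`. -/
theorem add_mem_leakyConditions {Ψ Φ : WaveFn} {f₁ f₃ f₄ f₅ g₂ g₃ g₄ g₆ : ℝ × ℝ → ℂ}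
    (hΨ : Ψ =ᵐ[volume.restrict (S₁ : Set Config)] minusForm ħ f₁ f₃ f₄ f₅)
    (hΦ : Φ =ᵐ[volume.restrict (S₁ : Set Config)] plusForm ħ g₂ g₃ g₄ g₆)
    (h₂ : ∀ q r : ℝ, 0 < r → g₂ (q, r) = Complex.exp (Complex.I * θ₁) * m (2 * r) *
      (f₄ (q, r) + amp ħ r * g₄ (q + r, r)))
    (h₃ : ∀ q r : ℝ, 0 < r → amp ħ r * f₃ (q + r, r) + g₃ (q, r) =
      Complex.exp (Complex.I * θ₁) * m (2 * r) * f₅ (q, r))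
    (h₄ : ∀ q r : ℝ, 0 < r → amp ħ r * f₄ (q - r, r) + g₄ (q, r) =
      Complex.exp (Complex.I * θ₂) * m (2 * r) * f₁ (q, r))
    (h₆ : ∀ q r : ℝ, 0 < r → g₆ (q, r) = Complex.exp (Complex.I * θ₂) * m (2 * r) *
      (f₃ (q, r) + amp ħ r * g₃ (q - r, r))) :
    Φ + Ψ ∈ leakyConditions θ₁ θ₂ m := by
  rw [ae_eq_iff_comp, forall_spin] at hΨ hΦ
  simp only [minusForm_001, minusForm_011, minusForm_100, minusForm_101] at hΨ
  obtain ⟨-, hΨ1, hΨ2, hΨ3, hΨ4, hΨ5, hΨ6, -⟩ := hΨ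
  obtain ⟨-, hΦ1, hΦ2, hΦ3, hΦ4, hΦ5, hΦ6, -⟩ := hΦ
  change comp (0, 1, 0) Φ =ᵐ[_] chartA.form (-ħ⁻¹) g₂ at hΦ2
  change comp (0, 1, 1) Φ =ᵐ[_] chartM.form (-ħ⁻¹) g₃ at hΦ3
  change comp (1, 0, 0) Φ =ᵐ[_] chartM'.form (-ħ⁻¹) g₄ at hΦ4
  change comp (1, 1, 0) Φ =ᵐ[_] chartB.form (-ħ⁻¹) g₆ at hΦ6
  have hu := fun ς => comp_memLp ς Ψ
  have hv := fun ς => comp_memLp ς Φ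
  -- The segment components have traces on both faces. Rewriting each from its far end produces the
  -- factor `amp` and the shift of the label by `r`.
  have hΨ3' := hΨ3
  rw [chartM'_form_eq_chartM] at hΨ3'
  have hΨ4' := hΨ4
  rw [chartM_form_eq_chartM'] at hΨ4'
  have hΦ3' := hΦ3
  rw [chartM_form_eq_chartM'] at hΦ3'
  have hΦ4' := hΦ4
  rw [chartM'_form_eq_chartM] at hΦ4'
  have hadd₁ : ∀ {ς : Spin} {κ : ℝ} {g g' : ℝ × ℝ → ℂ},
      HasTrace near₁ plane₁ κ (dir ς) (comp ς Φ) g → HasTrace near₁ plane₁ κ (dir ς) (comp ς Ψ) g' →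
      HasTrace near₁ plane₁ κ (dir ς) (comp ς (Φ + Ψ)) (fun p => g p + g' p) := fun h h' =>
    (h.add isClosedEmbedding_plane₁ (hv _) (hu _) h').congr (comp_add _ _ _)
  have hadd₂ : ∀ {ς : Spin} {κ : ℝ} {g g' : ℝ × ℝ → ℂ},
      HasTrace near₂ plane₂ κ (dir ς) (comp ς Φ) g → HasTrace near₂ plane₂ κ (dir ς) (comp ς Ψ) g' →
      HasTrace near₂ plane₂ κ (dir ς) (comp ς (Φ + Ψ)) (fun p => g p + g' p) := fun h h' =>
    (h.add isClosedEmbedding_plane₂ (hv _) (hu _) h').congr (comp_add _ _ _)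
  have hpos₁ : ∀ p, plane₁ p ∈ near₁ → 0 < (face₁.symm p).2 := fun p hp =>
    half_pos (sub_pos.2 (show p.1 < p.2 from hp))
  have hpos₂ : ∀ p, plane₂ p ∈ near₂ → 0 < (face₂.symm p).2 := fun p hp =>
    half_pos (sub_pos.2 (show p.2 < p.1 from hp))
  rw [mem_leakyConditions_iff]
  refine ⟨⟨⟨_, hadd₁ (chartM.hasTrace_form hΦ4' (hv _) dir_100 (by norm_num [sgn]))
      (chartM.hasTrace_form hΨ4 (hu _) dir_100 (by norm_num [sgn])),
      (hadd₁ (chartA.hasTrace_form hΦ2 (hv _) dir_010 (by norm_num [sgn]))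
      (HasTrace.zero_of_ae hΨ2)).congr_trace measurableSet_face₁ fun p hp => ?_⟩,
    ⟨_, hadd₁ (HasTrace.zero_of_ae hΦ5)
      (chartA.hasTrace_form hΨ5 (hu _) dir_101 (by norm_num [sgn])),
      (hadd₁ (chartM.hasTrace_form hΦ3 (hv _) dir_011_neg (by norm_num [sgn]))
      (chartM.hasTrace_form hΨ3' (hu _) dir_011_neg (by norm_num [sgn]))).congr_trace
        measurableSet_face₁ fun p hp => ?_⟩⟩,
    ⟨⟨_, hadd₂ (HasTrace.zero_of_ae hΦ1)
      (chartB.hasTrace_form hΨ1 (hu _) dir_001 (by norm_num [sgn])),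
      (hadd₂ (chartM'.hasTrace_form hΦ4 (hv _) dir_100_neg (by norm_num [sgn]))
      (chartM'.hasTrace_form hΨ4' (hu _) dir_100_neg (by norm_num [sgn]))).congr_trace
        measurableSet_face₂ fun p hp => ?_⟩,
    ⟨_, hadd₂ (chartM'.hasTrace_form hΦ3' (hv _) dir_011 (by norm_num [sgn]))
      (chartM'.hasTrace_form hΨ3 (hu _) dir_011 (by norm_num [sgn])),
      (hadd₂ (chartB.hasTrace_form hΦ6 (hv _) dir_110 (by norm_num [sgn]))
      (HasTrace.zero_of_ae hΨ6)).congr_trace measurableSet_face₂ fun p hp => ?_⟩⟩⟩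
  · beta_reduce
    rw [dist₁₂_plane₁ p hp]
    have := h₂ (face₁.symm p).1 _ (hpos₁ p hp)
    change g₂ (face₁.symm p) + 0 = _ * (amp ħ (face₁.symm p).2 *
      g₄ ((face₁.symm p).1 + (face₁.symm p).2, (face₁.symm p).2) + f₄ (face₁.symm p))
    rw [add_zero]
    refine this.trans ?_
    ring
  · beta_reduce
    rw [dist₁₂_plane₁ p hp]
    have := h₃ (face₁.symm p).1 _ (hpos₁ p hp)
    change g₃ (face₁.symm p) + amp ħ (face₁.symm p).2 * _ = _ * (0 + f₅ (face₁.symm p))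
    rw [zero_add, add_comm]
    exact this
  · beta_reduce
    rw [dist₁₂_plane₂ p hp]
    have := h₄ (face₂.symm p).1 _ (hpos₂ p hp)
    change g₄ (face₂.symm p) + amp ħ (face₂.symm p).2 * _ = _ * (0 + f₁ (face₂.symm p))
    rw [zero_add, add_comm]
    exact this
  · beta_reduce
    rw [dist₁₂_plane₂ p hp]
    have := h₆ (face₂.symm p).1 _ (hpos₂ p hp)
    change g₆ (face₂.symm p) + 0 = _ * (amp ħ (face₂.symm p).2 *
      g₃ ((face₂.symm p).1 - (face₂.symm p).2, (face₂.symm p).2) + f₃ (face₂.symm p))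
    rw [add_zero]
    refine this.trans ?_
    ring

theorem closure_domain_le_leakyConditions (hħ : 0 < ħ) :
    (hamiltonian ħ 0).closure.domain ≤ leakyConditions θ₁ θ₂ m := by
  intro Ψ hΨ
  have h := hasTrace_zero_of_mem_closure_domain hħ hΨ
  rw [mem_leakyConditions_iff]
  have h' : ∀ (N : Opens Config) (ι : ℝ × ℝ → Config) (κ : ℝ) (ς : Spin) (a : ℝ × ℝ → ℂ),
      HasTrace N ι κ (dir ς) (comp ς Ψ) (fun p => a p * (fun _ => 0 : ℝ × ℝ → ℂ) p) := by
    intro N ι κ ς a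
    simpa only [mul_zero] using h N ι κ ς
  exact ⟨⟨⟨_, h _ _ _ _, h' _ _ _ _ _⟩, ⟨_, h _ _ _ _, h' _ _ _ _ _⟩⟩,
    ⟨⟨_, h _ _ _ _, h' _ _ _ _ _⟩, ⟨_, h _ _ _ _, h' _ _ _ _ _⟩⟩⟩

/-- A function `e^{c τ} f(y)` vanishes if its trace does. -/
theorem FaceChart.form_ae_eq_zero_of_trace {N : Opens Config} {ι : ℝ × ℝ → Config}
    (ch : FaceChart N ι) (c : ℝ) {f : ℝ × ℝ → ℂ} (hf : Measurable f)
    (h : ∀ᵐ p, p ∈ ι ⁻¹' (N : Set Config) → f (ch.face.symm p) = 0) :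
    ch.form c f =ᵐ[volume.restrict (S₁ : Set Config)] fun _ => 0 := by
  have h1 : ∀ᵐ y, y ∈ ch.base → f y = 0 := by
    rw [ch.volume_face, Measure.ae_ennreal_smul_measure_iff (by norm_num)] at h
    have h2 := ae_of_ae_map ch.face.continuous.measurable.aemeasurable h
    filter_upwards [h2] with y hy hyb
    simpa using hy ((ch.mem_base_iff y).1 hyb)
  have h2 : ∫⁻ x in (S₁ : Set Config), ‖ch.form c f x‖ₑ ^ 2 = 0 := by
    rw [ch.lintegral_form c hf, setLIntegral_congr_fun_ae ch.isOpen_base.measurableSet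
      (g := fun _ => 0)]
    · simp
    · filter_upwards [h1] with y hy hyb
      simp [hy hyb]
  rw [lintegral_eq_zero_iff ((ch.measurable_form c hf).enorm.pow_const 2)] at h2
  filter_upwards [h2] with x hx
  simpa using hx

/-- No nonzero element of `Ker (i - Ĥ*)` satisfies the boundary conditions. -/
theorem eq_zero_of_mem_deficiency_of_mem_leakyConditions (hħ : 0 < ħ) {Φ : WaveFn}
    (hΦ : Φ ∈ deficiency (hamiltonian ħ 0) Complex.I) (h : Φ ∈ leakyConditions θ₁ θ₂ m) : Φ = 0 := by
  obtain ⟨g₂, g₃, g₄, g₆, hg₂, hg₃, hg₄, hg₆, hf⟩ := (mem_deficiency_I_iff hħ).1 hΦ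
  rw [ae_eq_iff_comp, forall_spin] at hf
  obtain ⟨h0, h1, h2, h3, h4, h5, h6, h7⟩ := hf
  change comp (0, 1, 0) Φ =ᵐ[_] chartA.form (-ħ⁻¹) g₂ at h2
  change comp (0, 1, 1) Φ =ᵐ[_] chartM.form (-ħ⁻¹) g₃ at h3
  change comp (1, 0, 0) Φ =ᵐ[_] chartM'.form (-ħ⁻¹) g₄ at h4
  change comp (1, 1, 0) Φ =ᵐ[_] chartB.form (-ħ⁻¹) g₆ at h6
  have hv := fun ς => comp_memLp ς Φ
  rw [mem_leakyConditions_iff] at h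
  obtain ⟨⟨⟨a, ha, ha'⟩, ⟨b, hb, hb'⟩⟩, ⟨⟨c, hc, hc'⟩, ⟨d, hd, hd'⟩⟩⟩ := h
  -- The components `+-+` and `--+` are absent from `Ker (i - Ĥ*)`, so the boundary conditions give
  -- the segment components zero trace at one end. This forces them to vanish along the whole
  -- segments.
  have z3 : comp (0, 1, 1) Φ =ᵐ[volume.restrict (S₁ : Set Config)] fun _ => 0 := by
    refine h3.trans (chartM.form_ae_eq_zero_of_trace _ hg₃ ?_)
    have e1 := ae_unique_trace₁ (by norm_num [sgn]) (hv _) hb (HasTrace.zero_of_ae h5)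
    have e2 := ae_unique_trace₁ (by norm_num [sgn]) (hv _) hb'
      (chartM.hasTrace_form h3 (hv _) dir_011_neg (by norm_num [sgn]))
    filter_upwards [e1, e2] with p h1 h2 hp
    rw [← h2 hp, h1 hp, mul_zero]
  have z4 : comp (1, 0, 0) Φ =ᵐ[volume.restrict (S₁ : Set Config)] fun _ => 0 := by
    refine h4.trans (chartM'.form_ae_eq_zero_of_trace _ hg₄ ?_)
    have e1 := ae_unique_trace₂ (by norm_num [sgn]) (hv _) hc (HasTrace.zero_of_ae h1)
    have e2 := ae_unique_trace₂ (by norm_num [sgn]) (hv _) hc'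
      (chartM'.hasTrace_form h4 (hv _) dir_100_neg (by norm_num [sgn]))
    filter_upwards [e1, e2] with p h1 h2 hp
    rw [← h2 hp, h1 hp, mul_zero]
  -- The segment components also vanish at their other ends, which are the sources of the two
  -- half-line components.
  have z2 : comp (0, 1, 0) Φ =ᵐ[volume.restrict (S₁ : Set Config)] fun _ => 0 := by
    refine h2.trans (chartA.form_ae_eq_zero_of_trace _ hg₂ ?_)
    have e1 := ae_unique_trace₁ (by norm_num [sgn]) (hv _) ha (HasTrace.zero_of_ae z4)
    have e2 := ae_unique_trace₁ (by norm_num [sgn]) (hv _) ha'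
      (chartA.hasTrace_form h2 (hv _) dir_010 (by norm_num [sgn]))
    filter_upwards [e1, e2] with p h1 h2 hp
    rw [← h2 hp, h1 hp, mul_zero]
  have z6 : comp (1, 1, 0) Φ =ᵐ[volume.restrict (S₁ : Set Config)] fun _ => 0 := by
    refine h6.trans (chartB.form_ae_eq_zero_of_trace _ hg₆ ?_)
    have e1 := ae_unique_trace₂ (by norm_num [sgn]) (hv _) hd (HasTrace.zero_of_ae z3)
    have e2 := ae_unique_trace₂ (by norm_num [sgn]) (hv _) hd'
      (chartB.hasTrace_form h6 (hv _) dir_110 (by norm_num [sgn]))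
    filter_upwards [e1, e2] with p h1 h2 hp
    rw [← h2 hp, h1 hp, mul_zero]
  rw [Lp.eq_zero_iff_ae_eq_zero]
  refine ae_eq_iff_comp.2 (forall_spin.2 ⟨h0, h1, z2, z3, z4, h5, z6, h7⟩)

end LeakyConditions

/-! ### Norms of the elements of the deficiency spaces -/

theorem lintegral_exp_Ioi {ħ : ℝ} (hħ : 0 < ħ) :
    ∫⁻ τ in Ioi (0 : ℝ), ENNReal.ofReal (Real.exp (2 * -ħ⁻¹ * τ)) = ENNReal.ofReal (ħ / 2) := by
  have ha : 2 * -ħ⁻¹ < 0 := by have := inv_pos.2 hħ; linarith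
  rw [← ofReal_integral_eq_lintegral_ofReal (integrableOn_exp_mul_Ioi ha 0)
    (Eventually.of_forall fun _ => (Real.exp_pos _).le), integral_exp_mul_Ioi ha]
  congr 1
  simp
  field_simp

theorem amp_sq (ħ r : ℝ) : amp ħ r ^ 2 = Real.exp (2 * -ħ⁻¹ * r) := by
  rw [amp, ← Real.exp_nat_mul]
  congr 1
  push_cast; ring

theorem amp_sq_le_one {ħ : ℝ} (hħ : 0 < ħ) {r : ℝ} (hr : 0 ≤ r) : amp ħ r ^ 2 ≤ 1 := by
  rw [amp_sq, Real.exp_le_one_iff]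
  have := mul_nonneg (inv_pos.2 hħ).le hr
  linarith

theorem measurable_amp (ħ : ℝ) : Measurable (amp ħ) :=
  Real.measurable_exp.comp (measurable_id.const_mul _)

/-- The relative weight `1 - e^{-2r/ħ}` of a segment of length `r`. -/
def weight (ħ r : ℝ) : ENNReal := ENNReal.ofReal (1 - amp ħ r ^ 2)

theorem measurable_weight (ħ : ℝ) : Measurable (weight ħ) :=
  (measurable_const.sub ((measurable_amp ħ).pow_const 2)).ennreal_ofReal

theorem lintegral_exp_Ioo {ħ : ℝ} (hħ : 0 < ħ) {r : ℝ} (hr : 0 < r) :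
    ∫⁻ τ in Ioo (0 : ℝ) r, ENNReal.ofReal (Real.exp (2 * -ħ⁻¹ * τ)) =
      weight ħ r * ENNReal.ofReal (ħ / 2) := by
  have ha : 2 * -ħ⁻¹ ≠ 0 := by have := inv_pos.2 hħ; linarith
  have hi : IntegrableOn (fun τ => Real.exp (2 * -ħ⁻¹ * τ)) (Ioc 0 r) :=
    (by fun_prop : Continuous fun τ => Real.exp (2 * -ħ⁻¹ * τ)).continuousOn.integrableOn_Icc.mono_set
      Ioc_subset_Icc_self
  rw [restrict_Ioo_eq_restrict_Ioc, ← ofReal_integral_eq_lintegral_ofReal hi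
    (Eventually.of_forall fun _ => (Real.exp_pos _).le),
    ← intervalIntegral.integral_of_le hr.le, intervalIntegral.integral_comp_mul_left _ ha,
    integral_exp, mul_zero, Real.exp_zero, ← amp_sq, weight,
    ← ENNReal.ofReal_mul (sub_nonneg.2 (amp_sq_le_one hħ hr.le))]
  congr 1
  rw [smul_eq_mul]
  field_simp
  ring

/-- The square of the norm of the amplitude `b` on half-lines and `a` on segments. -/
def sqNorm (ħ : ℝ) (b a : ℝ × ℝ → ℂ) : ENNReal :=
  ∫⁻ y in halfPlane, (‖b y‖ₑ ^ 2 + weight ħ y.2 * ‖a y‖ₑ ^ 2)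

theorem sqNorm_eq (ħ : ℝ) {b : ℝ × ℝ → ℂ} (hb : Measurable b) (a : ℝ × ℝ → ℂ) :
    sqNorm ħ b a = (∫⁻ y in halfPlane, ‖b y‖ₑ ^ 2) +
      ∫⁻ y in halfPlane, weight ħ y.2 * ‖a y‖ₑ ^ 2 :=
  lintegral_add_left (hb.enorm.pow_const 2) _

theorem measurableSet_halfPlane : MeasurableSet halfPlane := isOpen_halfPlane.measurableSet

theorem lintegral_form_halfLine {ħ : ℝ} (hħ : 0 < ħ) {ch : CharChart} (hb : ch.base = halfPlane)
    (hs : ∀ y, ch.slice y = Ioi 0) {f : ℝ × ℝ → ℂ} (hf : Measurable f) :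
    ∫⁻ x in (S₁ : Set Config), ‖ch.form (-ħ⁻¹) f x‖ₑ ^ 2 =
      4 * ENNReal.ofReal (ħ / 2) * ∫⁻ y in halfPlane, ‖f y‖ₑ ^ 2 := by
  simp_rw [ch.lintegral_form _ hf, hb, hs, lintegral_exp_Ioi hħ]
  rw [lintegral_mul_const _ (hf.enorm.pow_const 2)]
  ring

theorem measurable_weight_mul {ħ : ℝ} {f : ℝ × ℝ → ℂ} (hf : Measurable f) :
    Measurable fun y => weight ħ y.2 * ‖f y‖ₑ ^ 2 :=
  ((measurable_weight ħ).comp measurable_snd).mul (hf.enorm.pow_const 2)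

theorem lintegral_form_segment {ħ : ℝ} (hħ : 0 < ħ) {ch : CharChart} (hb : ch.base = halfPlane)
    (hs : ∀ y, ch.slice y = Ioo 0 y.2) {f : ℝ × ℝ → ℂ} (hf : Measurable f) :
    ∫⁻ x in (S₁ : Set Config), ‖ch.form (-ħ⁻¹) f x‖ₑ ^ 2 =
      4 * ENNReal.ofReal (ħ / 2) * ∫⁻ y in halfPlane, weight ħ y.2 * ‖f y‖ₑ ^ 2 := by
  simp_rw [ch.lintegral_form _ hf, hb, hs]
  rw [setLIntegral_congr_fun measurableSet_halfPlane
    (g := fun y => weight ħ y.2 * ‖f y‖ₑ ^ 2 * ENNReal.ofReal (ħ / 2))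
    (fun y (hy : 0 < y.2) => by simp only [lintegral_exp_Ioo hħ hy]; ring),
    lintegral_mul_const _ (measurable_weight_mul hf)]
  ring

theorem lintegral_add₄ {α : Type*} [MeasurableSpace α] {ν : Measure α} {F₁ F₂ F₃ : α → ENNReal}
    (h₁ : Measurable F₁) (h₂ : Measurable F₂) (h₃ : Measurable F₃) (F₄ : α → ENNReal) :
    ∫⁻ x, (F₁ x + F₂ x + F₃ x + F₄ x) ∂ν =
      (∫⁻ x, F₁ x ∂ν) + (∫⁻ x, F₂ x ∂ν) + (∫⁻ x, F₃ x ∂ν) + ∫⁻ x, F₄ x ∂ν := by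
  have h₁₂ : Measurable fun x => F₁ x + F₂ x := h₁.add h₂
  have h₁₃ : Measurable fun x => F₁ x + F₂ x + F₃ x := h₁₂.add h₃
  rw [lintegral_add_left h₁₃, lintegral_add_left h₁₂, lintegral_add_left h₁]

theorem enorm_spinor_sq (v : Spinor) : ‖v‖ₑ ^ 2 = ∑ ς, ‖v ς‖ₑ ^ 2 := by
  have h : ∀ {E : Type} [NormedAddCommGroup E] (z : E), ‖z‖ₑ ^ 2 = ENNReal.ofReal (‖z‖ ^ 2) := by
    intro E _ z
    rw [← ofReal_norm, ENNReal.ofReal_pow (norm_nonneg _)]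
  simp_rw [h]
  rw [EuclideanSpace.norm_sq_eq, ENNReal.ofReal_sum_of_nonneg fun _ _ => sq_nonneg _]

section

variable {ħ : ℝ} {f₁ f₃ f₄ f₅ : ℝ × ℝ → ℂ}

theorem measurable_minusForm (h₁ : Measurable f₁) (h₃ : Measurable f₃) (h₄ : Measurable f₄)
    (h₅ : Measurable f₅) : Measurable (minusForm ħ f₁ f₃ f₄ f₅) := by
  refine (WithLp.measurable_toLp 2 (Spin → ℂ)).comp (measurable_pi_iff.2 (forall_spin.2
    ⟨measurable_const, ?_, measurable_const, ?_, ?_, ?_, measurable_const, measurable_const⟩))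
  · convert chartB.measurable_form (-ħ⁻¹) h₁ using 1
    exact funext fun x => minusForm_001 ħ f₁ f₃ f₄ f₅ x
  · convert chartM'.measurable_form (-ħ⁻¹) h₃ using 1
    exact funext fun x => minusForm_011 ħ f₁ f₃ f₄ f₅ x
  · convert chartM.measurable_form (-ħ⁻¹) h₄ using 1
    exact funext fun x => minusForm_100 ħ f₁ f₃ f₄ f₅ x
  · convert chartA.measurable_form (-ħ⁻¹) h₅ using 1
    exact funext fun x => minusForm_101 ħ f₁ f₃ f₄ f₅ x

theorem measurable_plusForm (h₁ : Measurable f₁) (h₃ : Measurable f₃) (h₄ : Measurable f₄)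
    (h₅ : Measurable f₅) : Measurable (plusForm ħ f₁ f₃ f₄ f₅) := by
  refine (WithLp.measurable_toLp 2 (Spin → ℂ)).comp (measurable_pi_iff.2 (forall_spin.2
    ⟨measurable_const, measurable_const, ?_, ?_, ?_, measurable_const, ?_, measurable_const⟩))
  · exact chartA.measurable_form (-ħ⁻¹) h₁
  · exact chartM.measurable_form (-ħ⁻¹) h₃
  · exact chartM'.measurable_form (-ħ⁻¹) h₄
  · exact chartB.measurable_form (-ħ⁻¹) h₅

/-- The amplitudes are grouped into the pairs that the boundary conditions couple: `f₁` with `f₄`,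
and `f₅` with `f₃`. The contraction acts on each pair separately. -/
theorem lintegral_minusForm (hħ : 0 < ħ) (h₁ : Measurable f₁) (h₃ : Measurable f₃)
    (h₄ : Measurable f₄) (h₅ : Measurable f₅) :
    ∫⁻ x in (S₁ : Set Config), ‖minusForm ħ f₁ f₃ f₄ f₅ x‖ₑ ^ 2 =
      4 * ENNReal.ofReal (ħ / 2) * (sqNorm ħ f₁ f₄ + sqNorm ħ f₅ f₃) := by
  have e : ∀ x, ‖minusForm ħ f₁ f₃ f₄ f₅ x‖ₑ ^ 2 =
      ‖chartB.form (-ħ⁻¹) f₁ x‖ₑ ^ 2 + ‖chartM'.form (-ħ⁻¹) f₃ x‖ₑ ^ 2 +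
      ‖chartM.form (-ħ⁻¹) f₄ x‖ₑ ^ 2 + ‖chartA.form (-ħ⁻¹) f₅ x‖ₑ ^ 2 := by
    intro x
    rw [enorm_spinor_sq, sum_spin, minusForm_001, minusForm_011, minusForm_100, minusForm_101]
    simp [minusForm]
  simp_rw [e]
  have m₁ := (chartB.measurable_form (-ħ⁻¹) h₁).enorm.pow_const 2
  have m₃ := (chartM'.measurable_form (-ħ⁻¹) h₃).enorm.pow_const 2
  have m₄ := (chartM.measurable_form (-ħ⁻¹) h₄).enorm.pow_const 2
  rw [lintegral_add₄ m₁ m₃ m₄, lintegral_form_halfLine hħ rfl (fun _ => rfl) h₁,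
    lintegral_form_halfLine hħ rfl (fun _ => rfl) h₅,
    lintegral_form_segment hħ rfl (fun _ => rfl) h₃,
    lintegral_form_segment hħ rfl (fun _ => rfl) h₄, sqNorm_eq ħ h₁, sqNorm_eq ħ h₅]
  ring

theorem lintegral_plusForm (hħ : 0 < ħ) (h₁ : Measurable f₁) (h₃ : Measurable f₃)
    (h₄ : Measurable f₄) (h₅ : Measurable f₅) :
    ∫⁻ x in (S₁ : Set Config), ‖plusForm ħ f₁ f₃ f₄ f₅ x‖ₑ ^ 2 =
      4 * ENNReal.ofReal (ħ / 2) * (sqNorm ħ f₁ f₄ + sqNorm ħ f₅ f₃) := by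
  have e : ∀ x, ‖plusForm ħ f₁ f₃ f₄ f₅ x‖ₑ ^ 2 =
      ‖chartA.form (-ħ⁻¹) f₁ x‖ₑ ^ 2 + ‖chartM.form (-ħ⁻¹) f₃ x‖ₑ ^ 2 +
      ‖chartM'.form (-ħ⁻¹) f₄ x‖ₑ ^ 2 + ‖chartB.form (-ħ⁻¹) f₅ x‖ₑ ^ 2 := by
    intro x
    rw [enorm_spinor_sq, sum_spin]
    simp [plusForm]
  simp_rw [e]
  have m₁ := (chartA.measurable_form (-ħ⁻¹) h₁).enorm.pow_const 2
  have m₃ := (chartM.measurable_form (-ħ⁻¹) h₃).enorm.pow_const 2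
  have m₄ := (chartM'.measurable_form (-ħ⁻¹) h₄).enorm.pow_const 2
  rw [lintegral_add₄ m₁ m₃ m₄, lintegral_form_halfLine hħ rfl (fun _ => rfl) h₁,
    lintegral_form_halfLine hħ rfl (fun _ => rfl) h₅,
    lintegral_form_segment hħ rfl (fun _ => rfl) h₃,
    lintegral_form_segment hħ rfl (fun _ => rfl) h₄, sqNorm_eq ħ h₁, sqNorm_eq ħ h₅]
  ring

theorem plusForm_sub (g₁ g₃ g₄ g₅ : ℝ × ℝ → ℂ) (x : Config) :
    plusForm ħ f₁ f₃ f₄ f₅ x - plusForm ħ g₁ g₃ g₄ g₅ x =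
      plusForm ħ (f₁ - g₁) (f₃ - g₃) (f₄ - g₄) (f₅ - g₅) x := by
  ext ς
  revert ς
  rw [forall_spin]
  simp only [plusForm, PiLp.sub_apply, CharChart.form, Pi.sub_apply, mul_sub, sub_self, and_self]

end

theorem enorm_sq_waveFn {Ψ : WaveFn} {F : Config → Spinor}
    (h : Ψ =ᵐ[volume.restrict (S₁ : Set Config)] F) :
    ‖Ψ‖ₑ ^ 2 = ∫⁻ x in (S₁ : Set Config), ‖F x‖ₑ ^ 2 := by
  rw [Lp.enorm_def, eLpNorm_congr_ae h, eLpNorm_eq_lintegral_rpow_enorm_toReal (by norm_num) (by norm_num),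
    ← ENNReal.rpow_natCast, ← ENNReal.rpow_mul]
  simp

theorem memLp_of_lintegral_ne_top {F : Config → Spinor} (hF : Measurable F)
    (h : ∫⁻ x in (S₁ : Set Config), ‖F x‖ₑ ^ 2 ≠ ⊤) :
    MemLp F 2 (volume.restrict (S₁ : Set Config)) := by
  refine ⟨hF.aestronglyMeasurable, ?_⟩
  rw [eLpNorm_lt_top_iff_lintegral_rpow_enorm_lt_top (by norm_num) (by norm_num)]
  simpa using h.lt_top

/-! ### The amplitudes of the image -/

/-- The outgoing amplitude on a half-line, when the amplitude `a` on a segment and the amplitude `b`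
on the half-line behind that segment are given. -/
def outAmp (e e' : ℂ) (E k : ℝ) (b a : ℂ) : ℂ := e * k * ((1 - E ^ 2 : ℝ) * a + e' * E * k * b)

/-- The amplitude reflected into the segment. -/
def retAmp (e' : ℂ) (E k : ℝ) (b a : ℂ) : ℂ := k * e' * b - E * a

/-- The algebraic core of unitarity. For `|E| ≤ 1`, after rescaling `a` by `√(1 - E²)`, the map has
the matrix with rows `(E, √(1 - E²))` and `(√(1 - E²), -E)`, which is a reflection. -/
theorem normSq_outAmp_add (a b : ℂ) (E : ℝ) :
    Complex.normSq ((1 - E ^ 2 : ℝ) * a + E * b) + (1 - E ^ 2) * Complex.normSq (b - E * a) =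
      Complex.normSq b + (1 - E ^ 2) * Complex.normSq a := by
  simp only [Complex.normSq_apply, Complex.add_re, Complex.add_im, Complex.sub_re, Complex.sub_im,
    Complex.re_ofReal_mul, Complex.im_ofReal_mul]
  ring

section Amplitudes

variable {e e' : ℂ} (he : ‖e‖ = 1) (he' : ‖e'‖ = 1) {E k : ℝ}
include he he'

/-- The map is the isometry above, preceded by multiplication of `b` by `k e'` and followed by
multiplication of the outgoing amplitude by `k e`. Both factors have modulus at most `1`. -/
theorem norm_outAmp_add_le (hk : k ∈ Icc (0 : ℝ) 1) (b a : ℂ) :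
    ‖outAmp e e' E k b a‖ ^ 2 + (1 - E ^ 2) * ‖retAmp e' E k b a‖ ^ 2 ≤
      ‖b‖ ^ 2 + (1 - E ^ 2) * ‖a‖ ^ 2 := by
  have h := normSq_outAmp_add a (k * e' * b) E
  have hX : outAmp e e' E k b a = e * (k * ((1 - E ^ 2 : ℝ) * a + E * (k * e' * b))) := by
    rw [outAmp]; ring
  have hk2 : k ^ 2 ≤ 1 := by nlinarith [hk.1, hk.2]
  have hn : ∀ z : ℂ, ‖(k : ℂ) * z‖ ^ 2 = k ^ 2 * ‖z‖ ^ 2 := by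
    intro z
    rw [norm_mul, Complex.norm_real, mul_pow, Real.norm_eq_abs, sq_abs]
  rw [hX, norm_mul, he, one_mul, hn, retAmp]
  simp only [← Complex.sq_norm] at h
  have hb : ‖(k : ℂ) * e' * b‖ ^ 2 = k ^ 2 * ‖b‖ ^ 2 := by
    rw [mul_assoc, hn, norm_mul, he', one_mul]
  rw [hb] at h
  nlinarith [sq_nonneg ‖((1 - E ^ 2 : ℝ) : ℂ) * a + E * (k * e' * b)‖, sq_nonneg ‖b‖,
    mul_nonneg (sub_nonneg.2 hk2) (sq_nonneg ‖((1 - E ^ 2 : ℝ) : ℂ) * a + E * (k * e' * b)‖),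
    mul_nonneg (sub_nonneg.2 hk2) (sq_nonneg ‖b‖)]

theorem norm_outAmp_add_eq (b a : ℂ) :
    ‖outAmp e e' E 1 b a‖ ^ 2 + (1 - E ^ 2) * ‖retAmp e' E 1 b a‖ ^ 2 =
      ‖b‖ ^ 2 + (1 - E ^ 2) * ‖a‖ ^ 2 := by
  have h := normSq_outAmp_add a (e' * b) E
  have hX : outAmp e e' E 1 b a = e * ((1 - E ^ 2 : ℝ) * a + E * (e' * b)) := by
    rw [outAmp]; push_cast; ring
  have hY : retAmp e' E 1 b a = e' * b - E * a := by rw [retAmp]; push_cast; ring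
  simp only [← Complex.sq_norm] at h
  rw [hX, hY, norm_mul, he, one_mul, h, norm_mul, he', one_mul]

end Amplitudes

theorem enorm_sq_eq_ofReal (z : ℂ) : ‖z‖ₑ ^ 2 = ENNReal.ofReal (‖z‖ ^ 2) := by
  rw [← ofReal_norm, ENNReal.ofReal_pow (norm_nonneg _)]

theorem enorm_add_weight_mul {ħ : ℝ} (hħ : 0 < ħ) {r : ℝ} (hr : 0 ≤ r) (z w : ℂ) :
    ‖z‖ₑ ^ 2 + weight ħ r * ‖w‖ₑ ^ 2 =
      ENNReal.ofReal (‖z‖ ^ 2 + (1 - amp ħ r ^ 2) * ‖w‖ ^ 2) := by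
  have h := sub_nonneg.2 (amp_sq_le_one hħ hr)
  rw [enorm_sq_eq_ofReal, enorm_sq_eq_ofReal, weight, ← ENNReal.ofReal_mul h,
    ← ENNReal.ofReal_add (sq_nonneg _) (mul_nonneg h (sq_nonneg _))]

/-- The shear `(q, r) ↦ (q + σ r, r)`. -/
def shear (σ : ℝ) (y : ℝ × ℝ) : ℝ × ℝ := (y.1 + σ * y.2, y.2)

theorem measurable_shear (σ : ℝ) : Measurable (shear σ) := by unfold shear; fun_prop

theorem shear_neg_shear (σ : ℝ) (y : ℝ × ℝ) : shear (-σ) (shear σ y) = y := by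
  ext <;> simp [shear]

theorem shear_shear_neg (σ : ℝ) (y : ℝ × ℝ) : shear σ (shear (-σ) y) = y := by
  ext <;> simp [shear]

/-- For each fixed `r` the shear is a translation in `q`. -/
theorem lintegral_comp_shear (σ : ℝ) {F : ℝ × ℝ → ENNReal} (hF : Measurable F) :
    ∫⁻ y in halfPlane, F (shear σ y) = ∫⁻ y in halfPlane, F y := by
  rw [← lintegral_indicator measurableSet_halfPlane, ← lintegral_indicator measurableSet_halfPlane]
  have hG : Measurable (halfPlane.indicator F) := hF.indicator measurableSet_halfPlane
  have e : (halfPlane.indicator fun y => F (shear σ y)) =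
      fun y => halfPlane.indicator F (shear σ y) := rfl
  have hGs : Measurable fun y => halfPlane.indicator F (shear σ y) := hG.comp (measurable_shear σ)
  rw [e, Measure.volume_eq_prod, lintegral_prod_symm' _ hGs, lintegral_prod_symm' _ hG]
  exact lintegral_congr fun r =>
    lintegral_add_right_eq_self (fun q => halfPlane.indicator F (q, r)) (σ * r)

/-- The weight depends on `r` alone, so one amplitude may be sheared without the other. This places
the amplitudes that meet on the same segment at the same `y`, although its two ends carry different
labels. -/
theorem sqNorm_eq_shear (ħ σ : ℝ) {b a : ℝ × ℝ → ℂ} (hb : Measurable b) (ha : Measurable a) :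
    sqNorm ħ b a = ∫⁻ y in halfPlane, (‖b y‖ₑ ^ 2 + weight ħ y.2 * ‖a (shear σ y)‖ₑ ^ 2) := by
  rw [sqNorm_eq ħ hb, lintegral_add_left (hb.enorm.pow_const 2),
    ← lintegral_comp_shear σ (measurable_weight_mul (ħ := ħ) ha)]
  rfl

theorem sqNorm_eq_shear' (ħ σ : ℝ) {b a : ℝ × ℝ → ℂ} (hb : Measurable b) :
    sqNorm ħ b a = ∫⁻ y in halfPlane, (‖b (shear σ y)‖ₑ ^ 2 + weight ħ y.2 * ‖a y‖ₑ ^ 2) := by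
  have hb2 : Measurable fun y => ‖b y‖ₑ ^ 2 := hb.enorm.pow_const 2
  have hbs : Measurable fun y => ‖b (shear σ y)‖ₑ ^ 2 := hb2.comp (measurable_shear σ)
  rw [sqNorm_eq ħ hb, lintegral_add_left hbs, ← lintegral_comp_shear σ hb2]

/-- The amplitude of the image on half-lines. -/
def outFn (ħ : ℝ) (e e' : ℂ) (m : ℝ → ℝ) (σ : ℝ) (b a : ℝ × ℝ → ℂ) (y : ℝ × ℝ) : ℂ :=
  outAmp e e' (amp ħ y.2) (m (2 * y.2)) (b (shear σ y)) (a y)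

/-- The amplitude of the image on segments. -/
def retFn (ħ : ℝ) (e' : ℂ) (m : ℝ → ℝ) (σ : ℝ) (b a : ℝ × ℝ → ℂ) (y : ℝ × ℝ) : ℂ :=
  retAmp e' (amp ħ y.2) (m (2 * y.2)) (b y) (a (shear (-σ) y))

theorem retFn_shear (ħ : ℝ) (e' : ℂ) (m : ℝ → ℝ) (σ : ℝ) (b a : ℝ × ℝ → ℂ) (y : ℝ × ℝ) :
    retFn ħ e' m σ b a (shear σ y) =
      retAmp e' (amp ħ y.2) (m (2 * y.2)) (b (shear σ y)) (a y) := by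
  rw [retFn, shear_neg_shear]; rfl

/-! ### Isometry, contraction and convergence at the level of amplitudes. -/

section

variable {ħ : ℝ} {e e' : ℂ} {m : ℝ → ℝ} {σ : ℝ} {b a : ℝ × ℝ → ℂ}

theorem measurable_outFn (hm : Measurable m) (hb : Measurable b) (ha : Measurable a) :
    Measurable (outFn ħ e e' m σ b a) := by
  have h1 := measurable_amp ħ
  have h2 := measurable_shear σ
  unfold outFn outAmp
  fun_prop

theorem measurable_retFn (hm : Measurable m) (hb : Measurable b) (ha : Measurable a) :
    Measurable (retFn ħ e' m σ b a) := by
  have h1 := measurable_amp ħ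
  have h2 := measurable_shear (-σ)
  unfold retFn retAmp
  fun_prop

theorem outFn_add_retFn_le (hħ : 0 < ħ) (he : ‖e‖ = 1) (he' : ‖e'‖ = 1)
    (h01 : ∀ s, 0 ≤ s → m s ∈ Icc (0 : ℝ) 1) {y : ℝ × ℝ} (hy : 0 < y.2) :
    ‖outFn ħ e e' m σ b a y‖ₑ ^ 2 + weight ħ y.2 * ‖retFn ħ e' m σ b a (shear σ y)‖ₑ ^ 2 ≤
      ‖b (shear σ y)‖ₑ ^ 2 + weight ħ y.2 * ‖a y‖ₑ ^ 2 := by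
  rw [retFn_shear, outFn, enorm_add_weight_mul hħ hy.le, enorm_add_weight_mul hħ hy.le]
  exact ENNReal.ofReal_le_ofReal (norm_outAmp_add_le he he'
    (h01 _ (by linarith)) _ _)

theorem sqNorm_image_le (hħ : 0 < ħ) (he : ‖e‖ = 1) (he' : ‖e'‖ = 1) (hm : Measurable m)
    (h01 : ∀ s, 0 ≤ s → m s ∈ Icc (0 : ℝ) 1) (hb : Measurable b) (ha : Measurable a) :
    sqNorm ħ (outFn ħ e e' m σ b a) (retFn ħ e' m σ b a) ≤ sqNorm ħ b a := by
  rw [sqNorm_eq_shear ħ σ (measurable_outFn hm hb ha) (measurable_retFn hm hb ha),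
    sqNorm_eq_shear' ħ σ hb]
  exact setLIntegral_mono' measurableSet_halfPlane fun y hy => outFn_add_retFn_le hħ he he' h01 hy

theorem sqNorm_image_eq (hħ : 0 < ħ) (he : ‖e‖ = 1) (he' : ‖e'‖ = 1) (hm : Measurable m)
    (h1 : ∀ s, 0 ≤ s → m s = 1) (hb : Measurable b) (ha : Measurable a) :
    sqNorm ħ (outFn ħ e e' m σ b a) (retFn ħ e' m σ b a) = sqNorm ħ b a := by
  rw [sqNorm_eq_shear ħ σ (measurable_outFn hm hb ha) (measurable_retFn hm hb ha),
    sqNorm_eq_shear' ħ σ hb]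
  refine setLIntegral_congr_fun measurableSet_halfPlane fun y (hy : 0 < y.2) => ?_
  rw [retFn_shear, outFn, enorm_add_weight_mul hħ hy.le, enorm_add_weight_mul hħ hy.le,
    h1 _ (by linarith), norm_outAmp_add_eq he he']

theorem enorm_sub_sq_le (z w : ℂ) : ‖z - w‖ₑ ^ 2 ≤ 2 * ‖z‖ₑ ^ 2 + 2 * ‖w‖ₑ ^ 2 := by
  have h : ENNReal.ofReal 2 = 2 := by norm_num
  rw [enorm_sq_eq_ofReal, enorm_sq_eq_ofReal, enorm_sq_eq_ofReal, ← h,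
    ← ENNReal.ofReal_mul (by norm_num), ← ENNReal.ofReal_mul (by norm_num),
    ← ENNReal.ofReal_add (by positivity) (by positivity)]
  refine ENNReal.ofReal_le_ofReal ?_
  have := norm_sub_le z w
  nlinarith [norm_nonneg (z - w), sq_nonneg (‖z‖ - ‖w‖)]

/-- Dominated convergence of the amplitudes when the leak shrinks. -/
theorem tendsto_sqNorm_image_sub (hħ : 0 < ħ) (he : ‖e‖ = 1) (he' : ‖e'‖ = 1) {μ : ℝ → ℝ → ℝ}
    (hμm : ∀ ε, 0 ≤ ε → Measurable (μ ε)) (hμ01 : ∀ ε, 0 ≤ ε → ∀ s, 0 ≤ s → μ ε s ∈ Icc (0 : ℝ) 1)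
    (hμ1 : ∀ ε, 0 ≤ ε → ∀ s, 0 ≤ s → 2 * ε ≤ s → μ ε s = 1)
    (hb : Measurable b) (ha : Measurable a) (hfin : sqNorm ħ b a ≠ ⊤) :
    Tendsto (fun ε => sqNorm ħ (outFn ħ e e' (μ ε) σ b a - outFn ħ e e' (μ 0) σ b a)
      (retFn ħ e' (μ ε) σ b a - retFn ħ e' (μ 0) σ b a)) (𝓝[>] 0) (𝓝 0) := by
  have hoM := fun ε (hε : 0 ≤ ε) => measurable_outFn (ħ := ħ) (e := e) (e' := e') (σ := σ)
    (hμm ε hε) hb ha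
  have hrM := fun ε (hε : 0 ≤ ε) => measurable_retFn (ħ := ħ) (e' := e') (σ := σ) (hμm ε hε) hb ha
  let F : ℝ → ℝ × ℝ → ENNReal := fun ε y =>
    ‖outFn ħ e e' (μ ε) σ b a y - outFn ħ e e' (μ 0) σ b a y‖ₑ ^ 2 +
      weight ħ y.2 * ‖retFn ħ e' (μ ε) σ b a (shear σ y) - retFn ħ e' (μ 0) σ b a (shear σ y)‖ₑ ^ 2
  let G : ℝ × ℝ → ENNReal := fun y => ‖b (shear σ y)‖ₑ ^ 2 + weight ħ y.2 * ‖a y‖ₑ ^ 2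
  have hpos : ∀ᶠ ε : ℝ in 𝓝[>] 0, 0 < ε := self_mem_nhdsWithin
  have key : Tendsto (fun ε => ∫⁻ y in halfPlane, F ε y) (𝓝[>] 0)
      (𝓝 (∫⁻ _ in halfPlane, (0 : ENNReal))) := by
    -- The pointwise contraction estimate at `ε` and at `0` bounds each image by `G`; the square of
    -- a difference costs another factor `2` for each, hence `4 * G`.
    refine tendsto_lintegral_filter_of_dominated_convergence (fun y => 4 * G y) ?_ ?_ ?_ ?_
    · filter_upwards [hpos] with ε hε
      exact (((hoM ε hε.le).sub (hoM 0 le_rfl)).enorm.pow_const 2).add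
        (((measurable_weight ħ).comp measurable_snd).mul
        ((((hrM ε hε.le).comp (measurable_shear σ)).sub
          ((hrM 0 le_rfl).comp (measurable_shear σ))).enorm.pow_const 2))
    · filter_upwards [hpos] with ε hε
      rw [ae_restrict_iff' measurableSet_halfPlane]
      refine Eventually.of_forall fun y hy => ?_
      have h1 := outFn_add_retFn_le (σ := σ) (b := b) (a := a) hħ he he' (hμ01 ε hε.le) hy
      have h2 := outFn_add_retFn_le (σ := σ) (b := b) (a := a) hħ he he' (hμ01 0 le_rfl) hy
      calc F ε y ≤ (2 * ‖outFn ħ e e' (μ ε) σ b a y‖ₑ ^ 2 + 2 * ‖outFn ħ e e' (μ 0) σ b a y‖ₑ ^ 2) +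
            weight ħ y.2 * (2 * ‖retFn ħ e' (μ ε) σ b a (shear σ y)‖ₑ ^ 2 +
              2 * ‖retFn ħ e' (μ 0) σ b a (shear σ y)‖ₑ ^ 2) := by
            refine add_le_add (enorm_sub_sq_le _ _) ?_
            gcongr
            exact enorm_sub_sq_le _ _
        _ = 2 * (‖outFn ħ e e' (μ ε) σ b a y‖ₑ ^ 2 +
              weight ħ y.2 * ‖retFn ħ e' (μ ε) σ b a (shear σ y)‖ₑ ^ 2) +
            2 * (‖outFn ħ e e' (μ 0) σ b a y‖ₑ ^ 2 +
              weight ħ y.2 * ‖retFn ħ e' (μ 0) σ b a (shear σ y)‖ₑ ^ 2) := by ring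
        _ ≤ 2 * G y + 2 * G y := by gcongr
        _ = 4 * G y := by ring
    · rw [lintegral_const_mul' _ _ (by norm_num), ← sqNorm_eq_shear' ħ σ hb]
      exact ENNReal.mul_ne_top (by norm_num) hfin
    · rw [ae_restrict_iff' measurableSet_halfPlane]
      refine Eventually.of_forall fun y (hy : 0 < y.2) => ?_
      refine tendsto_const_nhds.congr' ?_
      -- For `ε < r` the transition function equals `1` at `2r`, so at a fixed label the difference
      -- is eventually exactly zero.
      filter_upwards [hpos, mem_nhdsWithin_of_mem_nhds (Iio_mem_nhds hy)] with ε hε hεy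
      have h1 : μ ε (2 * y.2) = 1 := hμ1 ε hε.le _ (by linarith) (by linarith [mem_Iio.1 hεy])
      have h0 : μ 0 (2 * y.2) = 1 := hμ1 0 le_rfl _ (by linarith) (by linarith)
      simp only [F, retFn_shear, outFn, h1, h0, sub_self]
      simp
  rw [lintegral_zero] at key
  refine key.congr' ?_
  filter_upwards [hpos] with ε hε
  rw [sqNorm_eq_shear ħ σ ((hoM ε hε.le).sub (hoM 0 le_rfl)) ((hrM ε hε.le).sub (hrM 0 le_rfl))]
  rfl

end

theorem norm_exp_I_mul (θ : ℝ) : ‖Complex.exp (Complex.I * θ)‖ = 1 := by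
  rw [mul_comm, Complex.norm_exp_ofReal_mul_I]

/-- The image in terms of amplitudes. -/
theorem imageForm_eq_plusForm (ħ θ₁ θ₂ : ℝ) (m : ℝ → ℝ) (f₁ f₃ f₄ f₅ : ℝ × ℝ → ℂ) :
    imageForm ħ θ₁ θ₂ m f₁ f₃ f₄ f₅ = plusForm ħ
      (outFn ħ (Complex.exp (Complex.I * θ₁)) (Complex.exp (Complex.I * θ₂)) m 1 f₁ f₄)
      (retFn ħ (Complex.exp (Complex.I * θ₁)) m (-1) f₅ f₃)
      (retFn ħ (Complex.exp (Complex.I * θ₂)) m 1 f₁ f₄)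
      (outFn ħ (Complex.exp (Complex.I * θ₂)) (Complex.exp (Complex.I * θ₁)) m (-1) f₅ f₃) := by
  funext x
  have h2 : ∀ r : ℝ, Real.exp (-2 * r / ħ) = amp ħ r ^ 2 := by
    intro r
    rw [amp_sq]; congr 1; rw [div_eq_mul_inv]; ring
  have h1 : ∀ r : ℝ, Real.exp (-r / ħ) = amp ħ r := by
    intro r
    rw [amp, neg_div_eq_neg_inv_mul]
  have h3 : ∀ r : ℝ, Real.exp (-ħ⁻¹ * r) = amp ħ r := fun _ => rfl
  ext ς
  revert ς
  rw [forall_spin]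
  refine ⟨rfl, rfl, ?_, ?_, ?_, rfl, ?_, rfl⟩ <;>
    simp only [imageForm, plusForm, chartA_form, chartB_form, chartM_form, chartM'_form, outFn,
      retFn, outAmp, retAmp, shear, h2, h1, h3] <;> push_cast <;> ring_nf

/-! ### The contraction -/

theorem extendedLimit_subset {H : Type*} [NormedAddCommGroup H] [InnerProductSpace ℂ H]
    [CompleteSpace H] {B C : ℝ → H →ₗ.[ℂ] H} (h : ∀ ε, 0 < ε → B ε = C ε) :
    extendedLimit B ⊆ extendedLimit C := by
  rintro ⟨x, y⟩ ⟨X, hX, hY⟩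
  have hex : ∀ ε, ∃ z : (C ε).domain, 0 < ε → (z : H) = X ε ∧ C ε z = B ε (X ε) := by
    intro ε
    by_cases hε : 0 < ε
    · rw [← h ε hε]
      exact ⟨X ε, fun _ => ⟨rfl, rfl⟩⟩
    · exact ⟨0, fun h' => absurd h' hε⟩
  choose Z hZ using hex
  have hpos : ∀ᶠ ε : ℝ in 𝓝[>] 0, 0 < ε := self_mem_nhdsWithin
  exact ⟨Z, hX.congr' (hpos.mono fun ε hε => ((hZ ε hε).1).symm),
    hY.congr' (hpos.mono fun ε hε => ((hZ ε hε).2).symm)⟩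

theorem extendedLimit_congr {H : Type*} [NormedAddCommGroup H] [InnerProductSpace ℂ H]
    [CompleteSpace H] {B C : ℝ → H →ₗ.[ℂ] H} (h : ∀ ε, 0 < ε → B ε = C ε) :
    extendedLimit B = extendedLimit C :=
  (extendedLimit_subset h).antisymm (extendedLimit_subset fun ε hε => (h ε hε).symm)

section

variable {ħ θ₁ θ₂ : ℝ} {m : ℝ → ℝ} {f₁ f₃ f₄ f₅ : ℝ × ℝ → ℂ}

/-- Transition functions enter only at distances, which are nonnegative. They may therefore be
replaced by their cut-off to `[0, ∞)`, which is measurable on the whole line. -/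
theorem leakyConditions_congr {m' : ℝ → ℝ} (h : ∀ s, 0 ≤ s → m s = m' s) :
    leakyConditions θ₁ θ₂ m = leakyConditions θ₁ θ₂ m' := by
  have e : ∀ x, m (dist₁₂ x) = m' (dist₁₂ x) := fun x => h _ (abs_nonneg _)
  simp only [leakyConditions, e]

theorem relS_pos {x : Config} (hx : x ∈ (S₁ : Set Config)) : 0 < relS x := half_pos (sub_pos.2 hx.1)
theorem relT_pos {x : Config} (hx : x ∈ (S₁ : Set Config)) : 0 < relT x := half_pos (sub_pos.2 hx.2)

theorem imageForm_congr {m' : ℝ → ℝ} (h : ∀ s, 0 ≤ s → m s = m' s) {x : Config}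
    (hx : x ∈ (S₁ : Set Config)) :
    imageForm ħ θ₁ θ₂ m f₁ f₃ f₄ f₅ x = imageForm ħ θ₁ θ₂ m' f₁ f₃ f₄ f₅ x := by
  have hs := relS_pos hx
  have ht := relT_pos hx
  simp only [imageForm, h (2 * relS x) (by linarith), h (2 * relT x) (by linarith),
    h (2 * (relS x + relT x)) (by linarith)]

theorem CharChart.form_congr (ch : CharChart) (c : ℝ) {f g : ℝ × ℝ → ℂ} (h : EqOn f g ch.base)
    {x : Config} (hx : x ∈ (S₁ : Set Config)) : ch.form c f x = ch.form c g x := by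
  rw [CharChart.form, CharChart.form, h (ch.mem_base_of_mem hx).1]

theorem plusForm_congr {g₂ g₃ g₄ g₆ g₂' g₃' g₄' g₆' : ℝ × ℝ → ℂ} (h₂ : EqOn g₂ g₂' halfPlane)
    (h₃ : EqOn g₃ g₃' halfPlane) (h₄ : EqOn g₄ g₄' halfPlane) (h₆ : EqOn g₆ g₆' halfPlane)
    {x : Config} (hx : x ∈ (S₁ : Set Config)) :
    plusForm ħ g₂ g₃ g₄ g₆ x = plusForm ħ g₂' g₃' g₄' g₆' x := by
  simp only [plusForm, chartA.form_congr _ h₂ hx, chartM.form_congr _ h₃ hx,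
    chartM'.form_congr _ h₄ hx, chartB.form_congr _ h₆ hx]

theorem measurable_imageForm (hm : Measurable m) (h₁ : Measurable f₁) (h₃ : Measurable f₃)
    (h₄ : Measurable f₄) (h₅ : Measurable f₅) :
    Measurable (imageForm ħ θ₁ θ₂ m f₁ f₃ f₄ f₅) := by
  rw [imageForm_eq_plusForm]
  exact measurable_plusForm (measurable_outFn hm h₁ h₄) (measurable_retFn hm h₅ h₃)
    (measurable_retFn hm h₁ h₄) (measurable_outFn hm h₅ h₃)

theorem lintegral_imageForm_le (hħ : 0 < ħ) (hm : Measurable m)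
    (h01 : ∀ s, 0 ≤ s → m s ∈ Icc (0 : ℝ) 1) (h₁ : Measurable f₁) (h₃ : Measurable f₃)
    (h₄ : Measurable f₄) (h₅ : Measurable f₅) :
    ∫⁻ x in (S₁ : Set Config), ‖imageForm ħ θ₁ θ₂ m f₁ f₃ f₄ f₅ x‖ₑ ^ 2 ≤
      ∫⁻ x in (S₁ : Set Config), ‖minusForm ħ f₁ f₃ f₄ f₅ x‖ₑ ^ 2 := by
  rw [imageForm_eq_plusForm, lintegral_minusForm hħ h₁ h₃ h₄ h₅,
    lintegral_plusForm hħ (measurable_outFn hm h₁ h₄) (measurable_retFn hm h₅ h₃)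
      (measurable_retFn hm h₁ h₄) (measurable_outFn hm h₅ h₃)]
  gcongr
  · exact sqNorm_image_le hħ (norm_exp_I_mul _) (norm_exp_I_mul _) hm h01 h₁ h₄
  · exact sqNorm_image_le hħ (norm_exp_I_mul _) (norm_exp_I_mul _) hm h01 h₅ h₃

theorem lintegral_imageForm_eq (hħ : 0 < ħ) (hm : Measurable m)
    (h1 : ∀ s, 0 ≤ s → m s = 1) (h₁ : Measurable f₁) (h₃ : Measurable f₃)
    (h₄ : Measurable f₄) (h₅ : Measurable f₅) :
    ∫⁻ x in (S₁ : Set Config), ‖imageForm ħ θ₁ θ₂ m f₁ f₃ f₄ f₅ x‖ₑ ^ 2 =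
      ∫⁻ x in (S₁ : Set Config), ‖minusForm ħ f₁ f₃ f₄ f₅ x‖ₑ ^ 2 := by
  rw [imageForm_eq_plusForm, lintegral_minusForm hħ h₁ h₃ h₄ h₅,
    lintegral_plusForm hħ (measurable_outFn hm h₁ h₄) (measurable_retFn hm h₅ h₃)
      (measurable_retFn hm h₁ h₄) (measurable_outFn hm h₅ h₃),
    sqNorm_image_eq hħ (norm_exp_I_mul _) (norm_exp_I_mul _) hm h1 h₁ h₄,
    sqNorm_image_eq hħ (norm_exp_I_mul _) (norm_exp_I_mul _) hm h1 h₅ h₃]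

theorem lintegral_waveFn_ne_top {Ψ : WaveFn} {F : Config → Spinor}
    (h : Ψ =ᵐ[volume.restrict (S₁ : Set Config)] F) :
    ∫⁻ x in (S₁ : Set Config), ‖F x‖ₑ ^ 2 ≠ ⊤ := by
  rw [← enorm_sq_waveFn h]
  exact ENNReal.pow_ne_top enorm_ne_top

/-- The trace equations form a triangular system. Two of them give the segment amplitudes `retFn`;
inserted into the other two, these turn `a + E (k e' b - E a)` into `(1 - E²) a + E k e' b`, the
bracket in `outAmp`. -/
theorem add_mem_leakyConditions_of_imageForm {Ψ Φ : WaveFn}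
    (hΨ : Ψ =ᵐ[volume.restrict (S₁ : Set Config)] minusForm ħ f₁ f₃ f₄ f₅)
    (hΦ : Φ =ᵐ[volume.restrict (S₁ : Set Config)] imageForm ħ θ₁ θ₂ m f₁ f₃ f₄ f₅) :
    Φ + Ψ ∈ leakyConditions θ₁ θ₂ m := by
  rw [imageForm_eq_plusForm] at hΦ
  refine add_mem_leakyConditions hΨ hΦ ?_ ?_ ?_ ?_ <;> intro q r _ <;>
    simp only [outFn, retFn, outAmp, retAmp, shear, one_mul, neg_mul, neg_neg, ← sub_eq_add_neg,
      add_sub_cancel_right, sub_add_cancel] <;> push_cast <;> ring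

theorem exists_image (hħ : 0 < ħ) (hm : Measurable m) (h01 : ∀ s, 0 ≤ s → m s ∈ Icc (0 : ℝ) 1)
    (h₁ : Measurable f₁) (h₃ : Measurable f₃) (h₄ : Measurable f₄) (h₅ : Measurable f₅)
    {Ψ : WaveFn} (hΨ : Ψ =ᵐ[volume.restrict (S₁ : Set Config)] minusForm ħ f₁ f₃ f₄ f₅) :
    ∃ Φ ∈ deficiency (hamiltonian ħ 0) Complex.I,
      Φ =ᵐ[volume.restrict (S₁ : Set Config)] imageForm ħ θ₁ θ₂ m f₁ f₃ f₄ f₅ ∧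
      Φ + Ψ ∈ leakyConditions θ₁ θ₂ m ∧ ‖Φ‖ ≤ ‖Ψ‖ := by
  have hle := lintegral_imageForm_le (θ₁ := θ₁) (θ₂ := θ₂) hħ hm h01 h₁ h₃ h₄ h₅
  have hL := memLp_of_lintegral_ne_top (measurable_imageForm (ħ := ħ) (θ₁ := θ₁) (θ₂ := θ₂)
    hm h₁ h₃ h₄ h₅) (ne_top_of_le_ne_top (lintegral_waveFn_ne_top hΨ) hle)
  have hΦ := hL.coeFn_toLp
  refine ⟨hL.toLp _, (mem_deficiency_I_iff hħ).2 ⟨_, _, _, _, measurable_outFn hm h₁ h₄,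
    measurable_retFn hm h₅ h₃, measurable_retFn hm h₁ h₄, measurable_outFn hm h₅ h₃,
    hΦ.trans (Eventually.of_forall fun x =>
      congrFun (imageForm_eq_plusForm ħ θ₁ θ₂ m f₁ f₃ f₄ f₅) x)⟩, hΦ,
    add_mem_leakyConditions_of_imageForm hΨ hΦ, ?_⟩
  rw [← enorm_sq_waveFn hΨ, ← enorm_sq_waveFn hΦ] at hle
  exact enorm_le_iff_norm_le.1 ((ENNReal.pow_le_pow_left_iff two_ne_zero).1 hle)

/-- The contraction that belongs to the boundary conditions. -/
theorem exists_contraction (hħ : 0 < ħ) (hm : Measurable m)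
    (h01 : ∀ s, 0 ≤ s → m s ∈ Icc (0 : ℝ) 1) :
    ∃ T : deficiency (hamiltonian ħ 0) (-Complex.I) →L[ℂ] deficiency (hamiltonian ħ 0) Complex.I,
      ‖T‖ ≤ 1 ∧ (∀ Ψ, (T Ψ : WaveFn) + Ψ ∈ leakyConditions θ₁ θ₂ m) ∧
      ∀ (Ψ : deficiency (hamiltonian ħ 0) (-Complex.I)) (f₁ f₃ f₄ f₅ : ℝ × ℝ → ℂ),
        Measurable f₁ → Measurable f₃ → Measurable f₄ → Measurable f₅ →
        (Ψ : WaveFn) =ᵐ[volume.restrict (S₁ : Set Config)] minusForm ħ f₁ f₃ f₄ f₅ →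
        (T Ψ : WaveFn) =ᵐ[volume.restrict (S₁ : Set Config)]
          imageForm ħ θ₁ θ₂ m f₁ f₃ f₄ f₅ := by
  -- Two candidates differ by an element of `Ker (i - Ĥ*)` that satisfies the boundary conditions,
  -- hence by zero. This makes the image independent of the chosen representatives `f₁, f₃, f₄, f₅`.
  have huniq : ∀ Ψ Φ Φ' : WaveFn, Φ ∈ deficiency (hamiltonian ħ 0) Complex.I →
      Φ' ∈ deficiency (hamiltonian ħ 0) Complex.I → Φ + Ψ ∈ leakyConditions θ₁ θ₂ m →
      Φ' + Ψ ∈ leakyConditions θ₁ θ₂ m → Φ = Φ' := by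
    intro Ψ Φ Φ' h h' hl hl'
    have hd := sub_mem hl hl'
    rw [add_sub_add_right_eq_sub] at hd
    exact sub_eq_zero.1 (eq_zero_of_mem_deficiency_of_mem_leakyConditions hħ (sub_mem h h') hd)
  have hex : ∀ Ψ : deficiency (hamiltonian ħ 0) (-Complex.I),
      ∃ Φ : deficiency (hamiltonian ħ 0) Complex.I,
        (Φ : WaveFn) + Ψ ∈ leakyConditions θ₁ θ₂ m ∧ ‖Φ‖ ≤ ‖Ψ‖ := by
    intro Ψ
    obtain ⟨f₁, f₃, f₄, f₅, h₁, h₃, h₄, h₅, hΨ⟩ := (mem_deficiency_neg_I_iff hħ).1 Ψ.2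
    obtain ⟨Φ, hΦ, -, hl, hn⟩ := exists_image (θ₁ := θ₁) (θ₂ := θ₂) hħ hm h01 h₁ h₃ h₄ h₅ hΨ
    exact ⟨⟨Φ, hΦ⟩, hl, hn⟩
  choose T hT hTn using hex
  -- Linearity follows from uniqueness, since the boundary conditions form a subspace. No linear
  -- choice of amplitudes is needed.
  let L : deficiency (hamiltonian ħ 0) (-Complex.I) →ₗ[ℂ] deficiency (hamiltonian ħ 0) Complex.I :=
    { toFun := T
      map_add' := fun x y => Subtype.ext (huniq _ _ _ (T (x + y)).2 (T x + T y).2 (hT _) (by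
        have := add_mem (hT x) (hT y)
        rw [add_add_add_comm] at this
        exact this))
      map_smul' := fun c x => Subtype.ext (huniq _ _ _ (T (c • x)).2 (c • T x).2 (hT _) (by
        have := Submodule.smul_mem _ c (hT x)
        rw [smul_add] at this
        exact this)) }
  refine ⟨L.mkContinuous 1 fun Ψ => (hTn Ψ).trans (one_mul _).ge,
    L.mkContinuous_norm_le zero_le_one _, hT, fun Ψ f₁ f₃ f₄ f₅ h₁ h₃ h₄ h₅ hΨ => ?_⟩
  obtain ⟨Φ, hΦ, hf, hl, -⟩ := exists_image (θ₁ := θ₁) (θ₂ := θ₂) hħ hm h01 h₁ h₃ h₄ h₅ hΨ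
  have : (T Ψ : WaveFn) = Φ := huniq _ _ _ (T Ψ).2 hΦ (hT Ψ) hl
  change (T Ψ : WaveFn) =ᵐ[_] _
  rwa [this]

/-- Without leak, incoming and outgoing amplitudes determine each other. -/
theorem exists_preimage {e e' : ℂ} (he : e ≠ 0) (he' : e' ≠ 0) (h1 : ∀ s, 0 ≤ s → m s = 1) (σ : ℝ)
    {g h : ℝ × ℝ → ℂ} (hg : Measurable g) (hh : Measurable h) :
    ∃ b a : ℝ × ℝ → ℂ, Measurable b ∧ Measurable a ∧
      EqOn g (outFn ħ e e' m σ b a) halfPlane ∧ EqOn h (retFn ħ e' m σ b a) halfPlane := by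
  have hA := measurable_amp ħ
  have hs := measurable_shear σ
  have hs' := measurable_shear (-σ)
  have hE : Measurable fun y : ℝ × ℝ => (amp ħ y.2 : ℂ) :=
    Complex.measurable_ofReal.comp (hA.comp measurable_snd)
  -- The matrix with rows `(E, 1 - E²)` and `(1, -E)` is its own inverse. It is applied to `(e⁻¹ g,
  -- h)`, with the shears undone and the phase `e'` removed from `b`.
  refine ⟨fun y => e'⁻¹ * (amp ħ y.2 * (e⁻¹ * g (shear (-σ) y)) + (1 - (amp ħ y.2 : ℂ) ^ 2) * h y),
    fun y => e⁻¹ * g y - amp ħ y.2 * h (shear σ y), ?_, ?_, ?_, ?_⟩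
  · fun_prop
  · fun_prop
  · intro y (hy : 0 < y.2)
    have hk : m (2 * y.2) = 1 := h1 _ (by linarith)
    simp only [outFn, outAmp, hk, shear_neg_shear]
    simp only [shear]
    push_cast
    field_simp
    ring
  · intro y (hy : 0 < y.2)
    have hk : m (2 * y.2) = 1 := h1 _ (by linarith)
    simp only [retFn, retAmp, hk, shear_shear_neg]
    simp only [shear]
    push_cast
    field_simp
    ring

end

/-! ### Unitarity without leak and strong convergence. -/

section

variable {ħ θ₁ θ₂ : ℝ} {m : ℝ → ℝ}

/-- `T` is given by the explicit formula. -/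
def HasImageForm (ħ θ₁ θ₂ : ℝ) (m : ℝ → ℝ)
    (T : deficiency (hamiltonian ħ 0) (-Complex.I) →L[ℂ] deficiency (hamiltonian ħ 0) Complex.I) :
    Prop :=
  ∀ (Ψ : deficiency (hamiltonian ħ 0) (-Complex.I)) (f₁ f₃ f₄ f₅ : ℝ × ℝ → ℂ),
    Measurable f₁ → Measurable f₃ → Measurable f₄ → Measurable f₅ →
    (Ψ : WaveFn) =ᵐ[volume.restrict (S₁ : Set Config)] minusForm ħ f₁ f₃ f₄ f₅ →
    (T Ψ : WaveFn) =ᵐ[volume.restrict (S₁ : Set Config)] imageForm ħ θ₁ θ₂ m f₁ f₃ f₄ f₅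

theorem HasImageForm.congr {m' : ℝ → ℝ}
    {T : deficiency (hamiltonian ħ 0) (-Complex.I) →L[ℂ] deficiency (hamiltonian ħ 0) Complex.I}
    (hT : HasImageForm ħ θ₁ θ₂ m T) (h : ∀ s, 0 ≤ s → m s = m' s) : HasImageForm ħ θ₁ θ₂ m' T := by
  intro Ψ f₁ f₃ f₄ f₅ h₁ h₃ h₄ h₅ hΨ
  refine (hT Ψ f₁ f₃ f₄ f₅ h₁ h₃ h₄ h₅ hΨ).trans ?_
  rw [Filter.EventuallyEq, ae_restrict_iff' measurableSet_S₁]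
  exact Eventually.of_forall fun x hx => imageForm_congr h hx

variable {T : deficiency (hamiltonian ħ 0) (-Complex.I) →L[ℂ]
  deficiency (hamiltonian ħ 0) Complex.I}

theorem HasImageForm.norm_map (hħ : 0 < ħ) (hm : Measurable m) (h1 : ∀ s, 0 ≤ s → m s = 1)
    (hT : HasImageForm ħ θ₁ θ₂ m T) (Ψ : deficiency (hamiltonian ħ 0) (-Complex.I)) :
    ‖T Ψ‖ = ‖Ψ‖ := by
  obtain ⟨f₁, f₃, f₄, f₅, h₁, h₃, h₄, h₅, hΨ⟩ := (mem_deficiency_neg_I_iff hħ).1 Ψ.2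
  have h := lintegral_imageForm_eq (θ₁ := θ₁) (θ₂ := θ₂) hħ hm h1 h₁ h₃ h₄ h₅
  rw [← enorm_sq_waveFn hΨ, ← enorm_sq_waveFn (hT Ψ f₁ f₃ f₄ f₅ h₁ h₃ h₄ h₅ hΨ)] at h
  exact le_antisymm
    (enorm_le_iff_norm_le.1 ((ENNReal.pow_le_pow_left_iff two_ne_zero).1 h.le))
    (enorm_le_iff_norm_le.1 ((ENNReal.pow_le_pow_left_iff two_ne_zero).1 h.ge))

theorem HasImageForm.surjective (hħ : 0 < ħ) (hm : Measurable m) (h1 : ∀ s, 0 ≤ s → m s = 1)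
    (hT : HasImageForm ħ θ₁ θ₂ m T) : Function.Surjective T := by
  intro Φ
  obtain ⟨g₂, g₃, g₄, g₆, h₂, h₃, h₄, h₆, hΦ⟩ := (mem_deficiency_I_iff hħ).1 Φ.2
  obtain ⟨f₁, f₄, hf₁, hf₄, e₂, e₄⟩ := exists_preimage (ħ := ħ) (Complex.exp_ne_zero (Complex.I * θ₁))
    (Complex.exp_ne_zero (Complex.I * θ₂)) h1 1 h₂ h₄
  obtain ⟨f₅, f₃, hf₅, hf₃, e₆, e₃⟩ := exists_preimage (ħ := ħ) (Complex.exp_ne_zero (Complex.I * θ₂))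
    (Complex.exp_ne_zero (Complex.I * θ₁)) h1 (-1) h₆ h₃
  have hΦ' : (Φ : WaveFn) =ᵐ[volume.restrict (S₁ : Set Config)]
      imageForm ħ θ₁ θ₂ m f₁ f₃ f₄ f₅ := by
    refine hΦ.trans ?_
    rw [Filter.EventuallyEq, ae_restrict_iff' measurableSet_S₁]
    refine Eventually.of_forall fun x hx => ?_
    rw [imageForm_eq_plusForm]
    exact plusForm_congr e₂ e₃ e₄ e₆ hx
  -- The amplitudes of the preimage are only known to be measurable. Square integrability is read
  -- backwards from the equality of norms.
  have hL : MemLp (minusForm ħ f₁ f₃ f₄ f₅) 2 (volume.restrict (S₁ : Set Config)) := by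
    refine memLp_of_lintegral_ne_top (measurable_minusForm hf₁ hf₃ hf₄ hf₅) ?_
    rw [← lintegral_imageForm_eq (θ₁ := θ₁) (θ₂ := θ₂) hħ hm h1 hf₁ hf₃ hf₄ hf₅]
    exact lintegral_waveFn_ne_top hΦ'
  refine ⟨⟨hL.toLp _, (mem_deficiency_neg_I_iff hħ).2
    ⟨f₁, f₃, f₄, f₅, hf₁, hf₃, hf₄, hf₅, hL.coeFn_toLp⟩⟩, Subtype.ext (Lp.ext ?_)⟩
  exact (hT _ f₁ f₃ f₄ f₅ hf₁ hf₃ hf₄ hf₅ hL.coeFn_toLp).trans hΦ'.symm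

/-- The squared norm of `T ε Ψ - T 0 Ψ` is a constant times the `sqNorm` of the differences of the
image amplitudes, to which `tendsto_sqNorm_image_sub` applies pair by pair. -/
theorem tendsto_of_hasImageForm (hħ : 0 < ħ) {μ : ℝ → ℝ → ℝ}
    (hμm : ∀ ε, 0 ≤ ε → Measurable (μ ε)) (hμ01 : ∀ ε, 0 ≤ ε → ∀ s, 0 ≤ s → μ ε s ∈ Icc (0 : ℝ) 1)
    (hμ1 : ∀ ε, 0 ≤ ε → ∀ s, 0 ≤ s → 2 * ε ≤ s → μ ε s = 1)
    {T : ℝ → (deficiency (hamiltonian ħ 0) (-Complex.I) →L[ℂ]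
      deficiency (hamiltonian ħ 0) Complex.I)}
    (hT : ∀ ε, 0 ≤ ε → HasImageForm ħ θ₁ θ₂ (μ ε) (T ε))
    (Ψ : deficiency (hamiltonian ħ 0) (-Complex.I)) :
    Tendsto (fun ε => T ε Ψ) (𝓝[>] 0) (𝓝 (T 0 Ψ)) := by
  obtain ⟨f₁, f₃, f₄, f₅, h₁, h₃, h₄, h₅, hΨ⟩ := (mem_deficiency_neg_I_iff hħ).1 Ψ.2
  have hC : 4 * ENNReal.ofReal (ħ / 2) ≠ ⊤ := ENNReal.mul_ne_top (by norm_num) (by simp)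
  have hC0 : 4 * ENNReal.ofReal (ħ / 2) ≠ 0 := by simp [hħ]
  have hfin := lintegral_waveFn_ne_top hΨ
  rw [lintegral_minusForm hħ h₁ h₃ h₄ h₅] at hfin
  have hfin' : sqNorm ħ f₁ f₄ + sqNorm ħ f₅ f₃ ≠ ⊤ := fun h => hfin (by
    rw [h, ENNReal.mul_top hC0])
  have l₁ := tendsto_sqNorm_image_sub (σ := 1) hħ (norm_exp_I_mul θ₁) (norm_exp_I_mul θ₂) hμm hμ01 hμ1
    h₁ h₄ (ENNReal.add_ne_top.1 hfin').1
  have l₂ := tendsto_sqNorm_image_sub (σ := -1) hħ (norm_exp_I_mul θ₂) (norm_exp_I_mul θ₁) hμm hμ01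
    hμ1 h₅ h₃ (ENNReal.add_ne_top.1 hfin').2
  have l := ENNReal.Tendsto.const_mul (l₁.add l₂) (Or.inr hC)
  rw [add_zero, mul_zero] at l
  have hsq : Tendsto (fun ε => ‖T ε Ψ - T 0 Ψ‖ₑ ^ 2) (𝓝[>] 0) (𝓝 0) := by
    refine l.congr' ?_
    have hpos : ∀ᶠ ε : ℝ in 𝓝[>] 0, 0 < ε := self_mem_nhdsWithin
    filter_upwards [hpos] with ε hε
    have hε0 := hT ε hε.le Ψ f₁ f₃ f₄ f₅ h₁ h₃ h₄ h₅ hΨ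
    have h00 := hT 0 le_rfl Ψ f₁ f₃ f₄ f₅ h₁ h₃ h₄ h₅ hΨ
    have hd := (Lp.coeFn_sub (T ε Ψ : WaveFn) (T 0 Ψ : WaveFn)).trans (hε0.sub h00)
    have hd' := enorm_sq_waveFn hd
    simp only [Pi.sub_apply, imageForm_eq_plusForm, plusForm_sub] at hd'
    have mO := fun ε hε => measurable_outFn (ħ := ħ) (e := Complex.exp (Complex.I * θ₁))
      (e' := Complex.exp (Complex.I * θ₂)) (σ := 1) (hμm ε hε) h₁ h₄
    have mO' := fun ε hε => measurable_outFn (ħ := ħ) (e := Complex.exp (Complex.I * θ₂))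
      (e' := Complex.exp (Complex.I * θ₁)) (σ := -1) (hμm ε hε) h₅ h₃
    have mR := fun ε hε => measurable_retFn (ħ := ħ)
      (e' := Complex.exp (Complex.I * θ₂)) (σ := 1) (hμm ε hε) h₁ h₄
    have mR' := fun ε hε => measurable_retFn (ħ := ħ)
      (e' := Complex.exp (Complex.I * θ₁)) (σ := -1) (hμm ε hε) h₅ h₃
    rw [lintegral_plusForm hħ ((mO ε hε.le).sub (mO 0 le_rfl)) ((mR' ε hε.le).sub (mR' 0 le_rfl))
      ((mR ε hε.le).sub (mR 0 le_rfl)) ((mO' ε hε.le).sub (mO' 0 le_rfl))] at hd'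
    exact hd'.symm
  have hroot := (ENNReal.continuous_rpow_const (y := 1 / 2)).tendsto 0 |>.comp hsq
  rw [tendsto_iff_edist_tendsto_0]
  simp_rw [edist_eq_enorm_sub]
  rw [ENNReal.zero_rpow_of_pos (by norm_num)] at hroot
  refine hroot.congr fun ε => ?_
  rw [Function.comp_apply, ← ENNReal.rpow_natCast, ← ENNReal.rpow_mul]
  norm_num

end

theorem IsTransition.measurable_indicator {ε : ℝ} {m : ℝ → ℝ} (h : IsTransition ε m) :
    Measurable ((Ici (0 : ℝ)).indicator m) := by
  classical
  rw [← piecewise_eq_indicator]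
  exact h.smooth.continuousOn.measurable_piecewise continuousOn_const measurableSet_Ici

end LeakyBoundary
end

/-! ### The main theorem. -/

theorem mainTheorem4 (ħ : ℝ) (hħ : 0 < ħ) (θ₁ θ₂ : ℝ) (μ : ℝ → ℝ → ℝ)
    (hμ : ∀ ε, 0 < ε → LeakyBoundary.IsTransition ε (μ ε))
    (hμ0 : ∀ s, 0 ≤ s → μ 0 s = 1) :
    -- the leaky operators are maximally dissipative extensions
    (∀ ε, 0 ≤ ε →
      LeakyBoundary.IsMaximallyDissipative
        ((-Complex.I / (ħ : ℂ)) • LeakyBoundary.leakyHamiltonian ħ θ₁ θ₂ (μ ε)) ∧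
      (-Complex.I / (ħ : ℂ)) • LeakyBoundary.hamiltonian ħ 0 ≤
        (-Complex.I / (ħ : ℂ)) • LeakyBoundary.leakyHamiltonian ħ θ₁ θ₂ (μ ε)) ∧
    -- the elements of `Ker (i + Ĥ*)`
    (∀ Ψ : LeakyBoundary.WaveFn,
      Ψ ∈ LeakyBoundary.deficiency (LeakyBoundary.hamiltonian ħ 0) (-Complex.I) ↔
        ∃ f₁ f₃ f₄ f₅ : ℝ × ℝ → ℂ, Measurable f₁ ∧ Measurable f₃ ∧ Measurable f₄ ∧ Measurable f₅ ∧
          Ψ =ᵐ[MeasureTheory.volume.restrict (LeakyBoundary.S₁ : Set LeakyBoundary.Config)]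
            LeakyBoundary.minusForm ħ f₁ f₃ f₄ f₅) ∧
    -- the associated contractions
    ∃ T : ℝ → (LeakyBoundary.deficiency (LeakyBoundary.hamiltonian ħ 0) (-Complex.I) →L[ℂ]
        LeakyBoundary.deficiency (LeakyBoundary.hamiltonian ħ 0) Complex.I),
      (∀ ε, 0 ≤ ε →
        ‖T ε‖ ≤ 1 ∧
        LeakyBoundary.leakyHamiltonian ħ θ₁ θ₂ (μ ε) =
          LeakyBoundary.extensionOf (LeakyBoundary.hamiltonian ħ 0) (T ε) ∧
        ∀ (Ψ : LeakyBoundary.deficiency (LeakyBoundary.hamiltonian ħ 0) (-Complex.I))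
          (f₁ f₃ f₄ f₅ : ℝ × ℝ → ℂ),
          Measurable f₁ → Measurable f₃ → Measurable f₄ → Measurable f₅ →
          (Ψ : LeakyBoundary.WaveFn)
            =ᵐ[MeasureTheory.volume.restrict (LeakyBoundary.S₁ : Set LeakyBoundary.Config)]
              LeakyBoundary.minusForm ħ f₁ f₃ f₄ f₅ →
          (T ε Ψ : LeakyBoundary.WaveFn)
            =ᵐ[MeasureTheory.volume.restrict (LeakyBoundary.S₁ : Set LeakyBoundary.Config)]
              LeakyBoundary.imageForm ħ θ₁ θ₂ (μ ε) f₁ f₃ f₄ f₅) ∧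
      -- `T 0` is unitary, and the operator without leak is a self-adjoint extension
      (∃ U : LeakyBoundary.deficiency (LeakyBoundary.hamiltonian ħ 0) (-Complex.I) ≃ₗᵢ[ℂ]
        LeakyBoundary.deficiency (LeakyBoundary.hamiltonian ħ 0) Complex.I, ∀ Ψ, T 0 Ψ = U Ψ) ∧
      IsSelfAdjoint (LeakyBoundary.leakyHamiltonian ħ θ₁ θ₂ (μ 0)) ∧
      LeakyBoundary.hamiltonian ħ 0 ≤ LeakyBoundary.leakyHamiltonian ħ θ₁ θ₂ (μ 0) ∧
      -- strong convergence of the contractions, and the extended limit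
      (∀ Ψ, Filter.Tendsto (fun ε => T ε Ψ) (nhdsWithin 0 (Set.Ioi 0)) (nhds (T 0 Ψ))) ∧
      LeakyBoundary.extendedLimit
          (fun ε => (-Complex.I / (ħ : ℂ)) • LeakyBoundary.leakyHamiltonian ħ θ₁ θ₂ (μ ε)) =
        (((-Complex.I / (ħ : ℂ)) • LeakyBoundary.leakyHamiltonian ħ θ₁ θ₂ (μ 0)).graph :
          Set (LeakyBoundary.WaveFn × LeakyBoundary.WaveFn)) := by
  classical
  let A := LeakyBoundary.hamiltonian ħ 0
  have hA : Dense (A.domain : Set LeakyBoundary.WaveFn) := LeakyBoundary.dense_domain_hamiltonian ħ 0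
  have hs : A ≤ A† := LeakyBoundary.hamiltonian_le_adjoint hħ
  -- Nothing is assumed about `μ ε` on the negative axis, so measurability is available only after
  -- cutting it off there.
  let ν : ℝ → ℝ → ℝ := fun ε => (Ici (0 : ℝ)).indicator (μ ε)
  have hν : ∀ ε s, 0 ≤ s → ν ε s = μ ε s := fun ε s h => indicator_of_mem (mem_Ici.2 h) _
  have hν0 : ∀ s, 0 ≤ s → ν 0 s = 1 := fun s h => (hν 0 s h).trans (hμ0 s h)
  have hνm : ∀ ε, 0 ≤ ε → Measurable (ν ε) := by
    intro ε hε
    rcases hε.eq_or_lt with rfl | hε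
    · have : ν 0 = (Ici (0 : ℝ)).indicator fun _ => 1 :=
        indicator_congr fun s hs => hμ0 s hs
      rw [this]
      exact measurable_const.indicator measurableSet_Ici
    · exact (hμ ε hε).measurable_indicator
  have hν01 : ∀ ε, 0 ≤ ε → ∀ s, 0 ≤ s → ν ε s ∈ Icc (0 : ℝ) 1 := by
    intro ε hε s h
    rcases hε.eq_or_lt with rfl | hε
    · rw [hν0 s h]
      exact right_mem_Icc.2 zero_le_one
    · rw [hν ε s h]
      exact (hμ ε hε).mem_Icc s h
  have hν1 : ∀ ε, 0 ≤ ε → ∀ s, 0 ≤ s → 2 * ε ≤ s → ν ε s = 1 := by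
    intro ε hε s h hεs
    rcases hε.eq_or_lt with rfl | hε
    · exact hν0 s h
    · rw [hν ε s h]
      exact (hμ ε hε).eq_one s hεs
  have hex : ∀ ε, ∃ T : LeakyBoundary.deficiency A (-Complex.I) →L[ℂ]
      LeakyBoundary.deficiency A Complex.I, 0 ≤ ε → ‖T‖ ≤ 1 ∧
        LeakyBoundary.leakyHamiltonian ħ θ₁ θ₂ (μ ε) = LeakyBoundary.extensionOf A T ∧
        LeakyBoundary.HasImageForm ħ θ₁ θ₂ (ν ε) T := by
    intro ε
    by_cases hε : 0 ≤ ε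
    · obtain ⟨T, hT1, hT2, hT3⟩ := LeakyBoundary.exists_contraction (θ₁ := θ₁) (θ₂ := θ₂) hħ
        (hνm ε hε) (hν01 ε hε)
      refine ⟨T, fun _ => ⟨hT1, ?_, hT3⟩⟩
      rw [LeakyBoundary.leakyHamiltonian,
        ← LeakyBoundary.leakyConditions_congr (m := ν ε) (hν ε)]
      exact LeakyBoundary.domRestrict_eq_extensionOf hA hs T
        (LeakyBoundary.closure_domain_le_leakyConditions hħ) hT2
        fun _ => LeakyBoundary.eq_zero_of_mem_deficiency_of_mem_leakyConditions hħ
    · exact ⟨0, fun h => absurd h hε⟩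
  -- For negative `ε` the map is the arbitrary value `0`; the limits only see `ε > 0`.
  choose T hT using hex
  have hU := (hT 0 le_rfl).2.2.norm_map hħ (hνm 0 le_rfl) hν0
  have hsurj := (hT 0 le_rfl).2.2.surjective hħ (hνm 0 le_rfl) hν0
  have hlim := LeakyBoundary.tendsto_of_hasImageForm hħ hνm hν01 hν1 fun ε hε => (hT ε hε).2.2
  have hħ' : -Complex.I / (ħ : ℂ) ≠ 0 :=
    div_ne_zero (neg_ne_zero.2 Complex.I_ne_zero) (by exact_mod_cast hħ.ne')
  refine ⟨fun ε hε => ?_, fun Ψ => LeakyBoundary.mem_deficiency_neg_I_iff hħ, T, fun ε hε =>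
    ⟨(hT ε hε).1, (hT ε hε).2.1, (hT ε hε).2.2.congr (hν ε)⟩, ?_, ?_, ?_, hlim, ?_⟩
  · rw [(hT ε hε).2.1]
    exact ⟨LeakyBoundary.isMaximallyDissipative_extensionOf hA hs (hT ε hε).1 hħ,
      LeakyBoundary.smul_le_smul _ (LeakyBoundary.le_extensionOf hA hs _)⟩
  · exact ⟨LinearIsometryEquiv.ofSurjective ⟨(T 0).toLinearMap, hU⟩ hsurj, fun _ => rfl⟩
  · rw [(hT 0 le_rfl).2.1]
    exact LeakyBoundary.isSelfAdjoint_extensionOf hA hs hU hsurj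
  · rw [(hT 0 le_rfl).2.1]
    exact LeakyBoundary.le_extensionOf hA hs _
  · rw [(hT 0 le_rfl).2.1, ← LeakyBoundary.extendedLimit_extensionOf hA hs
      (fun ε hε => (hT ε hε.le).1) hlim hħ']
    exact LeakyBoundary.extendedLimit_congr fun ε hε => by rw [(hT ε hε.le).2.1]
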